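/- Let $\Sigma=\{0,1\}$. All machines below are nondeterministic polynomial-time Turing machines (NPTMs) whose nondeterministic moves are guesses of single bits; a computation path of $M$ on input $x$ is named by the string of bits guessed along it, $\mathrm{acc}_M(x)$ is the set of accepting paths of $M$ on $x$, and $\#\mathrm{acc}_M(x)$ is its cardinality. For a polynomial $p$ (with values in $\mathbb N$ on $\mathbb N$), $M$ is $p$-balanced if for every input $x$ the set of its computation paths on $x$ is exactly $\Sigma^{p(|x|)}$. Write $<_{\rm lex}$ for the lexicographical order on $\Sigma^*$ (shorter strings first), $\leq_{\rm lex}$ for its reflexive closure, and $a\prec_{\rm lex}b$ if $b$ is the immediate successor of $a$ in this order. $\mathrm{FP_t}$ is the class of total polynomial-time computable functions $\Sigma^*\to\Sigma^*$. $\mathrm{UP}$ is the class of languages $L\subseteq\Sigma^*$ for which there is an NPTM that has at most one accepting path on every input and that has an accepting path on input $x$ exactly if $x\in L$; $\mathrm{coUP}=\{L : \Sigma^*\setminus L\in\mathrm{UP}\}$. A total function $f:\Sigma^*\to\mathbb N$ belongs to $\mathrm{CLU\#P_{free}}$ if there are a polynomial $p$, a $p$-balanced NPTM $M$ and a polynomial-time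 computable predicate $\prec$ with three string arguments such that for every $x\in\Sigma^*$ there is a bijection $h_x:\Sigma^{p(|x|)}\to\Sigma^{p(|x|)}$ such that (i) for all $y,z\in\Sigma^{p(|x|)}$: ${\prec}(x,y,z)$ holds if and only if $h_x(y)\prec_{\rm lex}h_x(z)$; (ii) if $f(x)\neq 0$, then there are $\ell,u\in\Sigma^{p(|x|)}$ with $\mathrm{acc}_M(x)=\{w\in\Sigma^{p(|x|)} : h_x(\ell)\leq_{\rm lex}h_x(w)\leq_{\rm lex}h_x(u)\}$; (iii) $f(x)=\#\mathrm{acc}_M(x)$. $\mathrm{CLU\#P}$ is defined in the same way, except that there must moreover be functions $b,\top\in\mathrm{FP_t}$ such that for every $x$, $|b(x)|=|\top(x)|=p(|x|)$, $h_x(b(x))=0^{p(|x|)}$ and $h_x(\top(x))=1^{p(|x|)}$. $\mathrm{CLU\#P_{circular}}$ is defined in the same way as $\mathrm{CLU\#P_{free}}$, except that (i) is replaced by: for all $y,z\in\Sigma^{p(|x|)}$, ${\prec}(x,y,z)$ holds if and only if $h_x(y)\prec_{\rm lex}h_x(z)$ or ($h_x(y)=1^{p(|x|)}$ and $h_x(z)=0^{p(|x|)}$).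 **Theorem.** The following are equivalent: 1. $\mathrm{UP}=\mathrm{coUP}$; 2. $\mathrm{CLU\#P_{free}}=\mathrm{CLU\#P}$; 3. $\mathrm{CLU\#P_{free}}\subseteq\mathrm{CLU\#P_{circular}}$. -/

import Mathlib

namespace Cluster

/-- Strings over the alphabet `{0,1}`; `false` is `0` and `true` is `1`. -/
abbrev Str := List Bool

/-- `{0,1}^n`. -/
def words (n : ℕ) : Set Str := {w | w.length = n}

/-! ### Lexicographical order (shorter strings first) -/

/-- `a` strictly precedes `b` in the lexicographical order on `{0,1}*`: shorter strings come
first, strings of equal length are compared bit by bit. -/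
def lexLt (a b : Str) : Prop := List.Shortlex (· < ·) a b

/-- `a ≤ b` in the lexicographical order. -/
def lexLe (a b : Str) : Prop := a = b ∨ lexLt a b

/-- `b` is the (immediate) lexicographical successor of `a`. -/
def lexSucc (a b : Str) : Prop := lexLt a b ∧ ¬ ∃ c, lexLt a c ∧ lexLt c b

/-! ### Polynomials and deterministic polynomial time -/

/-- `p : ℕ → ℕ` is (the restriction of) a polynomial. The coefficients need not be natural
numbers; only the values are required to be. -/
def IsPolynomial (p : ℕ → ℕ) : Prop :=
  ∃ P : Polynomial ℝ, ∀ n : ℕ, (p n : ℝ) = P.eval (n : ℝ)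

/-- Total functions from strings to strings computable in polynomial time. -/
def FPt : Set (Str → Str) :=
  {g | Nonempty (Turing.TM2ComputableInPolyTime (fun x : Str => x) (fun y : Str => y) g)}

/-- The encoding `x#y#z` of a triple of strings over the alphabet `{0,1,#}`, with `#` being
`none`. -/
def encTriple (t : Str × Str × Str) : List (Option Bool) :=
  t.1.map some ++ none :: (t.2.1.map some ++ none :: t.2.2.map some)

/-- Polynomial-time computable three-argument predicates on strings. -/
def PolyPred₃ : Set (Str → Str → Str → Bool) :=
  {R | Nonempty (Turing.TM2ComputableInPolyTime encTriple Computability.encodeBool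
    (fun t : Str × Str × Str => R t.1 t.2.1 t.2.2))}

/-! ### Nondeterministic Turing machines -/

/-- A nondeterministic Turing machine with binary guesses: the (finite, multi-stack) Turing
machine `tm`, over the input alphabet `{0,1}`, with an additional second statement `alt l` at
some of its labels `l`. At a label without second statement the machine is deterministic; at a
label with second statement it guesses a bit. Acceptance of a halting computation is decided by
the internal state; the output stack of `tm` plays no role. -/
structure NTM where
  /-- the underlying machine -/
  tm : Turing.FinTM2
  /-- the input alphabet is `{0,1}` -/
  inputAlphabet : tm.Γ tm.k₀ ≃ Bool
  /-- the statement executed after guessing the bit `1`, at the labels where a bit is guessed -/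
  alt : tm.Λ → Option tm.Stmt
  /-- the accepting internal states -/
  accept : Set tm.σ

namespace NTM

variable (M : NTM)

/-- The initial configuration on input `x`. -/
def init (x : Str) : M.tm.Cfg := Turing.initList M.tm (x.map M.inputAlphabet.symm)

/-- `M.Run c w n d`: from configuration `c`, the machine can get to configuration `d` in exactly
`n` steps, the sequence of bits guessed on the way being `w`. -/
inductive Run : M.tm.Cfg → List Bool → ℕ → M.tm.Cfg → Prop
  /-- the empty computation -/
  | refl (c : M.tm.Cfg) : Run c [] 0 c
  /-- a deterministic step -/
  | det {l : M.tm.Λ} {v : M.tm.σ} {S : ∀ k, List (M.tm.Γ k)} {w : List Bool} {n : ℕ}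
      {d : M.tm.Cfg} (hl : M.alt l = none)
      (h : Run (Turing.TM2.stepAux (M.tm.m l) v S) w n d) :
      Run ⟨some l, v, S⟩ w (n + 1) d
  /-- a step that guesses the bit `b` -/
  | guess {l : M.tm.Λ} {v : M.tm.σ} {S : ∀ k, List (M.tm.Γ k)} {w : List Bool} {n : ℕ}
      {d : M.tm.Cfg} {s : M.tm.Stmt} (b : Bool) (hl : M.alt l = some s)
      (h : Run (Turing.TM2.stepAux (cond b s (M.tm.m l)) v S) w n d) :
      Run ⟨some l, v, S⟩ (b :: w) (n + 1) d

/-- The machine is polynomial-time: on every input, the lengths of all its computations are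
bounded by a polynomial in the length of the input. -/
def PolyTime : Prop :=
  ∃ t : Polynomial ℕ, ∀ (x : Str) (w : List Bool) (n : ℕ) (d : M.tm.Cfg),
    M.Run (M.init x) w n d → n ≤ t.eval x.length

/-- The computation paths on input `x`, each named by its sequence of guesses. -/
def paths (x : Str) : Set Str :=
  {w | ∃ (n : ℕ) (d : M.tm.Cfg), M.Run (M.init x) w n d ∧ d.l = none}

/-- The accepting computation paths on input `x`. -/
def acc (x : Str) : Set Str :=
  {w | ∃ (n : ℕ) (d : M.tm.Cfg), M.Run (M.init x) w n d ∧ d.l = none ∧ d.var ∈ M.accept}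

/-- The number of accepting computation paths on input `x`. -/
noncomputable def numAcc (x : Str) : ℕ := (M.acc x).ncard

/-- `M` is `p`-balanced: on every input `x`, the set of guess sequences along the computation
paths is precisely `{0,1}^{p(|x|)}`. -/
def Balanced (p : ℕ → ℕ) : Prop := ∀ x : Str, M.paths x = words (p x.length)

end NTM

/-! ### The classes UP and coUP -/

/-- The languages accepted by nondeterministic polynomial-time machines that have at most one
accepting path on every input. -/
def UP : Set (Set Str) :=
  {L | ∃ M : NTM, M.PolyTime ∧ (∀ x, (M.acc x).Subsingleton) ∧ L = {x | (M.acc x).Nonempty}}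

/-- The complements of the languages in `UP`. -/
def coUP : Set (Set Str) := {L | Lᶜ ∈ UP}

/-! ### The cluster classes -/

/-- The set `A ⊆ {0,1}^n`, if nonempty, is an interval of `{0,1}^n` once the strings are renamed
by `h`. -/
def IsCluster (n : ℕ) (h : Str → Str) (A : Set Str) : Prop :=
  A ≠ ∅ → ∃ l ∈ words n, ∃ u ∈ words n,
    A = {w | w ∈ words n ∧ lexLe (h l) (h w) ∧ lexLe (h w) (h u)}

/-- The class CLU#P. -/
def CLUSharpP : Set (Str → ℕ) :=
  {f | ∃ p : ℕ → ℕ, IsPolynomial p ∧ ∃ M : NTM, M.PolyTime ∧ M.Balanced p ∧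
    ∃ bot ∈ FPt, ∃ top ∈ FPt, ∃ prec ∈ PolyPred₃, ∀ x : Str,
      ∃ h : Str → Str, Set.BijOn h (words (p x.length)) (words (p x.length)) ∧
        (bot x ∈ words (p x.length) ∧ top x ∈ words (p x.length)) ∧
        (h (bot x) = List.replicate (p x.length) false ∧
          h (top x) = List.replicate (p x.length) true) ∧
        (∀ y ∈ words (p x.length), ∀ z ∈ words (p x.length),
          (prec x y z = true ↔ lexSucc (h y) (h z))) ∧
        IsCluster (p x.length) h (M.acc x) ∧
        f x = M.numAcc x}

/-- The class CLU#P with free top and bottom elements. -/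
def CLUSharpPFree : Set (Str → ℕ) :=
  {f | ∃ p : ℕ → ℕ, IsPolynomial p ∧ ∃ M : NTM, M.PolyTime ∧ M.Balanced p ∧
    ∃ prec ∈ PolyPred₃, ∀ x : Str,
      ∃ h : Str → Str, Set.BijOn h (words (p x.length)) (words (p x.length)) ∧
        (∀ y ∈ words (p x.length), ∀ z ∈ words (p x.length),
          (prec x y z = true ↔ lexSucc (h y) (h z))) ∧
        IsCluster (p x.length) h (M.acc x) ∧
        f x = M.numAcc x}

/-- The class CLU#P with circular adjacency. -/
def CLUSharpPCircular : Set (Str → ℕ) :=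
  {f | ∃ p : ℕ → ℕ, IsPolynomial p ∧ ∃ M : NTM, M.PolyTime ∧ M.Balanced p ∧
    ∃ prec ∈ PolyPred₃, ∀ x : Str,
      ∃ h : Str → Str, Set.BijOn h (words (p x.length)) (words (p x.length)) ∧
        (∀ y ∈ words (p x.length), ∀ z ∈ words (p x.length),
          (prec x y z = true ↔ lexSucc (h y) (h z) ∨
            (h y = List.replicate (p x.length) true ∧
              h z = List.replicate (p x.length) false))) ∧
        IsCluster (p x.length) h (M.acc x) ∧
        f x = M.numAcc x}

end Cluster

/-! From statement 2 to statement 3: if the ends of an order are computable, the extra pair of the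
circular relation is recognized by comparing with them (`CLUSharpP_subset_circular`).

From statement 3 to statement 1: for `L` in `UP`, let a machine accept `1…1` and every word `0u`
whose rest `u` is a padded certificate of `x`. It has two accepting paths on `L` and one off it.
Moving the certificate word behind `1…1` turns the accepting set into an interval, and adjacency
stays decidable, since only the two words and the successor of the first need to be tested for being
the certificate (`exists_free_of_mem_UP`). The end of this order depends on whether `x ∈ L`, which
does not matter for the free class. If the same function is in the circular class, then `x ∉ L`
means that exactly one path is accepting. In a circular order this has a local proof: an accepting
path and its two neighbours, both rejecting (`eq_singleton_of_isolated`). The three words are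
unique, so the complement of `L` is in `UP`.

From statement 1 to statement 2: a word has at most one predecessor, so having one is a `UP`
property; under `UP = coUP` having none is one as well, and likewise for successors. So the first
and the last word of the order possess a unique joint certificate `v` (`exists_ends`). It cannot be
computed, but it can name a place. The words are prolonged by `r + 2` bits, where `r` is the length
of `v`. The old words sit behind a prefix of zeros, and all further words keep their numerical
order, with the whole old order inserted between `1v0…00` and `1v0…01`. Adjacency at the two
junctions is decidable because the junk word itself contains `v`, and the new ends are explicit
(`endPrec_iff`, `CLUSharpPFree_subset_of_UP_eq_coUP`).

All of this concerns genuine Turing machines. `Rz` and `PT` form a calculus of polynomial-time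
computations on registers; `PT.of_mem_FPt`, `mem_FPt_of_PT`, their analogues for predicates,
`PT.accepts` and `exists_NTM` connect it with the machine models of the definitions. -/

namespace Cluster

open Turing Function

set_option linter.unusedSectionVars false

/-! ### Composable machine fragments, and the growth of their stacks. -/

/-! ### Machine fragments -/

/-- A machine fragment over the stacks `Γ` with internal states `σ`: labelled statements, some of
the labels guessing a bit as in `NTM`. Halting means leaving the fragment. -/
structure Frag {K : Type} (Γ : K → Type) (σ : Type) where
  Λ : Type
  [fin : Fintype Λ]
  entry : Λ
  m : Λ → TM2.Stmt Γ Λ σ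
  alt : Λ → Option (TM2.Stmt Γ Λ σ)

/-- The statement leaving for the label `ex`, or halting. -/
def exitStmt {K : Type} {Γ : K → Type} {Λ σ : Type} : Option Λ → TM2.Stmt Γ Λ σ
  | some l => .goto fun _ => l
  | none => .halt

/-- Rename the labels of a statement and replace halting by a jump. -/
def relabel {K : Type} {Γ : K → Type} {Λ Λ' σ : Type} (ι : Λ → Λ') (ex : Option Λ') :
    TM2.Stmt Γ Λ σ → TM2.Stmt Γ Λ' σ
  | .push k f q => .push k f (relabel ι ex q)
  | .peek k f q => .peek k f (relabel ι ex q)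
  | .pop k f q => .pop k f (relabel ι ex q)
  | .load f q => .load f (relabel ι ex q)
  | .branch f q₁ q₂ => .branch f (relabel ι ex q₁) (relabel ι ex q₂)
  | .goto f => .goto fun v => ι (f v)
  | .halt => exitStmt ex

/-- The effect of `relabel` on configurations. -/
def relabelCfg {K : Type} {Γ : K → Type} {Λ Λ' σ : Type} (ι : Λ → Λ') (ex : Option Λ')
    (c : TM2.Cfg Γ Λ σ) : TM2.Cfg Γ Λ' σ :=
  ⟨c.l.elim ex (fun l => some (ι l)), c.var, c.stk⟩

theorem stepAux_relabel {K : Type} [DecidableEq K] {Γ : K → Type} {Λ Λ' σ : Type} (ι : Λ → Λ')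
    (ex : Option Λ') (s : TM2.Stmt Γ Λ σ) (v : σ) (S : ∀ k, List (Γ k)) :
    TM2.stepAux (relabel ι ex s) v S = relabelCfg ι ex (TM2.stepAux s v S) := by
  induction s generalizing v S with
  | push k f q ih | peek k f q ih | pop k f q ih | load f q ih => simp [relabel, ih]
  | branch f q₁ q₂ ih₁ ih₂ => simp only [relabel, TM2.stepAux]; cases f v <;> simp [ih₁, ih₂]
  | goto f => simp [relabel, relabelCfg]
  | halt => cases ex <;> simp [relabel, relabelCfg, exitStmt]

namespace Frag

section

variable {K : Type} [DecidableEq K] {Γ : K → Type} {σ : Type}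

/-- Computations of a fragment, as in `NTM.Run`. -/
inductive Run (F : Frag Γ σ) : TM2.Cfg Γ F.Λ σ → List Bool → ℕ → TM2.Cfg Γ F.Λ σ → Prop
  | refl (c : TM2.Cfg Γ F.Λ σ) : Run F c [] 0 c
  | det {l : F.Λ} {v : σ} {S : ∀ k, List (Γ k)} {w : List Bool} {n : ℕ}
      {d : TM2.Cfg Γ F.Λ σ} (hl : F.alt l = none)
      (h : Run F (TM2.stepAux (F.m l) v S) w n d) : Run F ⟨some l, v, S⟩ w (n + 1) d
  | guess {l : F.Λ} {v : σ} {S : ∀ k, List (Γ k)} {w : List Bool} {n : ℕ}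
      {d : TM2.Cfg Γ F.Λ σ} {s : TM2.Stmt Γ F.Λ σ} (b : Bool) (hl : F.alt l = some s)
      (h : Run F (TM2.stepAux (cond b s (F.m l)) v S) w n d) :
      Run F ⟨some l, v, S⟩ (b :: w) (n + 1) d

/-- `F.Reach v S w n v' S'`: started at its entry, `F` is left after `n` steps. -/
def Reach (F : Frag Γ σ) (v : σ) (S : ∀ k, List (Γ k)) (w : List Bool) (n : ℕ) (v' : σ)
    (S' : ∀ k, List (Γ k)) : Prop :=
  F.Run ⟨some F.entry, v, S⟩ w n ⟨none, v', S'⟩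

theorem Reach.cast {F : Frag Γ σ} {v v' : σ} {S S' S₁ S₁' : ∀ k, List (Γ k)} {w : List Bool}
    {n : ℕ} (h : F.Reach v S w n v' S') (h₁ : S = S₁) (h₂ : S' = S₁') :
    F.Reach v S₁ w n v' S₁' := by
  subst h₁ h₂; exact h

theorem Reach.congr_steps {F : Frag Γ σ} {v v' : σ} {S S' : ∀ k, List (Γ k)} {w : List Bool}
    {n n' : ℕ} (h : F.Reach v S w n v' S') (hn : n = n') : F.Reach v S w n' v' S' :=
  hn ▸ h

/-- Deterministic fragments. -/
def Det (F : Frag Γ σ) : Prop := ∀ l, F.alt l = none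

theorem Run.trans {F : Frag Γ σ} {c d e : TM2.Cfg Γ F.Λ σ} {w w' : List Bool} {n n' : ℕ}
    (h : F.Run c w n d) (h' : F.Run d w' n' e) : F.Run c (w ++ w') (n + n') e := by
  induction h with
  | refl c => simpa using h'
  | det hl _ ih => have := Run.det hl (ih h'); convert this using 1; omega
  | guess b hl _ ih => have := Run.guess b hl (ih h'); rw [Nat.add_right_comm]; exact this

theorem Run.step {F : Frag Γ σ} {l : F.Λ} {v : σ} {S : ∀ k, List (Γ k)}
    {c d : TM2.Cfg Γ F.Λ σ} {w : List Bool} {n : ℕ} (hl : F.alt l = none)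
    (hc : TM2.stepAux (F.m l) v S = c) (h : F.Run c w n d) : F.Run ⟨some l, v, S⟩ w (n + 1) d :=
  .det hl (by rwa [hc])

/-- Relabelling commutes with single steps, so computations survive in any fragment containing a
relabelled copy, where leaving `F` becomes a jump to `ex`. The correctness of `seq` and `popLoop`
rests on this. -/
theorem Run.map {F G : Frag Γ σ} (ι : F.Λ → G.Λ) (ex : Option G.Λ)
    (hm : ∀ l, G.m (ι l) = relabel ι ex (F.m l))
    (ha : ∀ l, G.alt (ι l) = (F.alt l).map (relabel ι ex))
    {c d : TM2.Cfg Γ F.Λ σ} {w : List Bool} {n : ℕ} (h : F.Run c w n d) :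
    G.Run (relabelCfg ι ex c) w n (relabelCfg ι ex d) := by
  induction h with
  | refl c => exact .refl _
  | @det l v S w n d hl _ ih =>
    refine Run.det (l := ι l) (by simp [ha, hl]) ?_
    rw [hm, stepAux_relabel]; exact ih
  | @guess l v S w n d s b hl _ ih =>
    refine Run.guess (l := ι l) (s := relabel ι ex s) b (by simp [ha, hl]) ?_
    rw [hm, show cond b (relabel ι ex s) (relabel ι ex (F.m l)) =
      relabel ι ex (cond b s (F.m l)) by cases b <;> rfl, stepAux_relabel]
    exact ih

/-- Two computations along compatible guesses, the second one halting. -/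
theorem Run.compat {F : Frag Γ σ} {c d e : TM2.Cfg Γ F.Λ σ} {w w' : List Bool} {n n' : ℕ}
    (h : F.Run c w n d) (h' : F.Run c w' n' e) (he : e.l = none) (hw : w <+: w' ∨ w' <+: w) :
    n ≤ n' ∧ w <+: w' ∧ (d.l = none → w = w' ∧ d = e) := by
  -- Two computations from the same configuration can part only at a guess, and compatible guess
  -- strings agree there.
  induction h generalizing w' n' with
  | refl c =>
    refine ⟨Nat.zero_le _, List.nil_prefix, fun hc => ?_⟩
    cases h' with
    | refl => exact ⟨rfl, rfl⟩
    | det => simp at hc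
    | guess => simp at hc
  | det hl _ ih =>
    cases h' with
    | refl => simp at he
    | det _ h' => obtain ⟨h1, h2, h3⟩ := ih h' hw; exact ⟨by omega, h2, h3⟩
    | guess b hl' h' => simp [hl] at hl'
  | @guess l v S w n d s b hl _ ih =>
    cases h' with
    | refl => simp at he
    | det hl' h' => simp [hl] at hl'
    | @guess _ _ _ w₂ n₂ _ s₂ b' hl' h' =>
      obtain rfl : s = s₂ := by simpa [hl] using hl'
      simp only [List.cons_prefix_cons] at hw
      obtain rfl : b = b' := by rcases hw with h | h <;> simp [h.1]
      obtain ⟨h1, h2, h3⟩ := ih h' (by simpa using hw)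
      exact ⟨by omega, by simpa using h2, fun hd => by simpa using h3 hd⟩

/-! #### Sequential composition -/

/-- `F`, then `G`. -/
def seq (F G : Frag Γ σ) : Frag Γ σ where
  Λ := F.Λ ⊕ G.Λ
  fin := letI := F.fin; letI := G.fin; inferInstance
  entry := .inl F.entry
  m := Sum.elim (fun l => relabel .inl (some (.inr G.entry)) (F.m l))
    (fun l => relabel .inr none (G.m l))
  alt := Sum.elim (fun l => (F.alt l).map (relabel .inl (some (.inr G.entry))))
    (fun l => (G.alt l).map (relabel .inr none))

theorem Det.seq {F G : Frag Γ σ} (hF : F.Det) (hG : G.Det) : (F.seq G).Det := by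
  rintro (l | l)
  · simp [Frag.seq, hF l]
  · simp [Frag.seq, hG l]

theorem Reach.seq {F G : Frag Γ σ} {v v' v'' : σ} {S S' S'' : ∀ k, List (Γ k)} {w w' : List Bool}
    {n n' : ℕ} (hF : F.Reach v S w n v' S') (hG : G.Reach v' S' w' n' v'' S'') :
    (F.seq G).Reach v S (w ++ w') (n + n') v'' S'' :=
  (Run.map (G := F.seq G) .inl (some (.inr G.entry)) (fun _ => rfl) (fun _ => rfl) hF).trans
    (Run.map (G := F.seq G) .inr none (fun _ => rfl) (fun _ => rfl) hG)

/-! #### Single statements and loops over a stack -/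

/-- A statement without jumps. -/
def single (s : TM2.Stmt Γ Unit σ) : Frag Γ σ where
  Λ := Unit
  entry := ()
  m := fun _ => s
  alt := fun _ => none

theorem Det.single (s : TM2.Stmt Γ Unit σ) : (single s).Det := fun _ => rfl

theorem Reach.single {s : TM2.Stmt Γ Unit σ} {v v' : σ} {S S' : ∀ k, List (Γ k)}
    (h : TM2.stepAux s v S = ⟨none, v', S'⟩) : (single s).Reach v S [] 1 v' S' :=
  .step rfl h (.refl _)

/-- Pop the symbols `a` of the stack `k` one after the other, executing `F` whenever the recorded
symbol says `true` and `G` whenever it says `false`. -/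
def popLoop (k : K) (get : σ → Option Bool) (set : Option Bool → σ → σ)
    (read : Γ k → Bool) (F G : Frag Γ σ) : Frag Γ σ where
  Λ := Unit ⊕ F.Λ ⊕ G.Λ
  fin := letI := F.fin; letI := G.fin; inferInstance
  entry := .inl ()
  m := Sum.elim (fun _ => .pop k (fun v o => set (o.map read) v)
      (.branch (fun v => (get v).isNone) .halt
        (.branch (fun v => (get v).getD false)
          -- The popped symbol is erased from the state before the body starts, so that every round
          -- begins in the same kind of state.
          (.load (set none) (.goto fun _ => .inr (.inl F.entry)))
          (.load (set none) (.goto fun _ => .inr (.inr G.entry))))))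
    (Sum.elim (fun l => relabel (fun l => .inr (.inl l)) (some (.inl ())) (F.m l))
      (fun l => relabel (fun l => .inr (.inr l)) (some (.inl ())) (G.m l)))
  alt := Sum.elim (fun _ => none)
    (Sum.elim (fun l => (F.alt l).map (relabel (fun l => .inr (.inl l)) (some (.inl ()))))
      (fun l => (G.alt l).map (relabel (fun l => .inr (.inr l)) (some (.inl ())))))

section popLoop

variable {k : K} {get : σ → Option Bool} {set : Option Bool → σ → σ} {read : Γ k → Bool}
  {F G : Frag Γ σ}

theorem Det.popLoop (hF : F.Det) (hG : G.Det) : (popLoop k get set read F G).Det := by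
  rintro (l | l | l)
  · rfl
  · simp [Frag.popLoop, hF l]
  · simp [Frag.popLoop, hG l]

theorem Reach.popLoop_nil (hget : ∀ o v, get (set o v) = o) {v : σ} {S : ∀ k, List (Γ k)}
    (hv : set none v = v) (hk : S k = []) :
    (popLoop k get set read F G).Reach v S [] 1 v S := by
  refine .step (c := ⟨none, v, S⟩) rfl ?_ (.refl _)
  have : update S k [] = S := by rw [← hk]; exact update_eq_self k S
  have hg : get v = none := by rw [← hv, hget]
  simp [Frag.popLoop, hk, hg, hv, this]

theorem Reach.popLoop_cons (hget : ∀ o v, get (set o v) = o)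
    (hset : ∀ o v, set none (set o v) = set none v) {v v' v'' : σ} {S S' S'' : ∀ k, List (Γ k)}
    (hv : set none v = v) {a : Γ k} {l : List (Γ k)} (hk : S k = a :: l) {w w' : List Bool}
    {n n' : ℕ} (h : (bif read a then F else G).Reach v (update S k l) w n v' S')
    (h' : (popLoop k get set read F G).Reach v' S' w' n' v'' S'') :
    (popLoop k get set read F G).Reach v S (w ++ w') (n + n' + 1) v'' S'' := by
  cases hb : read a
  · rw [hb] at h
    refine .step (c := ⟨some (Sum.inr (Sum.inr G.entry)), v, update S k l⟩) rfl
      (by simp [Frag.popLoop, hk, hget, hset, hv, hb]) ?_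
    exact (Run.map (G := Frag.popLoop k get set read F G) (fun l => .inr (.inr l)) (some (.inl ()))
      (fun _ => rfl) (fun _ => rfl) h).trans h'
  · rw [hb] at h
    refine .step (c := ⟨some (Sum.inr (Sum.inl F.entry)), v, update S k l⟩) rfl
      (by simp [Frag.popLoop, hk, hget, hset, hv, hb]) ?_
    exact (Run.map (G := Frag.popLoop k get set read F G) (fun l => .inr (.inl l)) (some (.inl ()))
      (fun _ => rfl) (fun _ => rfl) h).trans h'

end popLoop

/-- Pop the symbols `a` of the stack `k` and push `f (read a)` on the stack `k'`. -/
def moveMap {X : Type} (k k' : K) (get : σ → Option X) (set : Option X → σ → σ)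
    (read : Γ k → X) (f : Option X → Γ k') : Frag Γ σ where
  Λ := Unit
  entry := ()
  m := fun _ => .pop k (fun v o => set (o.map read) v)
      (.branch (fun v => (get v).isNone) .halt
        (.push k' (fun v => f (get v)) (.load (set none) (.goto fun _ => ()))))
  alt := fun _ => none

theorem Reach.moveMap {X : Type} {k k' : K} (hkk : k ≠ k') {get : σ → Option X}
    {set : Option X → σ → σ} {read : Γ k → X} {f : Option X → Γ k'}
    (hget : ∀ o v, get (set o v) = o) (hset : ∀ o v, set none (set o v) = set none v) {v : σ}
    (hv : set none v = v) (l : List (Γ k)) (S : ∀ k, List (Γ k)) (hl : S k = l) :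
    (moveMap k k' get set read f).Reach v S [] (l.length + 1) v
      (update (update S k []) k' ((l.map fun a => f (some (read a))).reverse ++ S k')) := by
  induction l generalizing S with
  | nil =>
    refine .step (c := ⟨none, v, S⟩) rfl ?_ ?_
    · have : update S k [] = S := by rw [← hl]; exact update_eq_self k S
      have hg : get v = none := by rw [← hv, hget]
      simp [Frag.moveMap, hl, hg, hv, this]
    · have : update S k [] = S := by rw [← hl]; exact update_eq_self k S
      simp only [this, List.map_nil, List.reverse_nil, List.nil_append, update_eq_self]
      exact .refl _
  | cons a l ih =>
    refine .step (c := ⟨some (), v, update (update S k l) k' (f (some (read a)) :: S k')⟩) rfl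
      (by simp [Frag.moveMap, hl, hget, hset, hv, hkk.symm]) ?_
    have := ih (update (update S k l) k' (f (some (read a)) :: S k')) (by simp [hkk])
    unfold Reach at this
    convert this using 2
    · rfl
    · rfl
    funext j
    rcases eq_or_ne j k' with rfl | hj
    · simp
    · rcases eq_or_ne j k with rfl | hj'
      · simp [hkk]
      · simp [hj, hj']

/-- Empty the stack `k`. -/
def clear (k : K) (set : Bool → σ → σ) (get : σ → Bool) : Frag Γ σ where
  Λ := Unit
  entry := ()
  m := fun _ => .pop k (fun v o => set o.isSome v)
      (.branch get (.load (set false) (.goto fun _ => ())) .halt)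
  alt := fun _ => none

theorem Reach.clear {k : K} {get : σ → Bool} {set : Bool → σ → σ}
    (hget : ∀ o v, get (set o v) = o) (hset : ∀ o v, set false (set o v) = set false v) {v : σ}
    (hv : set false v = v) (l : List (Γ k)) (S : ∀ k, List (Γ k)) (hl : S k = l) :
    (clear k set get).Reach v S [] (l.length + 1) v (update S k []) := by
  induction l generalizing S with
  | nil =>
    have hg : get v = false := by rw [← hv, hget]
    exact .step (c := ⟨none, v, update S k []⟩) rfl (by simp [Frag.clear, hl, hg, hv]) (.refl _)
  | cons a l ih =>
    refine .step (c := ⟨some (), v, update S k l⟩) rfl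
      (by simp [Frag.clear, hl, hget, hset, hv]) ?_
    have := ih (update S k l) (by simp)
    rwa [update_idem] at this

end

/-! #### Change of stacks and states -/

section lift

variable {K K' : Type} {Γ : K → Type} {σ σ' τ : Type}

/-- Execute a statement on some of the stacks and on a component of the state. -/
def liftStmt {Λ : Type} (e : K' → K) (φ : σ ≃ σ' × τ) :
    TM2.Stmt (fun k => Γ (e k)) Λ σ' → TM2.Stmt Γ Λ σ
  | .push k f q => .push (e k) (fun v => f (φ v).1) (liftStmt e φ q)
  | .peek k f q => .peek (e k) (fun v o => φ.symm (f (φ v).1 o, (φ v).2)) (liftStmt e φ q)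
  | .pop k f q => .pop (e k) (fun v o => φ.symm (f (φ v).1 o, (φ v).2)) (liftStmt e φ q)
  | .load f q => .load (fun v => φ.symm (f (φ v).1, (φ v).2)) (liftStmt e φ q)
  | .branch f q₁ q₂ => .branch (fun v => f (φ v).1) (liftStmt e φ q₁) (liftStmt e φ q₂)
  | .goto f => .goto fun v => f (φ v).1
  | .halt => .halt

/-- `c` extends `c'` by the further state component `t` and further stacks as in `S₀`. -/
def Extends {Λ : Type} (e : K' → K) (φ : σ ≃ σ' × τ) (t : τ) (S₀ : ∀ k, List (Γ k))
    (c' : TM2.Cfg (fun k => Γ (e k)) Λ σ') (c : TM2.Cfg Γ Λ σ) : Prop :=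
  c.l = c'.l ∧ c.var = φ.symm (c'.var, t) ∧ (∀ k, c.stk (e k) = c'.stk k) ∧
    ∀ k, k ∉ Set.range e → c.stk k = S₀ k

theorem Extends.stepAux [DecidableEq K] [DecidableEq K'] {Λ : Type} {e : K' → K}
    (he : Injective e) {φ : σ ≃ σ' × τ} {t : τ} {S₀ : ∀ k, List (Γ k)}
    (s : TM2.Stmt (fun k => Γ (e k)) Λ σ') (v : σ') (S' : ∀ k, List (Γ (e k)))
    (S : ∀ k, List (Γ k)) (h : ∀ k, S (e k) = S' k) (h₀ : ∀ k, k ∉ Set.range e → S k = S₀ k) :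
    Extends e φ t S₀ (TM2.stepAux s v S') (TM2.stepAux (liftStmt e φ s) (φ.symm (v, t)) S) := by
  -- This fact depends on `S` and `S'`, so the induction generalizes it too; the induction
  -- hypotheses ask for it again after each update.
  have upd : ∀ (k : K') (x : List (Γ (e k))), (∀ j, update S (e k) x (e j) = update S' k x j) ∧
      ∀ j, j ∉ Set.range e → update S (e k) x j = S₀ j := by
    refine fun k x => ⟨fun j => ?_, fun j hj => ?_⟩
    · rcases eq_or_ne j k with rfl | hjk
      · simp
      · rw [update_of_ne hjk, update_of_ne (he.ne hjk), h]
    · rw [update_of_ne (fun hh => hj ⟨k, hh.symm⟩), h₀ j hj]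
  induction s generalizing v S S' with
  | push k f q ih =>
    simp only [liftStmt, TM2.stepAux, Equiv.apply_symm_apply]
    rw [h]
    exact ih _ _ _ (upd _ _).1 (upd _ _).2 fun k x => by
      refine ⟨fun j => ?_, fun j hj => ?_⟩
      · rcases eq_or_ne j k with rfl | hjk
        · simp
        · rw [update_of_ne hjk, update_of_ne (he.ne hjk), (upd _ _).1]
      · rw [update_of_ne (fun hh => hj ⟨k, hh.symm⟩), (upd _ _).2 j hj]
  | peek k f q ih =>
    simp only [liftStmt, TM2.stepAux, Equiv.apply_symm_apply]
    rw [h]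
    exact ih _ _ _ h h₀ upd
  | pop k f q ih =>
    simp only [liftStmt, TM2.stepAux, Equiv.apply_symm_apply]
    rw [h]
    exact ih _ _ _ (upd _ _).1 (upd _ _).2 fun k x => by
      refine ⟨fun j => ?_, fun j hj => ?_⟩
      · rcases eq_or_ne j k with rfl | hjk
        · simp
        · rw [update_of_ne hjk, update_of_ne (he.ne hjk), (upd _ _).1]
      · rw [update_of_ne (fun hh => hj ⟨k, hh.symm⟩), (upd _ _).2 j hj]
  | load f q ih =>
    simp only [liftStmt, TM2.stepAux, Equiv.apply_symm_apply]
    exact ih _ _ _ h h₀ upd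
  | branch f q₁ q₂ ih₁ ih₂ =>
    simp only [liftStmt, TM2.stepAux, Equiv.apply_symm_apply]
    cases f v
    · exact ih₂ _ _ _ h h₀ upd
    · exact ih₁ _ _ _ h h₀ upd
  | goto f => exact ⟨by simp [liftStmt], rfl, h, h₀⟩
  | halt => exact ⟨by simp [liftStmt], rfl, h, h₀⟩

/-- Execute a fragment on some of the stacks and on a component of the state. -/
def lift (e : K' → K) (φ : σ ≃ σ' × τ) (F : Frag (fun k => Γ (e k)) σ') : Frag Γ σ where
  Λ := F.Λ
  fin := F.fin
  entry := F.entry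
  m := fun l => liftStmt e φ (F.m l)
  alt := fun l => (F.alt l).map (liftStmt e φ)

theorem Run.lift [DecidableEq K] [DecidableEq K'] {e : K' → K} (he : Injective e)
    {φ : σ ≃ σ' × τ} {t : τ} {S₀ : ∀ k, List (Γ k)} {F : Frag (fun k => Γ (e k)) σ'}
    {c' d' : TM2.Cfg (fun k => Γ (e k)) F.Λ σ'} {w : List Bool} {n : ℕ} (h : F.Run c' w n d')
    (c : TM2.Cfg Γ F.Λ σ) (hc : Extends e φ t S₀ c' c) :
    ∃ d, (F.lift e φ).Run c w n d ∧ Extends e φ t S₀ d' d := by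
  induction h generalizing c with
  | refl c' => exact ⟨c, .refl _, hc⟩
  | @det l v S w n d hl _ ih =>
    obtain ⟨l', v', S'⟩ := c
    obtain ⟨rfl, rfl, h1, h2⟩ := hc
    obtain ⟨d, hd, h3⟩ := ih _ (Extends.stepAux he (F.m l) v S S' h1 h2)
    exact ⟨d, .det (by simp [Frag.lift, hl]) hd, h3⟩
  | @guess l v S w n d s b hl _ ih =>
    obtain ⟨l', v', S'⟩ := c
    obtain ⟨rfl, rfl, h1, h2⟩ := hc
    obtain ⟨d, hd, h3⟩ := ih _ (Extends.stepAux he (cond b s (F.m l)) v S S' h1 h2)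
    refine ⟨d, .guess (s := liftStmt e φ s) b (by simp [Frag.lift, hl]) ?_, h3⟩
    convert hd using 2
    cases b <;> rfl

/-- The alphabets are compared by a propositional equality, and the stacks by `HEq`, because for
sums of index types the alphabets agree definitionally only after a case distinction. -/
theorem exists_lift [DecidableEq K] [DecidableEq K'] {e : K' → K} (he : Injective e)
    (φ : σ ≃ σ' × τ) {Γ' : K' → Type} (hΓ : ∀ k, Γ' k = Γ (e k)) (F : Frag Γ' σ') :
    ∃ G : Frag Γ σ, (F.Det → G.Det) ∧ ∀ {v S w n v' S'}, F.Reach v S w n v' S' →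
      ∀ (t : τ) (T : ∀ k, List (Γ k)), (∀ k, HEq (T (e k)) (S k)) →
      ∃ T', G.Reach (φ.symm (v, t)) T w n (φ.symm (v', t)) T' ∧ (∀ k, HEq (T' (e k)) (S' k)) ∧
        ∀ k, k ∉ Set.range e → T' k = T k := by
  obtain rfl : Γ' = fun k => Γ (e k) := funext hΓ
  refine ⟨F.lift e φ, fun hF l => by simp [lift, hF l], fun {v S w n v' S'} h t T hT => ?_⟩
  obtain ⟨⟨l, u, T'⟩, hd, rfl, rfl, h2, h3⟩ := Run.lift he (t := t) (S₀ := T) h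
    ⟨some F.entry, φ.symm (v, t), T⟩ ⟨rfl, rfl, fun k => eq_of_heq (hT k), fun _ _ => rfl⟩
  exact ⟨T', hd, fun k => heq_of_eq (h2 k), h3⟩

end lift

end Frag

/-! ### Growth of the stacks -/

section growth

variable {K : Type} [Fintype K] {Γ : K → Type} {σ Λ : Type}

/-- The total height of the stacks. -/
def stkSize (S : ∀ k, List (Γ k)) : ℕ := ∑ k, (S k).length

/-- The number of pushes in a statement. -/
def pushes : TM2.Stmt Γ Λ σ → ℕ
  | .push _ _ q => pushes q + 1
  | .peek _ _ q => pushes q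
  | .pop _ _ q => pushes q
  | .load _ q => pushes q
  | .branch _ q₁ q₂ => pushes q₁ + pushes q₂
  | .goto _ => 0
  | .halt => 0

theorem stkSize_update_le [DecidableEq K] (S : ∀ k, List (Γ k)) (k : K) (x : List (Γ k)) (c : ℕ)
    (h : x.length ≤ (S k).length + c) : stkSize (update S k x) ≤ stkSize S + c := by
  unfold stkSize
  rw [← Finset.add_sum_erase _ _ (Finset.mem_univ k), ← Finset.add_sum_erase _ (fun k =>
    (S k).length) (Finset.mem_univ k)]
  rw [Finset.sum_congr rfl (g := fun k => (S k).length) fun j hj => by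
    rw [update_of_ne (Finset.ne_of_mem_erase hj)]]
  simp; omega

theorem stkSize_stepAux [DecidableEq K] (s : TM2.Stmt Γ Λ σ) (v : σ) (S : ∀ k, List (Γ k)) :
    stkSize (TM2.stepAux s v S).stk ≤ stkSize S + pushes s := by
  induction s generalizing v S with
  | push k f q ih =>
    have := stkSize_update_le S k (f v :: S k) 1 (by simp)
    have := ih v (update S k (f v :: S k))
    simp only [TM2.stepAux, pushes]; omega
  | peek k f q ih => exact ih _ _
  | pop k f q ih =>
    have := stkSize_update_le S k (S k).tail 0 (by simp)
    have := ih (f v (S k).head?) (update S k (S k).tail)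
    simp only [TM2.stepAux, pushes]; omega
  | load f q ih => exact ih _ _
  | branch f q₁ q₂ ih₁ ih₂ =>
    have := ih₁ v S
    have := ih₂ v S
    simp only [TM2.stepAux, pushes]
    cases f v <;> simp only [cond_true, cond_false] <;> omega
  | goto | halt => simp [pushes]

/-- With finitely many labels, the pushes in one step are bounded by the number of all pushes in the
program, second statements included. Thus time bounds yield size bounds. -/
theorem Frag.exists_growth [DecidableEq K] (F : Frag Γ σ) : ∃ C : ℕ, ∀ {c d w n}, F.Run c w n d →
    stkSize d.stk ≤ stkSize c.stk + C * n := by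
  let := F.fin
  refine ⟨∑ l, (pushes (F.m l) + ((F.alt l).elim 0 pushes)), fun {c d w n} h => ?_⟩
  set C := ∑ l, (pushes (F.m l) + ((F.alt l).elim 0 pushes)) with hC
  have hle : ∀ l, pushes (F.m l) + ((F.alt l).elim 0 pushes) ≤ C := fun l =>
    Finset.single_le_sum (f := fun l => pushes (F.m l) + ((F.alt l).elim 0 pushes))
      (fun _ _ => Nat.zero_le _) (Finset.mem_univ l)
  induction h with
  | refl => simp
  | @det l v S w n d hl _ ih =>
    have := hle l
    have := stkSize_stepAux (F.m l) v S
    rw [Nat.mul_add, Nat.mul_one]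
    refine ih.trans ?_
    simp only; omega
  | @guess l v S w n d s b hl _ ih =>
    have h1 := hle l
    have := stkSize_stepAux (cond b s (F.m l)) v S
    rw [Nat.mul_add, Nat.mul_one]
    refine ih.trans ?_
    rw [hl] at h1
    simp only [Option.elim_some] at h1
    cases b <;> simp only [cond_true, cond_false] at * <;> omega

end growth

/-! ### A calculus of polynomial-time computations, on registers and on coded data. -/

/-! ### Polynomial-time transformations of registers -/

theorem eval_mono (p : Polynomial ℕ) {a b : ℕ} (h : a ≤ b) : p.eval a ≤ p.eval b := by
  simp only [Polynomial.eval_eq_sum_range]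
  exact Finset.sum_le_sum fun i _ => Nat.mul_le_mul_left _ (Nat.pow_le_pow_left h i)

/-- Stack alphabets for registers `R` over the alphabet `{0,1}` and further stacks. -/
abbrev RegΓ (R : Type) {E : Type} (Γ : E → Type) : R ⊕ E → Type :=
  Sum.elim (fun _ => Bool) Γ

/-- The stacks when the registers have contents `s` and the further stacks are empty. -/
def full {R E : Type} {Γ : E → Type} (s : R → Str) : ∀ k, List (RegΓ R Γ k)
  | .inl r => s r
  | .inr _ => []

/-- The total length of the registers. -/
def memSize {R : Type} [Fintype R] (s : R → Str) : ℕ := ∑ r, (s r).length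

/-- A deterministic machine working on registers `R` and some further stacks. -/
structure Machine (R : Type) where
  E : Type
  [finE : Fintype E]
  [decE : DecidableEq E]
  Γ : E → Type
  σ : Type
  [finσ : Fintype σ]
  v₀ : σ
  F : Frag (RegΓ R Γ) σ
  det : F.Det

attribute [instance] Machine.finE Machine.decE Machine.finσ

section

variable {R R' : Type} [Fintype R] [DecidableEq R] [Fintype R'] [DecidableEq R']

/-- `M` transforms `s` into `s'` in `n` steps. -/
def Machine.Computes (M : Machine R) (s s' : R → Str) (n : ℕ) : Prop :=
  M.F.Reach M.v₀ (full s) [] n M.v₀ (full s')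

theorem stkSize_full {E : Type} [Fintype E] {Γ : E → Type} (s : R → Str) :
    stkSize (full (Γ := Γ) s) = memSize s := by
  simp [stkSize, memSize, Fintype.sum_sum_type, full]

/-- The basis for reusing machines: stacks outside the range of `e` and the state component `t` are
left alone, and the state is back at `M.v₀` in the end, so that machines can be chained without
cleaning up. -/
theorem Machine.embed (M : Machine R) {E : Type} [DecidableEq E] {Γ : E → Type} {σ τ : Type}
    {e : R ⊕ M.E → R' ⊕ E} (he : Injective e) (hΓ : ∀ k, RegΓ R M.Γ k = RegΓ R' Γ (e k))
    (φ : σ ≃ M.σ × τ) : ∃ G : Frag (RegΓ R' Γ) σ, G.Det ∧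
      ∀ {s s' : R → Str} {n : ℕ}, M.Computes s s' n → ∀ (u u' : R' → Str),
        (∀ k, HEq (full (Γ := Γ) u (e k)) (full (Γ := M.Γ) s k)) →
        (∀ k, HEq (full (Γ := Γ) u' (e k)) (full (Γ := M.Γ) s' k)) →
        (∀ k, k ∉ Set.range e → full (Γ := Γ) u' k = full u k) →
        ∀ t, G.Reach (φ.symm (M.v₀, t)) (full u) [] n (φ.symm (M.v₀, t)) (full u') := by
  obtain ⟨G, hG, h⟩ := Frag.exists_lift he φ hΓ M.F
  refine ⟨G, hG M.det, fun {s s' n} hM u u' hu hu' hrest t => ?_⟩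
  obtain ⟨T', h1, h2, h3⟩ := h hM t (full u) hu
  obtain rfl : T' = full u' := by
    funext k
    by_cases hk : k ∈ Set.range e
    · obtain ⟨j, rfl⟩ := hk
      exact eq_of_heq ((h2 j).trans (hu' j).symm)
    · rw [h3 k hk, hrest k hk]
  exact h1

/-- The relation `T` between register contents can be realized in polynomial time. -/
def Rz (T : (R → Str) → (R → Str) → Prop) : Prop :=
  ∃ (M : Machine R) (t : Polynomial ℕ), ∀ s s', T s s' →
    ∃ n ≤ t.eval (memSize s), M.Computes s s' n

/-- A relation serves as a specification: the machine owes something only for pairs in it, so a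
smaller relation is easier to realize. Typically, machines are composed and the resulting relation
is then cut down. -/
theorem Rz.mono {T T' : (R → Str) → (R → Str) → Prop} (h : Rz T') (hT : ∀ s s', T s s' → T' s s') :
    Rz T := by
  obtain ⟨M, t, h⟩ := h
  exact ⟨M, t, fun s s' hs => h s s' (hT s s' hs)⟩

theorem Machine.exists_growth (M : Machine R) : ∃ C : ℕ, ∀ {s s' n}, M.Computes s s' n →
    memSize s' ≤ memSize s + C * n := by
  obtain ⟨C, hC⟩ := M.F.exists_growth
  exact ⟨C, fun {s s' n} h => by simpa [stkSize_full] using hC h⟩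

theorem Rz.exists_growth {T : (R → Str) → (R → Str) → Prop} (h : Rz T) :
    ∃ q : Polynomial ℕ, ∀ s s', T s s' → memSize s' ≤ q.eval (memSize s) := by
  obtain ⟨M, t, h⟩ := h
  obtain ⟨C, hC⟩ := M.exists_growth
  refine ⟨.X + .C C * t, fun s s' hs => ?_⟩
  obtain ⟨n, hn, hs⟩ := h s s' hs
  have := Nat.mul_le_mul_left C hn
  have := hC hs
  simp; omega

theorem sumMap_inl_heq {E₁ E₂ : Type} {Γ₁ : E₁ → Type} {Γ₂ : E₂ → Type} (s : R → Str)
    (k : R ⊕ E₁) : HEq (full (Γ := Sum.elim Γ₁ Γ₂) s (Sum.map id Sum.inl k)) (full (Γ := Γ₁) s k) := by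
  cases k <;> exact HEq.rfl

theorem sumMap_inr_heq {E₁ E₂ : Type} {Γ₁ : E₁ → Type} {Γ₂ : E₂ → Type} (s : R → Str)
    (k : R ⊕ E₂) : HEq (full (Γ := Sum.elim Γ₁ Γ₂) s (Sum.map id Sum.inr k)) (full (Γ := Γ₂) s k) := by
  cases k <;> exact HEq.rfl

/-- Two machines on the same registers, working side by side. -/
theorem Machine.pair (M N : Machine R) {σ τ₁ τ₂ : Type} (φ₁ : σ ≃ M.σ × τ₁) (φ₂ : σ ≃ N.σ × τ₂) :
    ∃ F G : Frag (RegΓ R (Sum.elim M.Γ N.Γ)) σ, F.Det ∧ G.Det ∧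
      (∀ {s s' n}, M.Computes s s' n → ∀ t, F.Reach (φ₁.symm (M.v₀, t)) (full s) [] n
        (φ₁.symm (M.v₀, t)) (full s')) ∧
      (∀ {s s' n}, N.Computes s s' n → ∀ t, G.Reach (φ₂.symm (N.v₀, t)) (full s) [] n
        (φ₂.symm (N.v₀, t)) (full s')) := by
  obtain ⟨F, hF, h1⟩ := M.embed (R' := R) (E := M.E ⊕ N.E) (Γ := Sum.elim M.Γ N.Γ)
    (e := Sum.map id Sum.inl) (Sum.map_injective.2 ⟨injective_id, Sum.inl_injective⟩)
    (by rintro (k | k) <;> rfl) φ₁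
  obtain ⟨G, hG, h2⟩ := N.embed (R' := R) (E := M.E ⊕ N.E) (Γ := Sum.elim M.Γ N.Γ)
    (e := Sum.map id Sum.inr) (Sum.map_injective.2 ⟨injective_id, Sum.inr_injective⟩)
    (by rintro (k | k) <;> rfl) φ₂
  refine ⟨F, G, hF, hG, fun {s s' n} h t => h1 h s s' (sumMap_inl_heq s) (sumMap_inl_heq s') ?_ t,
    fun {s s' n} h t => h2 h s s' (sumMap_inr_heq s) (sumMap_inr_heq s') ?_ t⟩
  · rintro (k | k) hk
    · exact absurd ⟨.inl k, rfl⟩ hk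
    · rfl
  · rintro (k | k) hk
    · exact absurd ⟨.inl k, rfl⟩ hk
    · rfl

/-- The second running time is polynomial in the size of the intermediate contents, which is itself
polynomial in the initial size because a machine cannot write more than its time permits; hence
`t₂.comp q`. -/
theorem Rz.seq {T₁ T₂ : (R → Str) → (R → Str) → Prop} (h₁ : Rz T₁) (h₂ : Rz T₂) :
    Rz fun s s' => ∃ m, T₁ s m ∧ T₂ m s' := by
  obtain ⟨q, hq⟩ := h₁.exists_growth
  obtain ⟨M, t₁, h₁⟩ := h₁
  obtain ⟨N, t₂, h₂⟩ := h₂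
  obtain ⟨F, G, hF, hG, hM, hN⟩ := M.pair N (Equiv.refl (M.σ × N.σ)) (Equiv.prodComm M.σ N.σ)
  refine ⟨⟨M.E ⊕ N.E, _, _, (M.v₀, N.v₀), F.seq G, hF.seq hG⟩, t₁ + t₂.comp q, ?_⟩
  rintro s s' ⟨m, hs, hm⟩
  obtain ⟨n₁, hn₁, h1⟩ := h₁ s m hs
  obtain ⟨n₂, hn₂, h2⟩ := h₂ m s' hm
  refine ⟨n₁ + n₂, ?_, (hM h1 N.v₀).seq (hN h2 M.v₀)⟩
  have := eval_mono t₂ (hq s m hs)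
  simp; omega

/-- A frame rule: a program for few registers works inside a larger memory. -/
theorem Rz.rename {T : (R → Str) → (R → Str) → Prop} (h : Rz T) {ρ : R → R'} (hρ : Injective ρ) :
    Rz fun s s' => T (s ∘ ρ) (s' ∘ ρ) ∧ ∀ r, r ∉ Set.range ρ → s' r = s r := by
  obtain ⟨M, t, h⟩ := h
  obtain ⟨F, hF, h1⟩ := M.embed (R' := R') (E := M.E) (Γ := M.Γ)
    (e := Sum.map ρ id) (Sum.map_injective.2 ⟨hρ, injective_id⟩)
    (by rintro (k | k) <;> rfl) (Equiv.prodUnique M.σ Unit).symm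
  refine ⟨⟨M.E, _, _, M.v₀, F, hF⟩, t, ?_⟩
  rintro s s' ⟨hs, hr⟩
  obtain ⟨n, hn, h2⟩ := h _ _ hs
  refine ⟨n, hn.trans (eval_mono t ?_), h1 h2 s s' (by rintro (k | k) <;> exact HEq.rfl)
    (by rintro (k | k) <;> exact HEq.rfl) ?_ ()⟩
  · unfold memSize
    rw [show ∑ r, ((s ∘ ρ) r).length = ∑ r ∈ Finset.univ.image ρ, (s r).length from
      (Finset.sum_image (f := fun r => (s r).length) (fun _ _ _ _ h => hρ h)).symm]
    exact Finset.sum_le_sum_of_subset (Finset.subset_univ _)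
  · rintro (k | k) hk
    · exact hr k fun ⟨j, hj⟩ => hk ⟨.inl j, by simp [hj]⟩
    · rfl

/-- Local variables: registers that are empty before and after become further stacks of the machine.
-/
theorem Rz.hide {T : (R ⊕ R' → Str) → (R ⊕ R' → Str) → Prop} (h : Rz T) :
    Rz fun s s' => T (Sum.elim s fun _ => []) (Sum.elim s' fun _ => []) := by
  obtain ⟨M, t, h⟩ := h
  obtain ⟨F, hF, h1⟩ := M.embed (R' := R) (E := R' ⊕ M.E) (Γ := Sum.elim (fun _ => Bool) M.Γ)
    (e := Equiv.sumAssoc _ _ _) (Equiv.injective _)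
    (by rintro ((k | k) | k) <;> rfl) (Equiv.prodUnique M.σ Unit).symm
  refine ⟨⟨R' ⊕ M.E, _, _, M.v₀, F, hF⟩, t, ?_⟩
  rintro s s' hs
  obtain ⟨n, hn, h2⟩ := h _ _ hs
  refine ⟨n, hn.trans_eq (by simp [memSize, Fintype.sum_sum_type]),
    h1 h2 s s' (by rintro ((k | k) | k) <;> exact HEq.rfl)
      (by rintro ((k | k) | k) <;> exact HEq.rfl) ?_ ()⟩
  intro k hk
  exact absurd ((Equiv.sumAssoc R R' M.E).surjective k) hk

/-- Replace the statement in a machine on registers by an elementary one. -/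
theorem Rz.ofFrag {T : (R → Str) → (R → Str) → Prop}
    (F : Frag (RegΓ R (E := Empty) (fun _ => Unit)) Unit) (hF : F.Det) (t : Polynomial ℕ)
    (h : ∀ s s', T s s' → ∃ n ≤ t.eval (memSize s), F.Reach () (full s) [] n () (full s')) : Rz T :=
  ⟨⟨Empty, _, Unit, (), F, hF⟩, t, h⟩

theorem full_update {E : Type} [DecidableEq E] {Γ : E → Type} (s : R → Str) (r : R) (l : Str) :
    update (full (Γ := Γ) s) (.inl r) l = full (update s r l) := by
  funext k
  by_cases h : k = .inl r
  · subst h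
    exact (update_self (β := fun k => List (RegΓ R Γ k)) _ _ _).trans (update_self r l s).symm
  · refine (update_of_ne (β := fun k => List (RegΓ R Γ k)) h _ _).trans ?_
    rcases k with k | k
    · exact (update_of_ne (by simpa using h) _ _).symm
    · rfl

theorem Rz.skip : Rz fun s s' : R → Str => s' = s :=
  .ofFrag (.single .halt) (.single _) 1 (by rintro s _ rfl; exact ⟨1, by simp, .single rfl⟩)

theorem Rz.push (r : R) (b : Bool) : Rz fun s s' : R → Str => s' = update s r (b :: s r) :=
  .ofFrag (.single (.push (.inl r) (fun _ => b) .halt)) (.single _) 1 (by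
    rintro s _ rfl
    refine ⟨1, by simp, .single ?_⟩
    simp only [TM2.stepAux]
    congr 1
    exact full_update s r _)

/-- The computations of the loop which pops the bits `b` from the register `r` and realizes `T b`.
The number `B` bounds the sizes of the intermediate contents. -/
inductive Iter (r : R) (T : Bool → (R → Str) → (R → Str) → Prop) (B : ℕ) :
    ℕ → (R → Str) → (R → Str) → Prop
  | done {s : R → Str} (h : s r = []) : Iter r T B 0 s s
  | next {s s₁ s₂ : R → Str} {k : ℕ} {b : Bool} {l : Str} (h : s r = b :: l) (hB : memSize s ≤ B)
      (hT : T b (update s r l) s₁) (hk : Iter r T B k s₁ s₂) : Iter r T B (k + 1) s s₂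

theorem memSize_update_le (s : R → Str) (r : R) (x : Str) (c : ℕ)
    (h : x.length ≤ (s r).length + c) : memSize (update s r x) ≤ memSize s + c :=
  stkSize_update_le s r x c h

/-- Each round costs at most `t₁ B + t₂ B + 1` steps, where `B` bounds all intermediate sizes.
Iterating a polynomial-time body could make sizes explode, so the bounds on `B` and on the number of
rounds are part of the realized relation. -/
theorem Rz.loop {T : Bool → (R → Str) → (R → Str) → Prop} (r : R) (q : Polynomial ℕ)
    (h : ∀ b, Rz (T b)) :
    Rz fun s s' => ∃ k ≤ q.eval (memSize s), Iter r T (q.eval (memSize s)) k s s' := by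
  obtain ⟨M, t₁, h₁⟩ := h true
  obtain ⟨N, t₂, h₂⟩ := h false
  obtain ⟨F, G, hF, hG, hM, hN⟩ := M.pair N (σ := M.σ × N.σ × Option Bool) (Equiv.refl _)
    ((Equiv.prodAssoc _ _ _).symm.trans (((Equiv.prodComm _ _).prodCongr (.refl _)).trans
      (Equiv.prodAssoc _ _ _)))
  refine ⟨⟨M.E ⊕ N.E, _, _, (M.v₀, N.v₀, none), .popLoop (.inl r) (fun v => v.2.2)
    (fun o v => (v.1, v.2.1, o)) id F G, hF.popLoop hG⟩, q * (t₁.comp q + t₂.comp q + 1) + 1, ?_⟩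
  rintro s s' ⟨k, hk, hs⟩
  set B := q.eval (memSize s) with hB
  clear_value B
  suffices h : ∃ n ≤ k * (t₁.eval B + t₂.eval B + 1) + 1,
      (Frag.popLoop (.inl r) (fun v => v.2.2) (fun o v => (v.1, v.2.1, o)) id F G).Reach
        (M.v₀, N.v₀, none) (full s) [] n (M.v₀, N.v₀, none) (full s') by
    obtain ⟨n, hn, h⟩ := h
    refine ⟨n, hn.trans ?_, h⟩
    simp only [Polynomial.eval_add, Polynomial.eval_mul, Polynomial.eval_comp,
      Polynomial.eval_one, ← hB]
    exact Nat.add_le_add_right (Nat.mul_le_mul_right _ hk) 1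
  clear hk hB
  induction hs with
  | done h => exact ⟨1, by omega, .popLoop_nil (fun _ _ => rfl) rfl h⟩
  | @next s s₁ s₂ k b l h hsB hT hs ih =>
    obtain ⟨n', hn', ih⟩ := ih
    have hle : memSize (update s r l) ≤ B :=
      (memSize_update_le s r l 0 (by simp [h])).trans hsB
    obtain ⟨n, hn, hT⟩ : ∃ n ≤ t₁.eval B + t₂.eval B,
        (bif b then F else G).Reach (M.v₀, N.v₀, none) (full (update s r l)) [] n
          (M.v₀, N.v₀, none) (full s₁) := by
      cases b
      · obtain ⟨n, hn, hc⟩ := h₂ _ _ hT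
        exact ⟨n, (hn.trans (eval_mono t₂ hle)).trans (Nat.le_add_left _ _), hN hc (M.v₀, none)⟩
      · obtain ⟨n, hn, hc⟩ := h₁ _ _ hT
        exact ⟨n, (hn.trans (eval_mono t₁ hle)).trans (Nat.le_add_right _ _),
          hM hc (N.v₀, none)⟩
    refine ⟨n + n' + 1, by rw [Nat.add_mul]; omega, ?_⟩
    refine Frag.Reach.popLoop_cons (get := fun v : M.σ × N.σ × Option Bool => v.2.2)
      (set := fun o v => (v.1, v.2.1, o)) (w := []) (w' := []) (a := b) (l := l)
      (fun _ _ => rfl) (fun _ _ => rfl) rfl h ?_ ih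
    rw [full_update]
    exact hT

/-- A loop whose body increases the size by at most a constant and does not touch the
loop register. -/
theorem Rz.forIn {g : Bool → (R → Str) → R → Str} (r : R) (c : ℕ)
    (h : ∀ b, Rz fun s s' => s' = g b s) (hg : ∀ b s x, g b (update s r x) = update (g b s) r x)
    (hr : ∀ b s, g b s r = s r) (hc : ∀ b s, memSize (g b s) ≤ memSize s + c) :
    Rz fun s s' => s' = (s r).foldl (fun s b => g b s) (update s r []) := by
  -- There are at most as many rounds as the initial size `m`, each adding at most `c`; so sizes
  -- stay below `(c + 1) * m`.
  refine (Rz.loop r (.C (c + 1) * .X) h).mono ?_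
  rintro s _ rfl
  have hlen : (s r).length ≤ memSize s :=
    Finset.single_le_sum (f := fun r => (s r).length) (fun _ _ => Nat.zero_le _) (Finset.mem_univ r)
  refine ⟨(s r).length, by simp; nlinarith, ?_⟩
  set B := (Polynomial.C (c + 1) * Polynomial.X).eval (memSize s) with hB
  have hle : memSize s + c * (s r).length ≤ B := by simp [hB]; nlinarith
  clear_value B
  clear hB hlen
  generalize hl : s r = l at *
  induction l generalizing s with
  | nil =>
    have : update s r [] = s := by rw [← hl]; exact update_eq_self r s
    simp only [List.foldl_nil, this]
    exact .done hl
  | cons b l ih =>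
    have h1 := memSize_update_le s r l 0 (by simp [hl])
    have h2 := hc b (update s r l)
    simp only [List.length_cons, Nat.mul_add, Nat.mul_one] at hle
    refine .next hl (by omega) rfl ?_
    have := ih (g b (update s r l)) (by rw [hr]; simp) (by omega)
    rw [← hg, update_idem] at this
    rwa [List.foldl_cons]

theorem Rz.clear (r : R) : Rz fun s s' : R → Str => s' = update s r [] := by
  refine (Rz.forIn (g := fun _ s => s) r 0 (fun _ => .skip) (by simp) (by simp) (by simp)).mono ?_
  rintro s _ rfl
  generalize s r = l
  induction l with
  | nil => rfl
  | cons b l ih => exact ih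

/-- Move the register `r` to the register `r'`, in reverse order. -/
theorem Rz.moveRev {r r' : R} (hr : r ≠ r') :
    Rz fun s s' : R → Str => s' = update (update s r []) r' ((s r).reverse ++ s r') := by
  refine (Rz.forIn (g := fun b s => update s r' (b :: s r')) r 1 (fun b => .push r' b) ?_ ?_ ?_).mono
    ?_
  · intro b s x
    rw [update_of_ne hr.symm, update_comm hr.symm]
  · intro b s; rw [update_of_ne hr]
  · intro b s; exact memSize_update_le _ _ _ _ (by simp)
  · rintro s _ rfl
    have : ∀ (l : Str) (s : R → Str), update s r' (l.reverse ++ s r') =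
        l.foldl (fun s b => update s r' (b :: s r')) s := by
      intro l
      induction l with
      | nil => simp
      | cons b l ih => intro s; rw [List.foldl_cons, ← ih]; simp
    rw [← this, update_of_ne hr.symm]

/-- Move the register `r` to the registers `r'` and `r''`, in reverse order. -/
theorem Rz.moveRev₂ {r r' r'' : R} (h : r ≠ r') (h' : r ≠ r'') (h'' : r' ≠ r'') :
    Rz fun s s' : R → Str => s' = update (update (update s r []) r' ((s r).reverse ++ s r')) r''
      ((s r).reverse ++ s r'') := by
  refine (Rz.forIn (g := fun b s => update (update s r' (b :: s r')) r'' (b :: s r'')) r 2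
    (fun b => ((Rz.push r' b).seq (Rz.push r'' b)).mono ?_) ?_ ?_ ?_).mono ?_
  · rintro s _ rfl
    exact ⟨_, rfl, by rw [update_of_ne h''.symm]⟩
  · intro b s x
    funext j
    simp only [update_apply]
    split_ifs <;> simp_all
  · intro b s; rw [update_of_ne h', update_of_ne h]
  · intro b s
    have h1 := memSize_update_le s r' (b :: s r') 1 (by simp)
    have h2 := memSize_update_le (update s r' (b :: s r')) r'' (b :: s r'') 1
      (by rw [update_of_ne h''.symm]; simp)
    omega
  · rintro s _ rfl
    have : ∀ (l : Str) (s : R → Str), update (update s r' (l.reverse ++ s r')) r''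
        (l.reverse ++ s r'') =
          l.foldl (fun s b => update (update s r' (b :: s r')) r'' (b :: s r'')) s := by
      intro l
      induction l with
      | nil => simp
      | cons b l ih =>
        intro s
        rw [List.foldl_cons, ← ih]
        funext j
        simp only [update_apply]
        split_ifs <;> simp_all
    rw [← this, update_of_ne h.symm, update_of_ne h'.symm]

/-- Copy a register to an empty one. -/
theorem Rz.copy {r r' : R} (h : r ≠ r') :
    Rz fun s s' : R → Str => s r' = [] ∧ s' = update s r' (s r) := by
  -- Moving reverses a word, so it is moved twice: to a hidden register, and from there to `r` and
  -- `r'` at once.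
  refine (((Rz.moveRev (R := R ⊕ Unit) (r := .inl r) (r' := .inr ()) (by simp)).seq
    (Rz.moveRev₂ (r := .inr ()) (r' := .inl r) (r'' := .inl r') (by simp) (by simp)
      (by simpa using h))).hide).mono ?_
  rintro s _ ⟨h0, rfl⟩
  refine ⟨_, rfl, ?_⟩
  funext j
  rcases j with j | j
  · by_cases h1 : j = r'
    · subst h1
      simp only [update_apply, Sum.elim_inl, Sum.elim_inr, reduceCtorEq, if_false, if_true, h0]
      simp
    · by_cases h2 : j = r
      · subst h2
        simp only [update_apply, Sum.elim_inl, Sum.elim_inr, reduceCtorEq, if_false, if_true, h1,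
          Sum.inl.injEq]
        simp
      · simp only [update_apply, Sum.elim_inl, reduceCtorEq, if_false, h1, h2, Sum.inl.injEq]
  · simp only [update_apply, Sum.elim_inr, reduceCtorEq, if_false, if_true]

/-- Empty several registers. -/
theorem Rz.clearAll (A : Finset R) :
    Rz fun s s' : R → Str => s' = fun r => if r ∈ A then [] else s r := by
  induction A using Finset.induction_on with
  | empty => simpa using Rz.skip
  | insert a A _ ih =>
    refine (ih.seq (.clear a)).mono ?_
    rintro s _ rfl
    refine ⟨_, rfl, ?_⟩
    funext j
    simp only [Finset.mem_insert, update_apply]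
    split_ifs <;> simp_all

/-- Copy several registers. -/
theorem Rz.copyAll : Rz fun s s' : R ⊕ R → Str => ∃ a, s = Sum.elim a (fun _ => []) ∧
    s' = Sum.elim a a := by
  have : ∀ A : Finset R, Rz fun s s' : R ⊕ R → Str => ∃ a, s = Sum.elim a (fun _ => []) ∧
      s' = Sum.elim a fun r => if r ∈ A then a r else [] := by
    intro A
    induction A using Finset.induction_on with
    | empty => exact Rz.skip.mono (by rintro _ _ ⟨a, rfl, rfl⟩; simp)
    | insert a A ha ih =>
      refine (ih.seq (.copy (r := .inl a) (r' := .inr a) (by simp))).mono ?_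
      rintro _ _ ⟨s, rfl, rfl⟩
      refine ⟨_, ⟨s, rfl, rfl⟩, by simp [ha], ?_⟩
      funext j
      rcases j with j | j
      · simp
      · simp only [Sum.elim_inr, Finset.mem_insert, update_apply, Sum.inr.injEq]
        split_ifs <;> simp_all
  simpa using this Finset.univ

end

/-! ### Polynomial-time functions on coded types -/

/-- Types whose elements are coded by the contents of finitely many registers. -/
class Code (α : Type) where
  R : Type
  [finR : Fintype R]
  [decR : DecidableEq R]
  enc : α → R → Str

attribute [reducible, instance] Code.finR Code.decR

instance : Code Str where
  R := Unit
  enc x _ := x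

instance : Code Bool where
  R := Unit
  enc b _ := [b]

instance {α β : Type} [Code α] [Code β] : Code (α × β) where
  R := Code.R α ⊕ Code.R β
  enc p := Sum.elim (Code.enc p.1) (Code.enc p.2)

open Code (enc)

/-- The size of the code. -/
def size {α : Type} [Code α] (a : α) : ℕ := memSize (enc a)

@[simp] theorem size_str (x : Str) : size x = x.length := by simp [size, memSize, enc, Code.R]

@[simp] theorem size_bool (b : Bool) : size b = 1 := by simp [size, memSize, enc, Code.R]

theorem memSize_elim {R R' : Type} [Fintype R] [Fintype R'] (s : R → Str) (s' : R' → Str) :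
    memSize (Sum.elim s s') = memSize s + memSize s' := by
  simp [memSize, Fintype.sum_sum_type]

@[simp] theorem memSize_nil {R : Type} [Fintype R] : memSize (fun _ : R => ([] : Str)) = 0 := by
  simp [memSize]

@[simp] theorem memSize_unit (x : Str) : memSize (fun _ : Unit => x) = x.length := by
  simp [memSize]

@[simp] theorem size_prod {α β : Type} [Code α] [Code β] (a : α) (b : β) :
    size (a, b) = size a + size b := memSize_elim _ _

section

variable {α β γ δ : Type} [Code α] [Code β] [Code γ] [Code δ]

/-- Functions computable in polynomial time. -/
def PT (f : α → β) : Prop :=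
  Rz (R := Code.R α ⊕ Code.R β) fun s s' =>
    ∃ a, s = Sum.elim (enc a) (fun _ => []) ∧ s' = Sum.elim (enc a) (enc (f a))

theorem PT.congr {f g : α → β} (hf : PT f) (h : ∀ a, g a = f a) : PT g := by
  rwa [show g = f from funext h]

theorem PT.exists_size_le {f : α → β} (hf : PT f) :
    ∃ q : Polynomial ℕ, ∀ a, size (f a) ≤ q.eval (size a) := by
  obtain ⟨q, hq⟩ := Rz.exists_growth hf
  refine ⟨q, fun a => ?_⟩
  have := hq _ _ ⟨a, rfl, rfl⟩
  simp only [memSize_elim, memSize_nil, Nat.add_zero] at this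
  exact (Nat.le_add_left _ _).trans this

/-- A call of `f` inside a larger memory, with arguments in the registers `i` and the result in the
empty registers `o`. -/
theorem PT.at {f : α → β} (hf : PT f) {R : Type} [Fintype R] [DecidableEq R] (i : Code.R α → R)
    (o : Code.R β → R) (h : Injective (Sum.elim i o)) :
    Rz fun s s' : R → Str => ∃ a, (∀ r, s (i r) = enc a r) ∧ (∀ r, s (o r) = []) ∧
      (∀ r, s' (i r) = enc a r) ∧ (∀ r, s' (o r) = enc (f a) r) ∧
      ∀ r, r ∉ Set.range (Sum.elim i o) → s' r = s r := by
  refine (Rz.rename hf h).mono ?_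
  rintro s s' ⟨a, h1, h2, h3, h4, h5⟩
  exact ⟨⟨a, funext (Sum.rec h1 h2), funext (Sum.rec h3 h4)⟩, h5⟩

theorem Rz.copyAt {R R' : Type} [Fintype R] [DecidableEq R] [Fintype R'] [DecidableEq R']
    (i o : R → R') (h : Injective (Sum.elim i o)) :
    Rz fun s s' : R' → Str => (∀ r, s (o r) = []) ∧ (∀ r, s' (i r) = s (i r)) ∧
      (∀ r, s' (o r) = s (i r)) ∧ ∀ r, r ∉ Set.range (Sum.elim i o) → s' r = s r := by
  refine (Rz.rename Rz.copyAll h).mono ?_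
  rintro s s' ⟨h1, h2, h3, h4⟩
  exact ⟨⟨fun r => s (i r), funext (Sum.rec (fun _ => rfl) h1), funext (Sum.rec h2 h3)⟩, h4⟩

theorem Rz.clearAt {R R' : Type} [Fintype R] [Fintype R'] [DecidableEq R'] (i : R → R') :
    Rz fun s s' : R' → Str => (∀ r, s' (i r) = []) ∧ ∀ r, r ∉ Set.range i → s' r = s r := by
  refine (Rz.clearAll (Finset.univ.image i)).mono ?_
  rintro s s' ⟨h1, h2⟩
  funext r
  by_cases hr : r ∈ Set.range i
  · obtain ⟨j, rfl⟩ := hr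
    simp [h1]
  · rw [if_neg (by simpa using hr), h2 r hr]

theorem PT.id : PT (fun a : α => a) := by
  refine Rz.copyAll.mono ?_
  rintro _ _ ⟨a, rfl, rfl⟩
  exact ⟨_, rfl, rfl⟩

theorem PT.comp {g : β → γ} {f : α → β} (hg : PT g) (hf : PT f) : PT fun a => g (f a) := by
  refine ((((hf.at (R := (Code.R α ⊕ Code.R γ) ⊕ Code.R β) (fun r => .inl (.inl r)) .inr
    (by rintro (_ | _) (_ | _) <;> simp)).seq
    (hg.at .inr (fun r => .inl (.inr r)) (by rintro (_ | _) (_ | _) <;> simp))).seq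
    (.clearAt .inr)).hide).mono ?_
  rintro _ _ ⟨a, rfl, rfl⟩
  refine ⟨Sum.elim (Sum.elim (enc a) (enc (g (f a)))) (enc (f a)),
    ⟨Sum.elim (Sum.elim (enc a) (fun _ => [])) (enc (f a)),
      ⟨a, fun _ => rfl, fun _ => rfl, fun _ => rfl, fun _ => rfl, ?_⟩,
      ⟨f a, fun _ => rfl, fun _ => rfl, fun _ => rfl, fun _ => rfl, ?_⟩⟩, fun _ => rfl, ?_⟩
  · rintro ((r | r) | r) hr
    exacts [rfl, rfl, absurd ⟨.inr r, rfl⟩ hr]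
  · rintro ((r | r) | r) hr
    exacts [rfl, absurd ⟨.inr r, rfl⟩ hr, rfl]
  · rintro ((r | r) | r) hr
    exacts [rfl, rfl, absurd ⟨r, rfl⟩ hr]

theorem PT.pair {f : α → β} {g : α → γ} (hf : PT f) (hg : PT g) : PT fun a => (f a, g a) := by
  refine ((hf.at (R := Code.R α ⊕ Code.R β ⊕ Code.R γ) .inl (fun r => .inr (.inl r))
    (by rintro (_ | _) (_ | _) <;> simp)).seq
    (hg.at .inl (fun r => .inr (.inr r)) (by rintro (_ | _) (_ | _) <;> simp))).mono ?_
  rintro _ _ ⟨a, rfl, rfl⟩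
  refine ⟨Sum.elim (enc a) (Sum.elim (enc (f a)) (fun _ => [])),
      ⟨a, fun _ => rfl, fun _ => rfl, fun _ => rfl, fun _ => rfl, ?_⟩,
      ⟨a, fun _ => rfl, fun _ => rfl, fun _ => rfl, fun _ => rfl, ?_⟩⟩
  · rintro (r | (r | r)) hr
    exacts [rfl, absurd ⟨.inr r, rfl⟩ hr, rfl]
  · rintro (r | (r | r)) hr
    exacts [rfl, rfl, absurd ⟨.inr r, rfl⟩ hr]

theorem PT.fst : PT fun p : α × β => p.1 := by
  refine (Rz.copyAt (R' := (Code.R α ⊕ Code.R β) ⊕ Code.R α) (fun r => .inl (.inl r)) .inr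
    (by rintro (_ | _) (_ | _) <;> simp)).mono ?_
  rintro _ _ ⟨a, rfl, rfl⟩
  refine ⟨fun _ => rfl, fun _ => rfl, fun _ => rfl, ?_⟩
  rintro ((r | r) | r) hr
  exacts [rfl, rfl, absurd ⟨.inr r, rfl⟩ hr]

theorem PT.snd : PT fun p : α × β => p.2 := by
  refine (Rz.copyAt (R' := (Code.R α ⊕ Code.R β) ⊕ Code.R β) (fun r => .inl (.inr r)) .inr
    (by rintro (_ | _) (_ | _) <;> simp)).mono ?_
  rintro _ _ ⟨a, rfl, rfl⟩
  refine ⟨fun _ => rfl, fun _ => rfl, fun _ => rfl, ?_⟩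
  rintro ((r | r) | r) hr
  exacts [rfl, rfl, absurd ⟨.inr r, rfl⟩ hr]

theorem Rz.pushList {R : Type} [Fintype R] [DecidableEq R] (r : R) (l : Str) :
    Rz fun s s' : R → Str => s' = update s r (l ++ s r) := by
  induction l with
  | nil => simpa using Rz.skip
  | cons b l ih =>
    refine (ih.seq (.push r b)).mono ?_
    rintro s _ rfl
    exact ⟨_, rfl, by simp⟩

theorem Rz.set {R : Type} [Fintype R] [DecidableEq R] (t : R → Str) :
    Rz fun s s' : R → Str => (∀ r, s r = []) ∧ s' = t := by
  have : ∀ A : Finset R, Rz fun s s' : R → Str => (∀ r, s r = []) ∧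
      s' = fun r => if r ∈ A then t r else [] := by
    intro A
    induction A using Finset.induction_on with
    | empty =>
      refine Rz.skip.mono ?_
      rintro s _ ⟨h, rfl⟩
      exact funext fun r => by simp [h]
    | insert a A ha ih =>
      refine (ih.seq (.pushList a (t a))).mono ?_
      rintro s _ ⟨h, rfl⟩
      refine ⟨_, ⟨h, rfl⟩, ?_⟩
      funext j
      simp only [Finset.mem_insert, update_apply]
      split_ifs <;> simp_all
  simpa using this Finset.univ

theorem PT.const (b : β) : PT fun _ : α => b := by
  refine (Rz.rename (Rz.set (enc b)) (ρ := (Sum.inr : _ → Code.R α ⊕ Code.R β))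
    Sum.inr_injective).mono ?_
  rintro _ _ ⟨a, rfl, rfl⟩
  refine ⟨⟨fun _ => rfl, rfl⟩, ?_⟩
  rintro (r | r) hr
  exacts [rfl, absurd ⟨r, rfl⟩ hr]

theorem PT.ite {c : α → Bool} {f g : α → β} (hc : PT c) (hf : PT f) (hg : PT g) :
    PT fun a => if c a then f a else g a := by
  have body : ∀ b : Bool, Rz (R := (Code.R α ⊕ Code.R β) ⊕ Unit) fun s s' => ∃ a,
      s = Sum.elim (Sum.elim (enc a) (fun _ => [])) (fun _ => []) ∧
      s' = Sum.elim (Sum.elim (enc a) (enc (if b then f a else g a))) (fun _ => []) := by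
    intro b
    have : PT fun a => if b then f a else g a := by cases b <;> simpa
    refine (Rz.rename this (ρ := Sum.inl) Sum.inl_injective).mono ?_
    rintro _ _ ⟨a, rfl, rfl⟩
    refine ⟨⟨a, rfl, rfl⟩, ?_⟩
    rintro (r | r) hr
    exacts [absurd ⟨r, rfl⟩ hr, rfl]
  -- A conditional is a loop over a hidden register holding the single bit `c a`: it runs once, and
  -- the bit selects the body.
  refine (((hc.at (R := (Code.R α ⊕ Code.R β) ⊕ Unit) (fun r => .inl (.inl r)) .inr
    (by rintro (_ | _) (_ | _) <;> simp)).seq (.loop (.inr ()) (.X + 1) body)).hide).mono ?_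
  rintro _ _ ⟨a, rfl, rfl⟩
  refine ⟨Sum.elim (Sum.elim (enc a) (fun _ => [])) (fun _ => [c a]),
      ⟨a, fun _ => rfl, fun _ => rfl, fun _ => rfl, fun _ => rfl, ?_⟩, 1, by simp,
      .next (b := c a) (l := []) (by simp) (by simp) ⟨a, ?_, rfl⟩ (.done rfl)⟩
  · rintro ((r | r) | r) hr
    exacts [rfl, rfl, absurd ⟨.inr r, rfl⟩ hr]
  · funext r
    rcases r with (r | r) | r
    exacts [rfl, rfl, by simp]

/-- The registers used for a recursion. -/
abbrev FoldRegs (α β : Type) [Code α] [Code β] : Type :=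
  (Code.R α ⊕ Code.R β) ⊕ Unit ⊕ Unit ⊕ Code.R β

/-- Contents of the registers used for a recursion. -/
def foldRegs (a : Code.R α → Str) (b : Code.R β → Str) (x y : Str) (c : Code.R β → Str) :
    FoldRegs α β → Str :=
  Sum.elim (Sum.elim a b) (Sum.elim (fun _ => x) (Sum.elim (fun _ => y) c))

/-- Bounded recursion. -/
theorem PT.foldl {l : α → Str} {i : α → β} {F : α → β → Bool → β} (hl : PT l) (hi : PT i)
    (hF : PT fun p : α × β × Bool => F p.1 p.2.1 p.2.2) (q : Polynomial ℕ)
    (hq : ∀ a l₁ l₂, l a = l₁ ++ l₂ → size (l₁.foldl (F a) (i a)) ≤ q.eval (size a)) :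
    PT fun a => (l a).foldl (F a) (i a) := by
  have body : ∀ b, Rz (R := FoldRegs α β) fun s s' => ∃ (a : α) (z : β) (x : Str),
      s = foldRegs (enc a) (enc z) x [] (fun _ => []) ∧
      s' = foldRegs (enc a) (enc (F a z b)) x [] (fun _ => []) := by
    intro b
    -- One round: record the popped bit, compute the new value in scratch registers, let it replace
    -- the old value, and empty the scratch registers and the recorded bit.
    refine ((((((Rz.push (R := FoldRegs α β) (.inr (.inr (.inl ()))) b).seq (hF.at (R := FoldRegs α β)
      (Sum.elim (fun r => .inl (.inl r)) (Sum.elim (fun r => .inl (.inr r))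
        (fun r => .inr (.inr (.inl r)))))
      (fun r => .inr (.inr (.inr r)))
      (by rintro ((_ | (_ | _)) | _) ((_ | (_ | _)) | _) <;> simp <;> rintro rfl <;> rfl))).seq
      (.clearAt fun r : Code.R β => .inl (.inr r))).seq
      (.copyAt (R := Code.R β) (fun r => .inr (.inr (.inr r))) (fun r => .inl (.inr r))
        (by rintro (_ | _) (_ | _) <;> simp))).seq
      (.clearAt fun r : Code.R β => .inr (.inr (.inr r)))).seq
      (.clear (.inr (.inr (.inl ()))))).mono ?_
    rintro _ _ ⟨a, z, x, rfl, rfl⟩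
    refine ⟨foldRegs (enc a) (enc (F a z b)) x [b] (fun _ => []),
      ⟨foldRegs (enc a) (enc (F a z b)) x [b] (enc (F a z b)),
      ⟨foldRegs (enc a) (fun _ => []) x [b] (enc (F a z b)),
      ⟨foldRegs (enc a) (enc z) x [b] (enc (F a z b)),
      ⟨foldRegs (enc a) (enc z) x [b] (fun _ => []), ?_,
      ⟨(a, z, b), ?_, fun _ => rfl, ?_, fun _ => rfl, ?_⟩⟩,
      fun _ => rfl, ?_⟩, fun _ => rfl, fun _ => rfl, fun _ => rfl, ?_⟩, fun _ => rfl, ?_⟩, ?_⟩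
    · funext r
      rcases r with (r | r) | (r | (r | r)) <;> simp [foldRegs]
    · rintro (r | (r | r)) <;> rfl
    · rintro (r | (r | r)) <;> rfl
    · rintro ((r | r) | (r | (r | r))) hr
      exacts [rfl, rfl, rfl, rfl, absurd ⟨.inr r, rfl⟩ hr]
    · rintro ((r | r) | (r | (r | r))) hr
      exacts [rfl, absurd ⟨r, rfl⟩ hr, rfl, rfl, rfl]
    · rintro ((r | r) | (r | (r | r))) hr
      exacts [rfl, absurd ⟨.inr r, rfl⟩ hr, rfl, rfl, rfl]
    · rintro ((r | r) | (r | (r | r))) hr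
      exacts [rfl, rfl, rfl, rfl, absurd ⟨r, rfl⟩ hr]
    · funext r
      rcases r with (r | r) | (r | (r | r)) <;> simp [foldRegs]
  refine ((((hl.at (R := FoldRegs α β) (fun r => .inl (.inl r)) (fun r => .inr (.inl r))
    (by rintro (_ | _) (_ | _) <;> simp)).seq
    (hi.at (R := FoldRegs α β) (fun r => .inl (.inl r)) (fun r => .inl (.inr r))
      (by rintro (_ | _) (_ | _) <;> simp))).seq
    (.loop (.inr (.inl ())) (.X + .X + q) body)).hide).mono ?_
  rintro _ _ ⟨a, rfl, rfl⟩
  refine ⟨foldRegs (enc a) (enc (i a)) (l a) [] (fun _ => []),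
    ⟨foldRegs (enc a) (fun _ => []) (l a) [] (fun _ => []),
      ⟨a, fun _ => rfl, fun _ => rfl, fun _ => rfl, fun _ => rfl, ?_⟩,
      ⟨a, fun _ => rfl, fun _ => rfl, fun _ => rfl, fun _ => rfl, ?_⟩⟩, (l a).length, ?_, ?_⟩
  · rintro ((r | r) | (r | (r | r))) hr
    exacts [rfl, rfl, absurd ⟨.inr r, rfl⟩ hr, rfl, rfl]
  · rintro ((r | r) | (r | (r | r))) hr
    exacts [rfl, absurd ⟨.inr r, rfl⟩ hr, rfl, rfl, rfl]
  · simp [foldRegs, memSize_elim]; omega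
  · have hst : ∀ (z : β) (x : Str), memSize (foldRegs (enc a) (enc z) x [] (fun _ => [])) =
        size a + size z + x.length := fun z x => by simp [foldRegs, memSize_elim, size]
    have hfin : (Sum.elim (Sum.elim (enc a) (enc ((l a).foldl (F a) (i a)))) fun _ => [] :
        FoldRegs α β → Str) =
          foldRegs (enc a) (enc ((l a).foldl (F a) (i a))) [] [] (fun _ => []) := by
      funext r
      rcases r with (r | r) | (r | (r | r)) <;> rfl
    beta_reduce
    rw [hfin]
    clear hfin
    -- At any moment the memory holds the argument, a partial result bounded by `q`, and the unread
    -- rest of the list.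
    have hB : ∀ l₁ l₂, l a = l₁ ++ l₂ → size a + size (l₁.foldl (F a) (i a)) + l₂.length ≤
        (Polynomial.X + Polynomial.X + q).eval
          (memSize (foldRegs (enc a) (enc (i a)) (l a) [] (fun _ => []))) := by
      intro l₁ l₂ h
      have h1 := hq a l₁ l₂ h
      have h2 := eval_mono q (show size a ≤ memSize (foldRegs (enc a) (enc (i a)) (l a) []
        (fun _ => [])) by rw [hst]; omega)
      have h3 : l₂.length ≤ (l a).length := by simp [h]
      have h4 := hst (i a) (l a)
      simp only [Polynomial.eval_add, Polynomial.eval_X]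
      omega
    generalize (Polynomial.X + Polynomial.X + q).eval
          (memSize (foldRegs (enc a) (enc (i a)) (l a) [] (fun _ => []))) = B at hB ⊢
    generalize l a = x at *
    generalize i a = z at *
    clear hl hi hq
    induction x generalizing z with
    | nil => exact .done rfl
    | cons b x ih =>
      refine .next (b := b) (l := x) rfl ?_ ⟨a, z, x, ?_, rfl⟩ (ih _ ?_)
      · rw [hst]
        exact hB [] _ rfl
      · funext r
        rcases r with (r | r) | (r | (r | r)) <;> simp [foldRegs]
      · intro l₁ l₂ h
        exact hB (b :: l₁) l₂ (by simp [h])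

/-- Recursion with steps increasing the size by at most a constant. -/
theorem PT.foldl_of_le {l : α → Str} {i : α → β} {F : α → β → Bool → β} (hl : PT l) (hi : PT i)
    (hF : PT fun p : α × β × Bool => F p.1 p.2.1 p.2.2) (c : ℕ)
    (hc : ∀ a z b, size (F a z b) ≤ size z + c) : PT fun a => (l a).foldl (F a) (i a) := by
  obtain ⟨ql, hql⟩ := hl.exists_size_le
  obtain ⟨qi, hqi⟩ := hi.exists_size_le
  refine hl.foldl hi hF (qi + .C c * ql) fun a l₁ l₂ h => ?_
  have key : ∀ (l : Str) (z : β), size (l.foldl (F a) z) ≤ size z + c * l.length := by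
    intro l
    induction l with
    | nil => simp
    | cons b l ih =>
      intro z
      have h1 := ih (F a z b)
      have h2 := hc a z b
      simp only [List.foldl_cons, List.length_cons, Nat.mul_add, Nat.mul_one]
      omega
  have h1 := key l₁ (i a)
  have h2 := hqi a
  have h3 := hql a
  have h4 : c * l₁.length ≤ c * ql.eval (size a) := by
    refine Nat.mul_le_mul_left _ (le_trans ?_ h3)
    simp [h]
  simp only [Polynomial.eval_add, Polynomial.eval_mul, Polynomial.eval_C]
  omega

end

/-! ### A library of polynomial-time functions -/

section

variable {α β γ δ : Type} [Code α] [Code β] [Code γ] [Code δ]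

theorem PT.cons_const (b : Bool) : PT fun x : Str => b :: x := by
  refine (PT.id.seq (.push (R := Code.R Str ⊕ Code.R Str) (.inr ()) b)).mono ?_
  rintro _ _ ⟨x, rfl, rfl⟩
  refine ⟨_, ⟨x, rfl, rfl⟩, ?_⟩
  funext r
  rcases r with r | r
  · exact (update_of_ne (by simp) _ _).symm
  · exact (update_self (Sum.inr () : Code.R Str ⊕ Code.R Str) (b :: x : Str)
      (Sum.elim (fun _ => x) fun _ => x)).symm

theorem PT.cons {f : α → Bool} {g : α → Str} (hf : PT f) (hg : PT g) :
    PT fun a => f a :: g a :=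
  (hf.ite ((PT.cons_const true).comp hg) ((PT.cons_const false).comp hg)).congr
    fun a => by cases f a <;> rfl

theorem PT.not {f : α → Bool} (hf : PT f) : PT fun a => !f a :=
  (hf.ite (.const false) (.const true)).congr fun a => by cases f a <;> rfl

theorem PT.and {f g : α → Bool} (hf : PT f) (hg : PT g) : PT fun a => f a && g a :=
  (hf.ite hg (.const false)).congr fun a => by cases f a <;> rfl

theorem PT.or {f g : α → Bool} (hf : PT f) (hg : PT g) : PT fun a => f a || g a :=
  (hf.ite (.const true) hg).congr fun a => by cases f a <;> rfl

theorem PT.xor {f g : α → Bool} (hf : PT f) (hg : PT g) : PT fun a => f a ^^ g a :=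
  (hf.ite hg.not hg).congr fun a => by cases f a <;> simp

theorem PT.reverse {f : α → Str} (hf : PT f) : PT fun a => (f a).reverse :=
  (hf.foldl_of_le (i := fun _ => []) (F := fun _ z b => b :: z) (.const _)
    ((PT.snd.comp PT.snd).cons (PT.fst.comp PT.snd)) 1 (by simp)).congr fun a => by simp

/-- Recursion from the right, with steps increasing the size by at most a constant. -/
theorem PT.foldr_of_le {l : α → Str} {i : α → β} {F : α → Bool → β → β} (hl : PT l) (hi : PT i)
    (hF : PT fun p : α × β × Bool => F p.1 p.2.2 p.2.1) (c : ℕ)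
    (hc : ∀ a z b, size (F a b z) ≤ size z + c) : PT fun a => (l a).foldr (F a) (i a) :=
  (hl.reverse.foldl_of_le (F := fun a z b => F a b z) hi hF c hc).congr fun a => by simp

theorem PT.append {f g : α → Str} (hf : PT f) (hg : PT g) : PT fun a => f a ++ g a :=
  (hf.foldr_of_le (F := fun _ b z => b :: z) hg
    ((PT.snd.comp PT.snd).cons (PT.fst.comp PT.snd)) 1 (by simp)).congr fun a => by simp

theorem PT.isEmpty {f : α → Str} (hf : PT f) : PT fun a => (f a).isEmpty :=
  (hf.foldl_of_le (i := fun _ => true) (F := fun _ _ _ => false) (.const _) (.const _) 0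
    (by simp)).congr fun a => by
      rcases f a with _ | ⟨b, l⟩
      · rfl
      · simp only [List.isEmpty_cons, List.foldl_cons]
        induction l with
        | nil => rfl
        | cons _ _ ih => exact ih

theorem PT.headD {f : α → Str} (hf : PT f) : PT fun a => (f a).headD false :=
  (hf.foldr_of_le (i := fun _ => false) (F := fun _ b _ => b) (.const _)
    (PT.snd.comp PT.snd) 0 (by simp)).congr fun a => by cases f a <;> rfl

theorem PT.tail {f : α → Str} (hf : PT f) : PT fun a => (f a).tail := by
  -- The flag marks the first bit, which is skipped; the others accumulate in reverse order, whence
  -- the final reversal.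
  have h := (PT.snd.comp (hf.foldl_of_le (i := fun _ => (true, ([] : Str)))
    (F := fun _ z b => (false, if z.1 then [] else b :: z.2)) (.const _)
    ((PT.const _).pair ((PT.fst.comp (PT.fst.comp .snd)).ite (.const _)
      ((PT.snd.comp .snd).cons (PT.snd.comp (PT.fst.comp .snd))))) 1
    (by rintro _ ⟨_ | _, _⟩ _ <;> simp; omega))).reverse
  refine h.congr fun a => ?_
  have key : ∀ l z : Str, (l.foldl (fun (z : Bool × Str) b =>
      (false, if z.1 then [] else b :: z.2)) (false, z)).2 = l.reverse ++ z := by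
    intro l
    induction l with
    | nil => simp
    | cons b l ih => intro z; simpa using ih (b :: z)
  rcases f a with _ | ⟨b, l⟩
  · rfl
  · simp [key]

/-- Drop as many bits as `f a` has. -/
theorem PT.drop {f g : α → Str} (hf : PT f) (hg : PT g) :
    PT fun a => (g a).drop (f a).length := by
  refine (hf.foldl_of_le (F := fun _ z _ => z.tail) hg (PT.tail (PT.fst.comp .snd)) 0
    (by simp)).congr fun a => ?_
  generalize g a = z
  induction f a generalizing z with
  | nil => rfl
  | cons b l ih => simp [← ih]

theorem PT.beq {f g : α → Bool} (hf : PT f) (hg : PT g) : PT fun a => f a == g a :=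
  (hf.xor hg).not.congr fun a => by cases f a <;> cases g a <;> rfl

theorem PT.decide_eq {f g : α → Str} (hf : PT f) (hg : PT g) : PT fun a => decide (f a = g a) := by
  -- While `f a` is read, `g a` is stripped bit by bit. The emptiness test makes the default of
  -- `headD` harmless, and equality also requires that nothing of `g a` remains.
  have h := hf.foldl_of_le (i := fun a => (g a, true))
    (F := fun _ z b => (z.1.tail, z.2 && !z.1.isEmpty && (z.1.headD false == b)))
    (hg.pair (.const _)) ((PT.tail (PT.fst.comp (PT.fst.comp .snd))).pair
      (((PT.snd.comp (PT.fst.comp .snd)).and (PT.isEmpty (PT.fst.comp (PT.fst.comp .snd))).not).and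
        ((PT.headD (PT.fst.comp (PT.fst.comp .snd))).beq (PT.snd.comp .snd)))) 0
    (by rintro _ ⟨_, _⟩ _; simp)
  refine ((PT.snd.comp h).and (PT.isEmpty (PT.fst.comp h))).congr fun a => ?_
  generalize g a = y
  have key : ∀ (x y : Str) (c : Bool), decide (c = true ∧ x = y) =
      (let z := x.foldl (fun (z : Str × Bool) b =>
        (z.1.tail, z.2 && !z.1.isEmpty && (z.1.headD false == b))) (y, c)
      z.2 && z.1.isEmpty) := by
    intro x
    induction x with
    | nil => intro y c; cases y <;> cases c <;> simp
    | cons b x ih =>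
      intro y c
      rw [List.foldl_cons, ← ih]
      rcases y with _ | ⟨b', y⟩
      · simp
      · simp only [List.isEmpty_cons, Bool.not_false, Bool.and_true, List.headD_cons,
          List.tail_cons, List.cons.injEq, Bool.and_eq_true, beq_iff_eq]
        congr 1
        rw [eq_comm (a := b), and_assoc]
  simpa using key (f a) y true

/-! #### Binary successor -/

/-- The carry and the sum when a bit is added to a binary number. -/
def addBit (x : Str) (c : Bool) : Bool × Str :=
  x.foldr (fun b z => (b && z.1, (b ^^ z.1) :: z.2)) (c, [])

theorem PT.addBit {f : α → Str} (hf : PT f) (c : Bool) : PT fun a => addBit (f a) c :=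
  hf.foldr_of_le (F := fun _ b z => (b && z.1, (b ^^ z.1) :: z.2)) (.const _)
    (((PT.snd.comp .snd).and (PT.fst.comp (PT.fst.comp .snd))).pair
      (((PT.snd.comp .snd).xor (PT.fst.comp (PT.fst.comp .snd))).cons
        (PT.snd.comp (PT.fst.comp .snd)))) 1 (by simp; omega)

/-! #### Padding -/

/-- `w10⋯0`, of length `n` if `w` is shorter than that. -/
def pad (n : ℕ) (w : Str) : Str := w ++ true :: List.replicate (n - w.length - 1) false

/-- Whether there is a bit `1`, and the part before the last one. -/
def unpad (u : Str) : Bool × Str :=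
  u.foldr (fun b z => if z.1 then (true, b :: z.2) else (b, z.2)) (false, [])

theorem PT.unpad {f : α → Str} (hf : PT f) : PT fun a => unpad (f a) :=
  hf.foldr_of_le (i := fun _ => (false, []))
    (F := fun _ b (z : Bool × Str) => if z.1 then (true, b :: z.2) else (b, z.2)) (.const _)
    ((PT.fst.comp (PT.fst.comp .snd)).ite ((PT.const _).pair ((PT.snd.comp .snd).cons
      (PT.snd.comp (PT.fst.comp .snd)))) ((PT.snd.comp .snd).pair
        (PT.snd.comp (PT.fst.comp .snd)))) 1
    (by rintro _ ⟨_ | _, _⟩ _ <;> simp; omega)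

theorem unpad_true_cons (w : Str) {u : Str} {z : Str} (h : unpad u = (true, z)) :
    unpad (w ++ u) = (true, w ++ z) := by
  induction w with
  | nil => exact h
  | cons b w ih =>
    have : unpad (b :: (w ++ u)) = if (unpad (w ++ u)).1 then (true, b :: (unpad (w ++ u)).2)
      else (b, (unpad (w ++ u)).2) := rfl
    rw [List.cons_append, this, ih]; simp

theorem unpad_replicate (n : ℕ) : unpad (List.replicate n false) = (false, []) := by
  induction n with
  | zero => rfl
  | succ n ih =>
    have : unpad (false :: List.replicate n false) = if (unpad (List.replicate n false)).1
      then (true, false :: (unpad (List.replicate n false)).2)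
      else (false, (unpad (List.replicate n false)).2) := rfl
    rw [List.replicate_succ, this, ih]; simp

theorem unpad_pad (n : ℕ) (w : Str) : unpad (pad n w) = (true, w) := by
  have h : unpad (true :: List.replicate (n - w.length - 1) false) = (true, []) := by
    have : unpad (true :: List.replicate (n - w.length - 1) false) =
      if (unpad (List.replicate (n - w.length - 1) false)).1
      then (true, true :: (unpad (List.replicate (n - w.length - 1) false)).2)
      else (true, (unpad (List.replicate (n - w.length - 1) false)).2) := rfl
    rw [this, unpad_replicate]; simp
  simpa [pad] using unpad_true_cons w h

theorem length_pad {n : ℕ} {w : Str} (h : w.length < n) : (pad n w).length = n := by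
  simp [pad]; omega

/-- The last bit `1` separates the word from its padding, so a padded word is determined by its
length and content. This preserves uniqueness when certificates are brought to a fixed length. -/
theorem eq_pad_of_unpad {u w : Str} (h : unpad u = (true, w)) : u = pad u.length w := by
  have key : ∀ u : Str, ((unpad u).1 = true → u = pad u.length (unpad u).2) ∧
      ((unpad u).1 = false → u = List.replicate u.length false ∧ (unpad u).2 = []) := by
    intro u
    induction u with
    | nil => simp [unpad]
    | cons b u ih =>
      have : unpad (b :: u) = if (unpad u).1 then (true, b :: (unpad u).2)
        else (b, (unpad u).2) := rfl
      rw [this]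
      cases hu : (unpad u).1
      · obtain ⟨h1, h2⟩ := ih.2 hu
        cases b
        · simp only [h2, reduceCtorEq, if_false, List.length_cons, List.replicate_succ]
          refine ⟨fun h => by simp at h, fun _ => ⟨by rw [← h1], by simp⟩⟩
        · simp only [h2]
          refine ⟨fun _ => ?_, fun h => by simp at h⟩
          simp [pad, ← h1]
      · refine ⟨fun _ => ?_, fun h => by simp at h⟩
        have h1 := ih.1 hu
        simp only [if_true]
        unfold pad at h1 ⊢
        simp only [List.cons_append, List.length_cons]
        conv_lhs => rw [h1]
        congr 5; omega
  have := (key u).1 (by rw [h])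
  rwa [h] at this

/-! #### Pairs of strings -/

/-- A string coding two strings. -/
def pairStr (x y : Str) : Str := x.foldr (fun b z => true :: b :: z) (false :: y)

/-- The steps of the decoding of two strings. The first two components say whether the second
string has begun, and whether the next bit belongs to the first string. -/
def unpairStep (z : (Bool × Bool) × Str × Str) (b : Bool) : (Bool × Bool) × Str × Str :=
  if z.1.1 then (z.1, z.2.1, b :: z.2.2)
  else if z.1.2 then ((false, false), b :: z.2.1, z.2.2)
  else (if b then (false, true) else (true, false), z.2)

/-- The strings coded by a string. -/
def unpairStr (s : Str) : Str × Str :=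
  let z := s.foldl unpairStep ((false, false), [], [])
  (z.2.1.reverse, z.2.2.reverse)

/-- Every bit of the first string is announced by a `1`, and a `0` in place of an announcement opens
the second string; hence the code can be read from left to right. -/
theorem unpairStr_pairStr (x y : Str) : unpairStr (pairStr x y) = (x, y) := by
  have h1 : ∀ (y X Y : Str), y.foldl unpairStep ((true, false), X, Y) =
      ((true, false), X, y.reverse ++ Y) := by
    intro y
    induction y with
    | nil => simp
    | cons b y ih => intro X Y; simp [unpairStep, ih]
  have h2 : ∀ (x X : Str), (pairStr x y).foldl unpairStep ((false, false), X, []) =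
      ((true, false), x.reverse ++ X, y.reverse) := by
    intro x
    induction x with
    | nil => intro X; simp [pairStr, unpairStep, h1]
    | cons b x ih =>
      intro X
      have : pairStr (b :: x) y = true :: b :: pairStr x y := rfl
      simp [this, unpairStep, ih]
  simp [unpairStr, h2]

@[simp] theorem length_pairStr (x y : Str) : (pairStr x y).length = 2 * x.length + y.length + 1 := by
  induction x with
  | nil => simp [pairStr]
  | cons b x ih =>
    have : pairStr (b :: x) y = true :: b :: pairStr x y := rfl
    simp [this, ih]; omega

theorem PT.pairStr {f g : α → Str} (hf : PT f) (hg : PT g) : PT fun a => pairStr (f a) (g a) :=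
  hf.foldr_of_le (F := fun _ b z => true :: b :: z) ((PT.const _).cons hg)
    ((PT.const _).cons ((PT.snd.comp .snd).cons (PT.fst.comp .snd))) 2 (by simp)

theorem PT.unpairStr {f : α → Str} (hf : PT f) : PT fun a => unpairStr (f a) := by
  have z : PT fun p : α × ((Bool × Bool) × Str × Str) × Bool => p.2.1 := PT.fst.comp .snd
  have b : PT fun p : α × ((Bool × Bool) × Str × Str) × Bool => p.2.2 := PT.snd.comp .snd
  have h := hf.foldl_of_le (i := fun _ => ((false, false), ([] : Str), ([] : Str)))
    (F := fun _ => unpairStep) (.const _)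
    ((PT.fst.comp (PT.fst.comp z)).ite
      ((PT.fst.comp z).pair ((PT.fst.comp (PT.snd.comp z)).pair
        (b.cons (PT.snd.comp (PT.snd.comp z)))))
      ((PT.snd.comp (PT.fst.comp z)).ite
        ((PT.const _).pair ((b.cons (PT.fst.comp (PT.snd.comp z))).pair
          (PT.snd.comp (PT.snd.comp z))))
        ((b.ite (.const _) (.const _)).pair (PT.snd.comp z)))) 1
    (by
      rintro _ ⟨⟨_ | _, _ | _⟩, _, _⟩ _ <;> simp [unpairStep] <;> (try split_ifs) <;>
        (try simp) <;> omega)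
  exact (PT.reverse (PT.fst.comp (PT.snd.comp h))).pair (PT.reverse (PT.snd.comp (PT.snd.comp h)))

/-! #### Clocks -/

/-- Multiplication of unary numbers, by repeated concatenation. With concatenation as addition it
yields clocks for all polynomials. -/
theorem PT.replicate_mul {f g : α → Str} (hf : PT f) (hg : PT g) :
    PT fun a => List.replicate ((f a).length * (g a).length) false := by
  obtain ⟨qf, hqf⟩ := hf.exists_size_le
  obtain ⟨qg, hqg⟩ := hg.exists_size_le
  have hg' : PT fun a => List.replicate (g a).length false :=
    (hg.foldr_of_le (i := fun _ => []) (F := fun _ _ z => false :: z) (.const _)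
      ((PT.const _).cons (PT.fst.comp .snd)) 1 (by simp)).congr fun a => by
        induction g a with
        | nil => rfl
        | cons b l ih => rw [List.length_cons, List.replicate_succ, ih]; rfl
  have key : ∀ (l y : Str) (n : ℕ), l.foldl (fun z _ => List.replicate y.length false ++ z)
      (List.replicate n false) = List.replicate (l.length * y.length + n) false := by
    intro l y
    induction l with
    | nil => simp
    | cons b l ih =>
      intro n
      rw [List.foldl_cons, List.replicate_append_replicate, ih, List.length_cons]
      congr 1; ring
  refine (hf.foldl (i := fun _ => []) (F := fun a z _ => List.replicate (g a).length false ++ z)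
    (.const _) ((hg'.comp .fst).append (PT.fst.comp .snd)) (qf * qg) ?_).congr fun a => ?_
  · intro a l₁ l₂ h
    have h1 := key l₁ (g a) 0
    have h2 := hqf a
    have h3 := hqg a
    rw [h] at h2
    simp only [size_str, List.length_append] at h2 h3
    simp only [List.replicate_zero] at h1
    rw [h1]
    simpa using Nat.mul_le_mul (by omega) h3
  · simp

/-- The clock `0^{q(|f a|)}`. -/
theorem PT.clock {f : α → Str} (hf : PT f) (q : Polynomial ℕ) :
    PT fun a => List.replicate (q.eval (f a).length) false := by
  induction q using Polynomial.induction_on' with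
  | add p q hp hq =>
    exact (hp.append hq).congr fun a => by simp [List.replicate_append_replicate]
  | monomial n c =>
    induction n with
    | zero => exact (PT.const (List.replicate c false)).congr fun a => by simp
    | succ n ih =>
      exact (ih.replicate_mul hf).congr fun a => by simp [pow_succ, mul_assoc]

end

/-! ### Passage between the calculus and Turing machines, deterministic and nondeterministic. -/

/-! ### Given deterministic machines -/

/-- Contents of registers and further stacks. -/
def mix {R E : Type} {Γ : E → Type} (s : R → Str) (S : ∀ k, List (Γ k)) :
    ∀ k, List (RegΓ R Γ k)
  | .inl r => s r
  | .inr k => S k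

section mix

variable {R E : Type} [DecidableEq R] [DecidableEq E] {Γ : E → Type}

theorem full_eq_mix (s : R → Str) : full (Γ := Γ) s = mix s fun _ => [] := by
  funext k
  rcases k with k | k <;> rfl

theorem update_mix_inl (s : R → Str) (S : ∀ k, List (Γ k)) (r : R) (l : Str) :
    update (mix s S) (.inl r) l = mix (update s r l) S := by
  funext k
  by_cases h : k = .inl r
  · subst h
    exact (update_self (β := fun k => List (RegΓ R Γ k)) _ _ _).trans (update_self r l s).symm
  · refine (update_of_ne (β := fun k => List (RegΓ R Γ k)) h _ _).trans ?_
    rcases k with k | k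
    · exact (update_of_ne (by simpa using h) _ _).symm
    · rfl

theorem update_mix_inr (s : R → Str) (S : ∀ k, List (Γ k)) (e : E) (l : List (Γ e)) :
    update (mix s S) (.inr e) l = mix s (update S e l) := by
  funext k
  by_cases h : k = .inr e
  · subst h
    exact (update_self (β := fun k => List (RegΓ R Γ k)) _ _ _).trans (update_self e l S).symm
  · refine (update_of_ne (β := fun k => List (RegΓ R Γ k)) h _ _).trans ?_
    rcases k with k | k
    · rfl
    · exact (update_of_ne (by simpa using h) _ _).symm

theorem stkSize_mix [Fintype R] [Fintype E] (s : R → Str) (S : ∀ k, List (Γ k)) :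
    stkSize (mix s S) = memSize s + stkSize S := by
  simp [stkSize, memSize, Fintype.sum_sum_type, mix]

/-- Move a register to a further stack. -/
theorem reach_moveMap_inr {σ : Type} {e : E} (f : Option Bool → Γ e) (r : R) (v : σ)
    (s : R → Str) (S : ∀ k, List (Γ k)) :
    (Frag.moveMap (σ := σ × Option Bool) (Γ := RegΓ R Γ) (.inl r) (.inr e) (fun v => v.2)
      (fun o v => (v.1, o)) id f).Reach (v, none) (mix s S) [] ((s r).length + 1) (v, none)
      (mix (update s r []) (update S e (((s r).map fun b => f (some b)).reverse ++ S e))) := by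
  have h := Frag.Reach.moveMap (σ := σ × Option Bool) (Γ := RegΓ R Γ) (k := .inl r)
    (k' := .inr e) (by simp) (get := fun v => v.2) (set := fun o v => (v.1, o)) (read := id)
    (f := f) (fun _ _ => rfl) (fun _ _ => rfl) (v := (v, none)) rfl (s r) (mix s S) rfl
  exact h.cast rfl ((congrArg (fun T => update T _ _) (update_mix_inl s S r [])).trans
    (update_mix_inr (update s r []) S e (((s r).map fun b => f (some b)).reverse ++ S e)))

/-- Move a further stack to a register. -/
theorem reach_moveMap_inl {σ : Type} {e : E} (f : Γ e → Bool) (r : R) (v : σ)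
    (s : R → Str) (S : ∀ k, List (Γ k)) :
    (Frag.moveMap (σ := σ × Option Bool) (Γ := RegΓ R Γ) (.inr e) (.inl r) (fun v => v.2)
      (fun o v => (v.1, o)) f (fun o => o.getD false)).Reach (v, none) (mix s S) []
      ((S e).length + 1) (v, none)
      (mix (update s r (((S e).map f).reverse ++ s r)) (update S e [])) := by
  have h := Frag.Reach.moveMap (σ := σ × Option Bool) (Γ := RegΓ R Γ) (k := .inr e)
    (k' := .inl r) (by simp) (get := fun v => v.2) (set := fun o v => (v.1, o)) (read := f)
    (f := fun o => o.getD false) (fun _ _ => rfl) (fun _ _ => rfl) (v := (v, none)) rfl (S e)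
    (mix s S) rfl
  exact h.cast rfl ((congrArg (fun T => update T _ _) (update_mix_inr s S e [])).trans
    (update_mix_inl s (update S e []) r (((S e).map f).reverse ++ s r)))

end mix

/-- A Turing machine as a fragment. -/
def ofTM (tm : FinTM2) : Frag tm.Γ tm.σ where
  Λ := tm.Λ
  fin := tm.ΛFin
  entry := tm.main
  m := tm.m
  alt := fun _ => none

theorem initList_eq (tm : FinTM2) (x : List (tm.Γ tm.k₀)) :
    initList tm x = ⟨some tm.main, tm.initialState, update (fun _ => []) tm.k₀ x⟩ := by
  unfold initList
  congr 1
  funext k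
  by_cases h : k = tm.k₀
  · subst h; simp
  · simp [h]

theorem haltList_eq (tm : FinTM2) (x : List (tm.Γ tm.k₁)) :
    haltList tm x = ⟨none, tm.initialState, update (fun _ => []) tm.k₁ x⟩ := by
  unfold haltList
  congr 1
  funext k
  by_cases h : k = tm.k₁
  · subst h; simp
  · simp [h]

theorem run_ofTM (tm : FinTM2) (n : ℕ) (c d : TM2.Cfg tm.Γ tm.Λ tm.σ)
    (h : (flip bind tm.step)^[n] (some c) = some d) : (ofTM tm).Run c [] n d := by
  induction n generalizing c with
  | zero =>
    obtain rfl : c = d := Option.some.inj h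
    exact .refl _
  | succ n ih =>
    rw [iterate_succ_apply] at h
    have hnone : ∀ n, (flip bind tm.step)^[n] none = none := by
      intro n
      induction n with
      | zero => rfl
      | succ n ih => rw [iterate_succ_apply]; exact ih
    obtain ⟨_ | l, v, S⟩ := c
    · exact absurd ((hnone n).symm.trans h) (by simp)
    · exact .det rfl (ih _ h)

theorem reach_ofTM {tm : FinTM2} {x : List (tm.Γ tm.k₀)} {y : List (tm.Γ tm.k₁)} {m : ℕ}
    (h : TM2OutputsInTime tm x (some y) m) : ∃ n ≤ m, (ofTM tm).Reach tm.initialState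
      (update (fun _ => []) tm.k₀ x) [] n tm.initialState (update (fun _ => []) tm.k₁ y) := by
  obtain ⟨⟨n, hn⟩, hm⟩ := h
  refine ⟨n, hm, ?_⟩
  have := run_ofTM tm n _ _ hn
  rw [initList_eq, haltList_eq] at this
  exact this

/-- Run a given machine on an input prepared from the registers. -/
theorem Rz.ofTM {R ι : Type} [Fintype R] [DecidableEq R] (tm : FinTM2)
    (out : tm.Γ tm.k₁ ≃ Bool) (o : R) (load : Frag (RegΓ R tm.Γ) (tm.σ × Option Bool))
    (hdet : load.Det) (inp : ι → R → Str) (x : ι → List (tm.Γ tm.k₀)) (y : ι → Str)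
    (t t' : Polynomial ℕ)
    (hload : ∀ i, ∃ n ≤ t.eval (memSize (inp i)), load.Reach (tm.initialState, none) (full (inp i))
      [] n (tm.initialState, none) (mix (fun _ => []) (update (fun _ => []) tm.k₀ (x i))))
    (htm : ∀ i, Nonempty (TM2OutputsInTime tm (x i) (some ((y i).map out.symm))
      (t'.eval (memSize (inp i))))) :
    Rz fun s s' => ∃ i, s = inp i ∧ s' = update (fun _ => []) o (y i).reverse := by
  let := tm.kFin
  let := tm.σFin
  obtain ⟨G, hG, hrun⟩ := Frag.exists_lift (Γ := RegΓ R tm.Γ) (e := Sum.inr) Sum.inr_injective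
    (Equiv.refl (tm.σ × Option Bool)) (Γ' := tm.Γ) (fun _ => rfl) (Cluster.ofTM tm)
  obtain ⟨C, hC⟩ := (load.seq G).exists_growth
  refine ⟨⟨tm.K, tm.Γ, _, (tm.initialState, none), (load.seq G).seq (.moveMap (.inr tm.k₁) (.inl o)
    (fun v => v.2) (fun o v => (v.1, o)) out (fun o => o.getD false)),
    (hdet.seq (hG fun _ => rfl)).seq fun _ => rfl⟩,
    t + t' + (.X + .C C * (t + t')) + 1, ?_⟩
  rintro _ _ ⟨i, rfl, rfl⟩
  obtain ⟨n, hn, h1⟩ := hload i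
  obtain ⟨h2⟩ := htm i
  obtain ⟨n', hn', h2⟩ := reach_ofTM h2
  obtain ⟨T, h3, h4, h5⟩ := hrun h2 none (mix (fun _ => []) (update (fun _ => []) tm.k₀ (x i)))
    (fun k => HEq.rfl)
  -- The halting configuration in `TM2OutputsInTime` has the initial state, and all its stacks
  -- except the output stack are empty; nothing has to be cleaned up.
  obtain rfl : T = mix (fun _ => []) (update (fun _ => []) tm.k₁ ((y i).map out.symm)) := by
    funext k
    rcases k with k | k
    · exact h5 (.inl k) (by simp)
    · exact eq_of_heq (h4 k)
  have h6 := h1.seq h3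
  -- The time for moving the output is its length, which the growth bound controls.
  have h7 := hC h6
  rw [stkSize_full, stkSize_mix] at h7
  have h8 : (y i).length ≤ stkSize (update (fun _ => []) tm.k₁ ((y i).map out.symm)) := by
    refine le_trans (by simp) (Finset.single_le_sum (f := fun k =>
      (update (fun _ => []) tm.k₁ ((y i).map out.symm) k).length) (fun _ _ => Nat.zero_le _)
        (Finset.mem_univ tm.k₁))
  have h9 := reach_moveMap_inl out o tm.initialState (fun _ : R => [])
    (update (fun _ => []) tm.k₁ ((y i).map out.symm))
  refine ⟨_, ?_, by
    have h10 := h6.seq h9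
    rw [Machine.Computes, full_eq_mix (update (fun _ => []) o (y i).reverse)]
    simpa using h10⟩
  have h10 : C * (n + n') ≤ C * (t.eval (memSize (inp i)) + t'.eval (memSize (inp i))) :=
    Nat.mul_le_mul_left _ (by omega)
  simp; omega

/-- Loading the input stack and unloading the output stack both reverse, so the argument is reversed
in advance and the result afterwards. -/
theorem PT.of_mem_FPt {g : Str → Str} (hg : g ∈ FPt) : PT g := by
  obtain ⟨⟨⟨tm, inA, outA⟩, t, h⟩⟩ := hg
  have key := Rz.ofTM (R := Unit) tm outA () (.moveMap (.inl ()) (.inr tm.k₀) (fun v => v.2)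
      (fun o v => (v.1, o)) (fun b => b) (fun o => inA.symm (o.getD false))) (fun _ => rfl)
      (fun x : Str => fun _ => x.reverse) (fun x => x.map inA.symm) g (.X + 1) t
      (fun x => ⟨x.length + 1, by simp, by
        have := reach_moveMap_inr (R := Unit) (Γ := tm.Γ) (fun o => inA.symm (o.getD false)) ()
          tm.initialState (fun _ => x.reverse) (fun _ => [])
        refine ((this.cast (full_eq_mix _).symm ?_)).congr_steps (by simp)
        congr 1
        exact funext fun _ => by simp⟩)
      (fun x => ⟨by simpa using h x⟩)
  have h1 : Rz (R := Code.R Str ⊕ Code.R Str) fun s s' => ∃ x : Str,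
      s = Sum.elim (fun _ => x) (fun _ => []) ∧ s' = Sum.elim (fun _ => x)
        (fun _ => (g x).reverse) := by
    refine (((PT.reverse PT.id).at (R := Code.R Str ⊕ Code.R Str) .inl .inr
      (by rintro (_ | _) (_ | _) <;> simp)).seq (key.rename
        (ρ := (Sum.inr : Unit → Code.R Str ⊕ Code.R Str)) Sum.inr_injective)).mono ?_
    rintro _ _ ⟨x, rfl, rfl⟩
    refine ⟨Sum.elim (fun _ => x) (fun _ => x.reverse), ⟨x, fun _ => rfl, fun _ => rfl,
      fun _ => rfl, fun _ => rfl, ?_⟩, ⟨x, rfl, ?_⟩, ?_⟩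
    · rintro (r | r) hr
      exacts [rfl, absurd ⟨.inr r, rfl⟩ hr]
    · exact funext fun _ => by simp
    · rintro (r | r) hr
      exacts [rfl, absurd ⟨r, rfl⟩ hr]
  exact (PT.reverse (f := fun x => (g x).reverse) h1).congr fun x => by simp

/-- Three registers. -/
abbrev Three : Type := Unit ⊕ Unit ⊕ Unit

/-- Contents of three registers. -/
def three (x y z : Str) : Three → Str := Sum.elim (fun _ => x) (Sum.elim (fun _ => y) (fun _ => z))

@[simp] theorem memSize_three (x y z : Str) :
    memSize (three x y z) = x.length + (y.length + z.length) := by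
  simp [three, memSize_elim]

/-- The code of the triple is built on the input stack from its bottom: third string, separator,
second string, separator, first string. -/
theorem PT.of_mem_PolyPred₃ {P : Str → Str → Str → Bool} (hP : P ∈ PolyPred₃) :
    PT fun p : Str × Str × Str => P p.1 p.2.1 p.2.2 := by
  obtain ⟨⟨⟨tm, inA, outA⟩, t, h⟩⟩ := hP
  let mv (r : Three) : Frag (RegΓ Three tm.Γ) (tm.σ × Option Bool) :=
    .moveMap (.inl r) (.inr tm.k₀) (fun v => v.2)
      (fun o v => (v.1, o)) (fun b => b) (fun o => inA.symm o)
  let sep : Frag (RegΓ Three tm.Γ) (tm.σ × Option Bool) :=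
    .single (.push (.inr tm.k₀) (fun _ => inA.symm none) .halt)
  have hmv : ∀ (r : Three) (s s' : Three → Str) (l : Str) (T T' : List (tm.Γ tm.k₀)), s r = l.reverse →
      s' = update s r [] → T' = l.map (fun b => inA.symm (some b)) ++ T →
      (mv r).Reach (tm.initialState, none) (mix s (update (fun _ => []) tm.k₀ T)) []
        (l.length + 1) (tm.initialState, none) (mix s' (update (fun _ => []) tm.k₀ T')) := by
    rintro r s _ l T _ hs rfl rfl
    have := reach_moveMap_inr (Γ := tm.Γ) (e := tm.k₀) (fun o => inA.symm o) r tm.initialState s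
      (update (fun _ => []) tm.k₀ T)
    exact (this.cast rfl (by simp [hs])).congr_steps (by simp [hs])
  have hsep : ∀ (s : Three → Str) (T : List (tm.Γ tm.k₀)),
      sep.Reach (tm.initialState, none) (mix s (update (fun _ => []) tm.k₀ T)) []
        1 (tm.initialState, none) (mix s (update (fun _ => []) tm.k₀ (inA.symm none :: T))) := by
    intro s T
    refine .single ?_
    simp only [TM2.stepAux]
    congr 1
    refine (update_mix_inr _ _ _ _).trans ?_
    simp [mix]
  have key := Rz.ofTM (R := Three) (ι := Str × Str × Str) tm outA (.inl ())
    ((mv (.inr (.inr ()))).seq (sep.seq ((mv (.inr (.inl ()))).seq (sep.seq (mv (.inl ()))))))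
    (Frag.Det.seq (fun _ => rfl) <| Frag.Det.seq (fun _ => rfl) <| Frag.Det.seq (fun _ => rfl) <|
      Frag.Det.seq (fun _ => rfl) fun _ => rfl)
    (fun p => three p.1.reverse p.2.1.reverse p.2.2.reverse)
    (fun p => (encTriple p).map inA.symm) (fun p => [P p.1 p.2.1 p.2.2]) (.X + 5)
    -- The code is longer than the three strings together by the two separators.
    (t.comp (.X + 2)) (fun p => by
      obtain ⟨x, y, z⟩ := p
      refine ⟨_, ?_, ((hmv (.inr (.inr ())) (three x.reverse y.reverse z.reverse)
        (three x.reverse y.reverse []) z [] _ rfl ?_ rfl).seq ((hsep _ _).seq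
        ((hmv (.inr (.inl ())) _ (three x.reverse [] []) y _ _ rfl ?_ rfl).seq ((hsep _ _).seq
        (hmv (.inl ()) _ (fun _ => []) x _ _ rfl ?_ rfl))))).cast ?_ ?_⟩
      · simp; omega
      · funext r; rcases r with r | (r | r) <;> simp [three]
      · funext r; rcases r with r | (r | r) <;> simp [three]
      · funext r; rcases r with r | (r | r) <;> simp [three]
      · rw [full_eq_mix]; simp
      · congr 2
        simp [encTriple, Function.comp_def])
    (fun p => by
      refine ⟨?_⟩
      have h2 := h p
      have h3 : (t.comp (.X + 2)).eval (memSize (three p.1.reverse p.2.1.reverse p.2.2.reverse)) =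
          t.eval (encTriple p).length := by
        simp only [memSize_three, encTriple, Polynomial.eval_comp, Polynomial.eval_add,
          Polynomial.eval_X, List.length_append, List.length_cons, List.length_map,
          List.length_reverse, Polynomial.eval_ofNat]
        congr 1
      rw [h3]
      exact h2)
  refine ((((((PT.reverse PT.fst).pair ((PT.reverse (PT.fst.comp .snd)).pair
    (PT.reverse (PT.snd.comp .snd)))).at
    (R := (Code.R (Str × Str × Str) ⊕ Code.R Bool) ⊕ Three) (fun r => .inl (.inl r)) .inr
    (by rintro (_ | _) (_ | _) <;> simp)).seq (key.rename (ρ := Sum.inr) Sum.inr_injective)).seq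
    (.moveRev (r := .inr (.inl ())) (r' := .inl (.inr ())) (by simp))).hide).mono ?_
  rintro _ _ ⟨⟨x, y, z⟩, rfl, rfl⟩
  refine ⟨Sum.elim (Sum.elim (enc (x, y, z)) (fun _ => [])) (update (fun _ => []) (.inl ())
      [P x y z].reverse), ⟨Sum.elim (Sum.elim (enc (x, y, z)) (fun _ => []))
        (three x.reverse y.reverse z.reverse),
      ⟨(x, y, z), fun _ => rfl, fun _ => rfl, fun _ => rfl, ?_, ?_⟩, ⟨(x, y, z), rfl, rfl⟩, ?_⟩, ?_⟩
  · rintro (r | r | r) <;> rfl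
  · rintro ((r | r) | r) hr
    exacts [rfl, rfl, absurd ⟨.inr r, rfl⟩ hr]
  · rintro ((r | r) | r) hr
    exacts [rfl, rfl, absurd ⟨r, rfl⟩ hr]
  · funext r
    rcases r with (r | r) | (r | (r | r)) <;> rfl

/-! ### Turing machines from fragments -/

section

variable {K : Type} [Fintype K] [DecidableEq K] {Γ : K → Type} {σ : Type} [Fintype σ]

/-- A fragment as a Turing machine. -/
def Frag.toTM (F : Frag Γ σ) (v₀ : σ) (k₀ k₁ : K) [Fintype (Γ k₀)] : FinTM2 where
  K := K
  k₀ := k₀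
  k₁ := k₁
  Γ := Γ
  Λ := F.Λ
  main := F.entry
  ΛFin := F.fin
  σ := σ
  initialState := v₀
  m := F.m

theorem Frag.Run.iterate {F : Frag Γ σ} {c d : TM2.Cfg Γ F.Λ σ} {w : List Bool} {n : ℕ}
    (hF : F.Det) (h : F.Run c w n d) : (flip bind (TM2.step F.m))^[n] (some c) = some d := by
  induction h with
  | refl => rfl
  | det hl _ ih => rw [iterate_succ_apply]; exact ih
  | guess b hl => exact absurd ((hF _).symm.trans hl) (by simp)

theorem Frag.Reach.toTM {F : Frag Γ σ} {v₀ : σ} {k₀ k₁ : K} [Fintype (Γ k₀)]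
    {x x' : List (Γ k₀)} {y y' : List (Γ k₁)} {n m : ℕ} (hx : x' = x) (hy : y' = y)
    (hF : F.Det)
    (h : F.Reach v₀ (update (fun _ => []) k₀ x) [] n v₀ (update (fun _ => []) k₁ y)) (hn : n ≤ m) :
    Nonempty (TM2OutputsInTime (F.toTM v₀ k₀ k₁) x' (some y') m) := by
  subst hx hy
  have h1 := Run.iterate hF h
  exact ⟨⟨⟨n, (congrArg (fun c => (flip bind (TM2.step F.m))^[n] (some c))
    (initList_eq (F.toTM v₀ k₀ k₁) x')).trans
      (h1.trans (congrArg some (haltList_eq (F.toTM v₀ k₀ k₁) y')).symm)⟩, hn⟩⟩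

end

theorem full_eq_update {R E : Type} [Fintype R] [DecidableEq R] [DecidableEq E] {Γ : E → Type} {s : R → Str}
    (r : R) (l : Str) (h : s = update (fun _ => []) r l) :
    full (Γ := Γ) s = update (β := fun k => List (RegΓ R Γ k)) (fun _ => []) (.inl r) l := by
  subst h
  have h1 : full (R := R) (Γ := Γ) (fun _ => []) = fun _ => [] := by
    funext k
    rcases k with k | k <;> rfl
  exact (full_update _ _ _).symm.trans
    (congrArg (fun T => update (β := fun k => List (RegΓ R Γ k)) T (.inl r) l) h1)

/-- A program for `PT g` preserves its argument, whereas a Turing machine has to halt with the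
output alone; so the argument is erased. -/
theorem mem_FPt_of_PT {g : Str → Str} (hg : PT g) : g ∈ FPt := by
  have h1 : Rz (R := Unit ⊕ Unit) fun s s' => ∃ x, s = Sum.elim (fun _ => x) (fun _ => []) ∧
      s' = Sum.elim (fun _ => []) (fun _ => g x) := by
    refine (Rz.seq hg (.clear (.inl ()))).mono ?_
    rintro _ _ ⟨x, rfl, rfl⟩
    refine ⟨_, ⟨x, rfl, rfl⟩, ?_⟩
    funext r
    rcases r with r | r <;> rfl
  obtain ⟨M, t, h⟩ := h1
  let _ : Fintype (RegΓ (Unit ⊕ Unit) M.Γ (.inl (.inl ()))) := inferInstanceAs (Fintype Bool)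
  refine ⟨⟨⟨M.F.toTM M.v₀ (.inl (.inl ())) (.inl (.inr ())), Equiv.refl Bool, Equiv.refl Bool⟩, t,
    fun x => Classical.choice ?_⟩⟩
  obtain ⟨n, hn, h2⟩ := h _ _ ⟨x, rfl, rfl⟩
  refine Frag.Reach.toTM (List.map_id _) (List.map_id _) M.det (h2.cast (full_eq_update (Sum.inl ()) x
    (by funext r; rcases r with r | r <;> rfl)) (full_eq_update (Sum.inr ()) (g x)
    (by funext r; rcases r with r | r <;> rfl))) (hn.trans_eq ?_)
  simp only [memSize_elim, memSize_unit, memSize_nil, Nat.add_zero]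

/-- Pop the bits of the last stack up to a separator and push them on the register `r`. -/
def splitFrag {R E : Type} {Γ : E → Type} {σ : Type} (r : R) :
    Frag (RegΓ R (Sum.elim Γ fun _ : Unit => Option Bool)) (σ × Option (Option Bool)) where
  Λ := Unit
  entry := ()
  m := fun _ => .pop (.inr (.inr ())) (fun v o => (v.1, o))
    (.branch (fun v => (v.2.getD none).isSome)
      (.push (.inl r) (fun v => (v.2.getD none).getD false)
        (.load (fun v => (v.1, none)) (.goto fun _ => ())))
      (.load (fun v => (v.1, none)) .halt))
  alt := fun _ => none

/-- By the default value `none`, an exhausted stack is read like a separator, so one fragment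
extracts all three arguments. -/
theorem reach_splitFrag {R E : Type} [DecidableEq R] [DecidableEq E] {Γ : E → Type} {σ : Type}
    (r : R) (v : σ) (l : Str) (L : List (Option Bool)) (hL : L = [] ∨ ∃ L', L = none :: L')
    (s : R → Str) :
    (splitFrag (Γ := Γ) r).Reach (v, none) (mix s (Sum.rec (fun _ => []) fun _ => l.map some ++ L))
      [] (l.length + 1) (v, none)
      (mix (update s r (l.reverse ++ s r)) (Sum.rec (fun _ => []) fun _ => L.tail)) := by
  have hup : ∀ (s : R → Str) (L L' : List (Option Bool)),
      update (mix (Γ := Sum.elim Γ fun _ : Unit => Option Bool) s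
        (Sum.rec (fun _ => []) fun _ => L)) (.inr (.inr ())) L' =
      mix s (Sum.rec (fun _ => []) fun _ => L') := by
    intro s L L'
    refine (update_mix_inr _ _ _ _).trans ?_
    congr 1
    funext k
    rcases k with k | k
    · exact update_of_ne (β := fun k => List (Sum.elim Γ (fun _ : Unit => Option Bool) k))
        (by simp) _ _
    · exact update_self (β := fun k => List (Sum.elim Γ (fun _ : Unit => Option Bool) k)) _ _ _
  induction l generalizing s with
  | nil =>
    refine .step (c := ⟨none, (v, none), _⟩) rfl ?_ (.refl _)
    have h1 := hup s L L.tail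
    have h2 : (L.head?.getD none).isSome = false := by
      rcases hL with rfl | ⟨L', rfl⟩ <;> rfl
    simp only [splitFrag, TM2.stepAux, List.map_nil, List.nil_append, mix]
    erw [h2]
    simp only [cond_false, List.reverse_nil, List.nil_append, update_eq_self]
    congr 1
  | cons b l ih =>
    refine .step (c := ⟨some (), (v, none), mix (update s r (b :: s r))
      (Sum.rec (fun _ => []) fun _ => l.map some ++ L)⟩) rfl ?_ ?_
    · have h1 := hup s ((b :: l).map some ++ L) (l.map some ++ L)
      refine (congrArg (fun T => (⟨some (), (v, none), update T (.inl r) (b :: T (.inl r))⟩ :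
        TM2.Cfg (RegΓ R (Sum.elim Γ fun _ : Unit => Option Bool)) Unit
          (σ × Option (Option Bool)))) h1).trans ?_
      exact congrArg _ (update_mix_inl _ _ _ _)
    · exact (ih (update s r (b :: s r))).cast rfl (by simp)

/-- The input is first split into three registers. This reverses the arguments, so the program used
is that for `P` after three reversals. -/
theorem mem_PolyPred₃_of_PT {P : Str → Str → Str → Bool}
    (hP : PT fun p : Str × Str × Str => P p.1 p.2.1 p.2.2) : P ∈ PolyPred₃ := by
  have hP' := hP.comp (((PT.reverse PT.fst).pair ((PT.reverse (PT.fst.comp .snd)).pair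
    (PT.reverse (PT.snd.comp .snd)))) : PT fun p : Str × Str × Str => _)
  have h1 : Rz (R := Three ⊕ Unit) fun s s' => ∃ x y z,
      s = Sum.elim (three x y z) (fun _ => []) ∧
      s' = Sum.elim (fun _ => []) (fun _ => [P x.reverse y.reverse z.reverse]) := by
    refine (Rz.seq hP' (.clearAt Sum.inl)).mono ?_
    rintro _ _ ⟨x, y, z, rfl, rfl⟩
    refine ⟨_, ⟨(x, y, z), rfl, rfl⟩, fun _ => rfl, ?_⟩
    rintro (r | r) hr
    exacts [absurd ⟨r, rfl⟩ hr, rfl]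
  obtain ⟨M, t, h⟩ := h1
  obtain ⟨G, hG, hrun⟩ := M.embed (E := M.E ⊕ Unit) (Γ := Sum.elim M.Γ fun _ => Option Bool)
    (e := Sum.map id Sum.inl) (Sum.map_injective.2 ⟨injective_id, Sum.inl_injective⟩)
    (by rintro (k | k) <;> rfl) (Equiv.refl (M.σ × Option (Option Bool)))
  let _ : Fintype (RegΓ (Three ⊕ Unit) (Sum.elim M.Γ fun _ : Unit => Option Bool)
    (.inr (.inr ()))) := inferInstanceAs (Fintype (Option Bool))
  let F := ((splitFrag (Γ := M.Γ) (σ := M.σ) (R := Three ⊕ Unit) (.inl (.inl ()))).seq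
    ((splitFrag (.inl (.inr (.inl ())))).seq ((splitFrag (.inl (.inr (.inr ())))).seq G)))
  have hF : F.Det := Frag.Det.seq (fun _ => rfl) <| Frag.Det.seq (fun _ => rfl) <|
    Frag.Det.seq (fun _ => rfl) hG
  refine ⟨⟨⟨F.toTM (M.v₀, none) (.inr (.inr ())) (.inl (.inr ())), Equiv.refl (Option Bool),
    Equiv.refl Bool⟩, .X + 3 + t, fun p => Classical.choice ?_⟩⟩
  obtain ⟨x, y, z⟩ := p
  obtain ⟨n, hn, h2⟩ := h _ _ ⟨x.reverse, y.reverse, z.reverse, rfl, rfl⟩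
  have h3 := hrun h2 _ _ (sumMap_inl_heq _) (sumMap_inl_heq _) (by
    rintro (k | (k | k)) hk
    exacts [absurd ⟨.inl k, rfl⟩ hk, absurd ⟨.inr k, rfl⟩ hk, rfl]) none
  have e1 := reach_splitFrag (Γ := M.Γ) (R := Three ⊕ Unit) (.inl (.inl ())) M.v₀ x
    (none :: (y.map some ++ none :: z.map some)) (.inr ⟨_, rfl⟩) (fun _ => [])
  have e2 := reach_splitFrag (Γ := M.Γ) (R := Three ⊕ Unit) (.inl (.inr (.inl ()))) M.v₀ y
    (none :: z.map some) (.inr ⟨_, rfl⟩) (update (fun _ => []) (.inl (.inl ())) (x.reverse ++ []))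
  have e3 := reach_splitFrag (Γ := M.Γ) (R := Three ⊕ Unit) (.inl (.inr (.inr ()))) M.v₀ z
    [] (.inl rfl) (update (update (fun _ => []) (.inl (.inl ())) (x.reverse ++ []))
      (.inl (.inr (.inl ()))) (y.reverse ++ []))
  have e4 := e1.seq ((e2.cast rfl ?_).seq ((e3.cast rfl ?_).seq h3))
  · have hm : n ≤ t.eval (encTriple (x, y, z)).length := hn.trans (eval_mono t (by
      simp [memSize_elim, encTriple, memSize_three, memSize_nil]; omega))
    refine Frag.Reach.toTM (List.map_id _) (y := [P x y z]) ?_ hF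
      (e4.cast ?_ (full_eq_update _ _ ?_)) ?_
    · exact List.map_id _
    · funext k
      rcases k with k | (k | k) <;> rfl
    · funext r
      rcases r with r | r <;> simp
    · simp [encTriple] at hm ⊢
      omega
  · funext k
    rcases k with ((k | (k | k)) | k) | (k | k) <;>
      first | rfl | exact (List.append_nil _).symm
  · funext k
    rcases k with ((k | (k | k)) | k) | (k | k) <;>
      first | rfl | exact List.append_nil _

/-! ### Checking a given computation path -/

/-- Empty the listed further stacks. -/
def clearStacks {R E : Type} [DecidableEq R] [DecidableEq E] {Γ : E → Type} {σ : Type} :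
    List E → Frag (RegΓ R Γ) (σ × Option Bool)
  | [] => .single .halt
  | e :: l => (Frag.clear (.inr e) (fun b v => (v.1, bif b then some true else none))
      fun v => v.2.isSome).seq (clearStacks l)

theorem det_clearStacks {R E : Type} [DecidableEq R] [DecidableEq E] {Γ : E → Type} {σ : Type} (l : List E) :
    (clearStacks (R := R) (Γ := Γ) (σ := σ) l).Det := by
  induction l with
  | nil => exact .single _
  | cons e l ih => exact Frag.Det.seq (fun _ => rfl) ih

theorem reach_clear_inr {R E : Type} [DecidableEq R] [DecidableEq E] {Γ : E → Type} {σ : Type}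
    (e : E) (v : σ) (s : R → Str) (S : ∀ k, List (Γ k)) :
    (Frag.clear (Γ := RegΓ R Γ) (σ := σ × Option Bool) (.inr e)
      (fun b v => (v.1, bif b then some true else none)) fun v => v.2.isSome).Reach (v, none)
      (mix s S) [] ((S e).length + 1) (v, none) (mix s (update S e [])) :=
  (Frag.Reach.clear (Γ := RegΓ R Γ) (k := .inr e) (σ := σ × Option Bool)
    (get := fun v => v.2.isSome) (set := fun b v => (v.1, bif b then some true else none))
    (by intro o v; cases o <;> rfl) (fun _ _ => rfl) (v := (v, none)) rfl (S e) (mix s S) rfl).cast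
    rfl (update_mix_inr s S e [])

theorem reach_clear_inl {R E : Type} [DecidableEq R] [DecidableEq E] {Γ : E → Type} {σ : Type}
    (r : R) (v : σ) (s : R → Str) (S : ∀ k, List (Γ k)) :
    (Frag.clear (Γ := RegΓ R Γ) (σ := σ × Option Bool) (.inl r)
      (fun b v => (v.1, bif b then some true else none)) fun v => v.2.isSome).Reach (v, none)
      (mix s S) [] ((s r).length + 1) (v, none) (mix (update s r []) S) :=
  (Frag.Reach.clear (Γ := RegΓ R Γ) (k := .inl r) (σ := σ × Option Bool)
    (get := fun v => v.2.isSome) (set := fun b v => (v.1, bif b then some true else none))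
    (by intro o v; cases o <;> rfl) (fun _ _ => rfl) (v := (v, none)) rfl (s r) (mix s S) rfl).cast
    rfl (update_mix_inl s S r [])

theorem reach_clearStacks {R E : Type} [DecidableEq R] [Fintype E] [DecidableEq E] {Γ : E → Type}
    {σ : Type} (l : List E) (v : σ) (s : R → Str) (S : ∀ k, List (Γ k)) :
    ∃ n ≤ l.length * (stkSize S + 1) + 1, (clearStacks l).Reach (v, none) (mix s S) [] n (v, none)
      (mix s fun k => if k ∈ l then [] else S k) := by
  induction l generalizing S with
  | nil =>
    refine ⟨1, by simp, .single ?_⟩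
    simp [TM2.stepAux]
  | cons e l ih =>
    obtain ⟨n, hn, h⟩ := ih (update S e [])
    have h1 := stkSize_update_le S e [] 0 (by simp)
    have h2 : (S e).length ≤ stkSize S := Finset.single_le_sum (f := fun k => (S k).length)
      (fun _ _ => Nat.zero_le _) (Finset.mem_univ e)
    refine ⟨_, ?_, ((reach_clear_inr e v s S).seq h).cast rfl ?_⟩
    · have : l.length * (stkSize (update S e []) + 1) ≤ l.length * (stkSize S + 1) :=
        Nat.mul_le_mul_left _ (by omega)
      simp only [List.length_cons, Nat.add_mul, Nat.one_mul]
      omega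
    · congr 1
      funext k
      by_cases hk : k = e
      · subst hk; simp
      · simp [hk]

section

variable (M : NTM) (A : Set M.tm.σ)

/-- The registers and stacks of a simulation of `M`. -/
abbrev SimΓ : Three ⊕ M.tm.K → Type := RegΓ Three M.tm.Γ

/-- A statement of `M` in a simulation of `M`. -/
def simStmt (s : M.tm.Stmt) : TM2.Stmt (SimΓ M) (Option M.tm.Λ) (M.tm.σ × Option Bool) :=
  relabel some (some none) (Frag.liftStmt (Γ := SimΓ M) Sum.inr
    (Equiv.refl (M.tm.σ × Option Bool)) s)

open Classical in
/-- Simulate `M`, taking the guessed bits from the second register. The result of the computation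
is pushed on the third register. -/
noncomputable def sim : Frag (SimΓ M) (M.tm.σ × Option Bool) where
  Λ := Option M.tm.Λ
  fin := letI := M.tm.ΛFin; inferInstance
  entry := some M.tm.main
  m
    | some l => (M.alt l).elim (simStmt M (M.tm.m l)) fun s =>
        .pop (.inl (.inr (.inl ()))) (fun v o => (v.1, o))
          (.branch (fun v => v.2.isNone) (.push (.inl (.inr (.inr ()))) (fun _ => false) .halt)
            (.branch (fun v => v.2.getD false) (.load (fun v => (v.1, none)) (simStmt M s))
              (.load (fun v => (v.1, none)) (simStmt M (M.tm.m l)))))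
    -- This label stands for the simulated machine having halted. A positive verdict needs all
    -- supplied bits to be used up, in the same way as running out of bits at a guess gives a
    -- negative one.
    | none => .pop (.inl (.inr (.inl ()))) (fun v o => (v.1, o))
        (.push (.inl (.inr (.inr ()))) (fun v => v.2.isNone && decide (v.1 ∈ A)) .halt)
  alt := fun _ => none

variable {M A}

theorem stepAux_simStmt (s : M.tm.Stmt) (v : M.tm.σ) (r : Three → Str)
    (S : ∀ k, List (M.tm.Γ k)) {c : M.tm.Cfg} (hc : TM2.stepAux s v S = c) :
    TM2.stepAux (simStmt M s) (v, none) (mix r S) =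
      ⟨some c.l, (c.var, none), mix r c.stk⟩ := by
  subst hc
  have h := Frag.Extends.stepAux (Γ := SimΓ M) Sum.inr_injective
    (φ := Equiv.refl (M.tm.σ × Option Bool)) (t := none) (S₀ := mix r S) s v S (mix r S)
    (fun _ => rfl) (fun _ _ => rfl)
  refine (stepAux_relabel _ _ _ _ _).trans ?_
  obtain ⟨h1, h2, h3, h4⟩ := h
  unfold relabelCfg
  congr 1
  · have h : ∀ o : Option M.tm.Λ, (o.elim (some none) fun l => some (some l)) = some o := by
      rintro (_ | _) <;> rfl
    exact (congrArg (fun o => Option.elim o (some none) fun l => some (some l)) h1).trans (h _)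
  · funext k
    rcases k with k | k
    · exact h4 (.inl k) (by simp)
    · exact h3 k

/-- The result of the computation from `c` along `w`. -/
def Accepts (A : Set M.tm.σ) (c : M.tm.Cfg) (w : Str) : Prop :=
  ∃ (n : ℕ) (d : M.tm.Cfg), M.Run c w n d ∧ d.l = none ∧ d.var ∈ A

theorem accepts_halt {v : M.tm.σ} {S : ∀ k, List (M.tm.Γ k)} {w : Str} :
    Accepts A ⟨none, v, S⟩ w ↔ w = [] ∧ v ∈ A := by
  constructor
  · rintro ⟨n, d, h, -, hA⟩
    cases h
    exact ⟨rfl, hA⟩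
  · rintro ⟨rfl, hA⟩
    exact ⟨0, _, .refl _, rfl, hA⟩

theorem accepts_det {l : M.tm.Λ} {v : M.tm.σ} {S : ∀ k, List (M.tm.Γ k)} {w : Str}
    (hl : M.alt l = none) :
    Accepts A ⟨some l, v, S⟩ w ↔ Accepts A (TM2.stepAux (M.tm.m l) v S) w := by
  constructor
  · rintro ⟨n, d, h, hd, hA⟩
    cases h with
    | refl => simp at hd
    | det _ h => exact ⟨_, d, h, hd, hA⟩
    | guess b hl' h => simp [hl] at hl'
  · rintro ⟨n, d, h, hd, hA⟩
    exact ⟨_, d, .det hl h, hd, hA⟩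

theorem accepts_guess {l : M.tm.Λ} {v : M.tm.σ} {S : ∀ k, List (M.tm.Γ k)} {b : Bool} {w : Str}
    {s : M.tm.Stmt} (hl : M.alt l = some s) : Accepts A ⟨some l, v, S⟩ (b :: w) ↔
      Accepts A (TM2.stepAux (cond b s (M.tm.m l)) v S) w := by
  constructor
  · rintro ⟨n, d, h, hd, hA⟩
    cases h with
    | det hl' h => simp [hl] at hl'
    | guess b hl' h =>
      obtain rfl := Option.some.inj (hl.symm.trans hl')
      exact ⟨_, d, h, hd, hA⟩
  · rintro ⟨n, d, h, hd, hA⟩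
    exact ⟨_, d, .guess b hl h, hd, hA⟩

theorem not_accepts_nil {l : M.tm.Λ} {v : M.tm.σ} {S : ∀ k, List (M.tm.Γ k)}
    {s : M.tm.Stmt} (hl : M.alt l = some s) : ¬ Accepts A ⟨some l, v, S⟩ [] := by
  rintro ⟨n, d, h, hd, hA⟩
  cases h with
  | refl => simp at hd
  | det hl' h => simp [hl] at hl'

theorem update_mix_second (w w' o : Str) (S : ∀ k, List (M.tm.Γ k)) :
    update (mix (three [] w o) S) (.inl (.inr (.inl ()))) w' = mix (three [] w' o) S := by
  refine (update_mix_inl _ _ _ _).trans (congrArg (fun s => mix s S) ?_)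
  funext r
  rcases r with r | (r | r) <;> rfl

theorem update_mix_third (w o o' : Str) (S : ∀ k, List (M.tm.Γ k)) :
    update (mix (three [] w o) S) (.inl (.inr (.inr ()))) o' = mix (three [] w o') S := by
  refine (update_mix_inl _ _ _ _).trans (congrArg (fun s => mix s S) ?_)
  funext r
  rcases r with r | (r | r) <;> rfl

open Classical in
theorem stepAux_sim_none (v : M.tm.σ) (w : Str) (S : ∀ k, List (M.tm.Γ k)) :
    TM2.stepAux ((sim M A).m none) (v, none) (mix (three [] w []) S) =
      ⟨none, (v, w.head?), mix (three [] w.tail [decide (w = [] ∧ v ∈ A)]) S⟩ := by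
  have h : (w.head?.isNone && decide (v ∈ A)) = decide (w = [] ∧ v ∈ A) := by cases w <;> simp
  have h1 := update_mix_second w w.tail [] S
  refine (congrArg (fun T => (⟨none, (v, w.head?), update T (.inl (.inr (.inr ())))
    ((w.head?.isNone && decide (v ∈ A)) :: T (.inl (.inr (.inr ()))))⟩ :
      TM2.Cfg (SimΓ M) (Option M.tm.Λ) (M.tm.σ × Option Bool))) h1).trans ?_
  rw [h]
  exact congrArg _ (update_mix_third _ _ _ _)

theorem stepAux_sim_nil {l : M.tm.Λ} {s : M.tm.Stmt} (hl : M.alt l = some s) (v : M.tm.σ)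
    (S : ∀ k, List (M.tm.Γ k)) :
    TM2.stepAux ((sim M A).m (some l)) (v, none) (mix (three [] [] []) S) =
      ⟨none, (v, none), mix (three [] [] [false]) S⟩ := by
  have h1 := update_mix_second [] [] [] S
  simp only [sim, hl, Option.elim_some]
  refine (congrArg (fun T => (⟨none, (v, none), update T (.inl (.inr (.inr ())))
    (false :: T (.inl (.inr (.inr ()))))⟩ :
      TM2.Cfg (SimΓ M) (Option M.tm.Λ) (M.tm.σ × Option Bool))) h1).trans ?_
  exact congrArg _ (update_mix_third _ _ _ _)

theorem stepAux_sim_cons {l : M.tm.Λ} {s : M.tm.Stmt} (hl : M.alt l = some s) (v : M.tm.σ)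
    (b : Bool) (w : Str) (S : ∀ k, List (M.tm.Γ k)) :
    TM2.stepAux ((sim M A).m (some l)) (v, none) (mix (three [] (b :: w) []) S) =
      TM2.stepAux (simStmt M (cond b s (M.tm.m l))) (v, none) (mix (three [] w []) S) := by
  have h1 := update_mix_second (b :: w) w [] S
  simp only [sim, hl, Option.elim_some]
  cases b
  · exact congrArg (TM2.stepAux (simStmt M (M.tm.m l)) (v, none)) h1
  · exact congrArg (TM2.stepAux (simStmt M s) (v, none)) h1

-- Induction on a bound for all computations from `c`. Every branch halts within it, so the
-- simulation reaches a verdict for each string `w`, including those that name no path; the verdict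
-- costs one more step.
open Classical in
theorem run_sim (N : ℕ) (c : M.tm.Cfg) (hN : ∀ w n d, M.Run c w n d → n ≤ N) (w : Str) :
    ∃ n ≤ N + 1, ∃ v w' S, (sim M A).Run ⟨some c.l, (c.var, none), mix (three [] w []) c.stk⟩ [] n
      ⟨none, v, mix (three [] w' [decide (Accepts A c w)]) S⟩ := by
  induction N generalizing c w with
  | zero =>
    obtain ⟨_ | l, v, S⟩ := c
    · refine ⟨1, le_rfl, (v, w.head?), w.tail, S, .step rfl ?_ (.refl _)⟩
      simp only [accepts_halt]
      exact stepAux_sim_none v w S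
    · cases hl : M.alt l with
      | none => exact absurd (hN _ _ _ (.det hl (.refl _))) (by simp)
      | some s => exact absurd (hN _ _ _ (.guess true hl (.refl _))) (by simp)
  | succ N ih =>
    obtain ⟨_ | l, v, S⟩ := c
    · refine ⟨1, by omega, (v, w.head?), w.tail, S, .step rfl ?_ (.refl _)⟩
      simp only [accepts_halt]
      exact stepAux_sim_none v w S
    · cases hl : M.alt l with
      | none =>
        obtain ⟨n, hn, v', w', S', h⟩ := ih _ (fun w n d h => by
          have := hN _ _ _ (.det hl h); omega) w
        refine ⟨n + 1, by omega, v', w', S', ?_⟩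
        simp only [accepts_det hl]
        refine .step rfl ?_ h
        have : (sim M A).m (some l) = simStmt M (M.tm.m l) := by simp [sim, hl]
        rw [this]
        exact stepAux_simStmt _ _ _ _ rfl
      | some s =>
        cases w with
        | nil =>
          refine ⟨1, by omega, (v, none), [], S, .step rfl ?_ (.refl _)⟩
          simp only [not_accepts_nil hl, decide_false]
          exact stepAux_sim_nil hl v S
        | cons b w =>
          obtain ⟨n, hn, v', w', S', h⟩ := ih _ (fun w n d h => by
            have := hN _ _ _ (.guess b hl h); omega) w
          refine ⟨n + 1, by omega, v', w', S', ?_⟩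
          simp only [accepts_guess hl]
          refine .step rfl ?_ h
          exact (stepAux_sim_cons hl v b w S).trans (stepAux_simStmt _ _ _ _ rfl)

-- A halting nondeterministic machine may leave arbitrary contents on its stacks and arbitrary
-- guesses unread. The growth bound limits their size, so they can be erased in polynomial time.
open Classical in
theorem PT.accepts {M : NTM} (hM : M.PolyTime) (A : Set M.tm.σ) :
    PT fun p : Str × Str => decide (Accepts A (M.init p.1) p.2) := by
  let := M.tm.kFin
  let := M.tm.σFin
  obtain ⟨t, ht⟩ := hM
  let F : Frag (SimΓ M) (M.tm.σ × Option Bool) :=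
    (Frag.moveMap (k := Sum.inl (Sum.inl ())) (k' := Sum.inr M.tm.k₀) (fun v => v.2)
      (fun o v => (v.1, o)) (fun b : Bool => b) (fun o => M.inputAlphabet.symm (o.getD false))).seq
    ((sim M A).seq (.single (.load (fun _ => (M.tm.initialState, none)) .halt)))
  obtain ⟨C, hC⟩ := F.exists_growth
  have key : Rz (R := Three) fun s s' => ∃ x w, s = three x.reverse w [] ∧
      s' = three [] [] [decide (Accepts A (M.init x) w)] := by
    refine ⟨⟨M.tm.K, M.tm.Γ, M.tm.σ × Option Bool, (M.tm.initialState, none),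
      (F.seq (.clear (.inl (.inr (.inl ()))) (fun b v => (v.1, bif b then some true else none))
        fun v => v.2.isSome)).seq (clearStacks Finset.univ.toList),
      Frag.Det.seq (Frag.Det.seq (Frag.Det.seq (fun _ => rfl) (Frag.Det.seq (fun _ => rfl)
        (fun _ => rfl))) (fun _ => rfl)) (det_clearStacks _)⟩,
      (.X + t + 3) + (.X + .C C * (.X + t + 3) + 1) +
        (.C (Finset.univ (α := M.tm.K)).toList.length * (.X + .C C * (.X + t + 3) + 1) + 1), ?_⟩
    rintro _ _ ⟨x, w, rfl, rfl⟩
    have h1 := reach_moveMap_inr (R := Three) (Γ := M.tm.Γ)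
      (fun o => M.inputAlphabet.symm (o.getD false)) (.inl ())
      M.tm.initialState (three x.reverse w []) (fun _ => [])
    obtain ⟨n, hn, v, w', S, h2⟩ := run_sim (A := A) _ (M.init x) (ht x) w
    have h2' : (sim M A).Reach (M.tm.initialState, none) (mix (three [] w []) (M.init x).stk) [] n v
      (mix (three [] w' [decide (Accepts A (M.init x) w)]) S) := h2
    have h3 : Frag.Reach (.single (.load (fun _ => (M.tm.initialState, none)) .halt)) v
      (mix (three [] w' [decide (Accepts A (M.init x) w)]) S) [] 1 (M.tm.initialState, none)
      (mix (three [] w' [decide (Accepts A (M.init x) w)]) S) := .single rfl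
    have h4 : F.Reach _ _ _ _ _ _ := (h1.cast (full_eq_mix _).symm ?_).seq (h2'.seq h3)
    · have h5 := hC h4
      have h6 := reach_clear_inl (.inr (.inl ())) M.tm.initialState
        (three [] w' [decide (Accepts A (M.init x) w)]) S
      obtain ⟨n', hn', h7⟩ := reach_clearStacks Finset.univ.toList M.tm.initialState
        (update (three [] w' [decide (Accepts A (M.init x) w)]) (.inr (.inl ())) []) S
      refine ⟨_, ?_, ((h4.seq h6).seq h7).cast rfl ?_⟩
      · rw [stkSize_full, stkSize_mix] at h5
        have h8 : three [] w' [decide (Accepts A (M.init x) w)] (.inr (.inl ())) = w' := rfl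
        have h9 : three x.reverse w [] (.inl ()) = x.reverse := rfl
        have h10 : t.eval x.length ≤ t.eval (x.length + w.length) := eval_mono t (by omega)
        rw [h9] at h5
        simp only [h8, h9, memSize_three, List.length_reverse, List.length_nil, Nat.zero_add,
          Nat.add_zero, Polynomial.eval_add, Polynomial.eval_mul, Polynomial.eval_X,
          Polynomial.eval_C, Polynomial.eval_one, Polynomial.eval_ofNat] at h5 ⊢
        have h11 : C * (x.length + 1 + (n + 1)) ≤
          C * (x.length + w.length + t.eval (x.length + w.length) + 3) :=
          Nat.mul_le_mul_left _ (by omega)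
        have h12 : (Finset.univ (α := M.tm.K)).toList.length * (stkSize S + 1) ≤
          (Finset.univ (α := M.tm.K)).toList.length * (x.length + w.length +
            C * (x.length + w.length + t.eval (x.length + w.length) + 3) + 1) :=
          Nat.mul_le_mul_left _ (by omega)
        omega
      · funext k
        rcases k with (k | (k | k)) | k
        · rfl
        · rfl
        · rfl
        · exact if_pos (by simp)
    · refine congrArg₂ mix ?_ ?_
      · funext r
        rcases r with r | (r | r) <;> rfl
      · refine Eq.trans ?_ (congrArg TM2.Cfg.stk (initList_eq M.tm _)).symm
        refine congrArg (update (fun _ => []) M.tm.k₀) ?_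
        simp [three]
  refine ((((((PT.reverse PT.fst).pair PT.snd).at
    (R := (Code.R (Str × Str) ⊕ Code.R Bool) ⊕ Three) (fun r => .inl (.inl r))
      (Sum.elim (fun _ => .inr (.inl ())) (fun _ => .inr (.inr (.inl ()))) :
        Code.R Str ⊕ Code.R Str → (Code.R (Str × Str) ⊕ Code.R Bool) ⊕ Three)
    (by
      rintro ((_ | _) | (_ | _)) ((_ | _) | (_ | _)) h
      all_goals first | rfl | simp at h)).seq
      (key.rename (ρ := Sum.inr) Sum.inr_injective)).seq
    (.moveRev (r := .inr (.inr (.inr ()))) (r' := .inl (.inr ())) (by simp))).hide).mono ?_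
  rintro _ _ ⟨⟨x, w⟩, rfl, rfl⟩
  refine ⟨Sum.elim (Sum.elim (enc (x, w)) (fun _ => []))
      (three [] [] [decide (Accepts A (M.init x) w)]), ⟨Sum.elim (Sum.elim (enc (x, w))
        (fun _ => [])) (three x.reverse w []),
      ⟨(x, w), fun _ => rfl, ?_, fun _ => rfl, ?_, ?_⟩, ⟨x, w, rfl, rfl⟩, ?_⟩, ?_⟩
  · rintro (r | r) <;> rfl
  · rintro (r | r) <;> rfl
  · rintro ((r | r) | (r | (r | r))) hr
    exacts [rfl, rfl, absurd ⟨.inr (.inl ()), rfl⟩ hr, absurd ⟨.inr (.inr ()), rfl⟩ hr, rfl]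
  · rintro ((r | r) | r) hr
    exacts [rfl, rfl, absurd ⟨r, rfl⟩ hr]
  · funext r
    rcases r with (r | r) | (r | (r | r)) <;> rfl

end

/-! ### Guessing strings -/

section

variable {K : Type} [Fintype K] [DecidableEq K] {Γ : K → Type} {σ : Type} [Fintype σ]

/-- A fragment as a nondeterministic machine. -/
def Frag.toNTM (F : Frag Γ σ) (v₀ : σ) (k₀ : K) [Fintype (Γ k₀)] (e : Γ k₀ ≃ Bool)
    (A : Set σ) : NTM where
  tm := F.toTM v₀ k₀ k₀
  inputAlphabet := e
  alt := F.alt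
  accept := A

theorem Frag.Run.toNTM {F : Frag Γ σ} {v₀ : σ} {k₀ : K} [Fintype (Γ k₀)] {e : Γ k₀ ≃ Bool}
    {A : Set σ} {c d : TM2.Cfg Γ F.Λ σ} {w : Str} {n : ℕ} (h : F.Run c w n d) :
    NTM.Run (F.toNTM v₀ k₀ e A) c w n d := by
  induction h with
  | refl c => exact NTM.Run.refl (M := F.toNTM v₀ k₀ e A) c
  | det hl _ ih => exact NTM.Run.det (M := F.toNTM v₀ k₀ e A) hl ih
  | guess b hl _ ih => exact NTM.Run.guess (M := F.toNTM v₀ k₀ e A) b hl ih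

theorem Frag.Run.of_toNTM {F : Frag Γ σ} {v₀ : σ} {k₀ : K} [Fintype (Γ k₀)] {e : Γ k₀ ≃ Bool}
    {A : Set σ} {c d : (F.toNTM v₀ k₀ e A).tm.Cfg} {w : Str} {n : ℕ}
    (h : NTM.Run (F.toNTM v₀ k₀ e A) c w n d) : F.Run c w n d := by
  induction h with
  | refl c => exact Frag.Run.refl (F := F) c
  | det hl _ ih => exact Frag.Run.det (F := F) hl ih
  | guess b hl _ ih => exact Frag.Run.guess (F := F) b hl ih

/-- One halting computation for each guess string of the right length determines the entire
computation tree: by `Run.compat`, every computation is an initial part of one of these. -/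
theorem Frag.toNTM_spec (F : Frag Γ σ) (v₀ : σ) (k₀ : K) [Fintype (Γ k₀)] (e : Γ k₀ ≃ Bool)
    (A : Set σ) (L : Str → ℕ) (B : Str × Str → Bool) (t : Polynomial ℕ)
    (h : ∀ x w, w.length = L x → ∃ n ≤ t.eval x.length, ∃ v S,
      F.Reach v₀ (update (fun _ => []) k₀ (x.map e.symm)) w n v S ∧ (v ∈ A ↔ B (x, w) = true)) :
    (F.toNTM v₀ k₀ e A).PolyTime ∧ (∀ x, (F.toNTM v₀ k₀ e A).paths x = words (L x)) ∧
      ∀ x, (F.toNTM v₀ k₀ e A).acc x = {w | w.length = L x ∧ B (x, w) = true} := by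
  have hinit : ∀ x, (F.toNTM v₀ k₀ e A).init x =
      (⟨some F.entry, v₀, update (fun _ => []) k₀ (x.map e.symm)⟩ : TM2.Cfg Γ F.Λ σ) :=
    fun x => initList_eq (F.toTM v₀ k₀ k₀) (x.map e.symm)
  have key : ∀ x w n d, (F.toNTM v₀ k₀ e A).Run ((F.toNTM v₀ k₀ e A).init x) w n d →
      n ≤ t.eval x.length ∧ (d.l = none → w.length = L x ∧ (d.var ∈ A ↔ B (x, w) = true)) := by
    intro x w n d hd
    have hd := Frag.Run.of_toNTM ((congrArg (fun c => NTM.Run _ c w n d) (hinit x)).mp hd)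
    -- The guesses made so far are filled up with zeros, or cut, to length `L x`; either way they
    -- are compatible with the result.
    obtain ⟨n', hn', v, S, h1, h2⟩ := h x ((w ++ List.replicate (L x) false).take (L x)) (by simp)
    obtain ⟨h3, h4, h5⟩ := hd.compat h1 rfl (by
      have := List.take_prefix (L x) (w ++ List.replicate (L x) false)
      exact List.prefix_or_prefix_of_prefix (List.prefix_append _ _) this)
    refine ⟨h3.trans hn', fun hl => ?_⟩
    obtain ⟨h6, rfl⟩ := h5 hl
    rw [← h6] at h2
    exact ⟨by rw [h6]; simp, h2⟩
  have run : ∀ x w, w.length = L x → ∃ n d, (F.toNTM v₀ k₀ e A).Run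
      ((F.toNTM v₀ k₀ e A).init x) w n d ∧ d.l = none := by
    intro x w hw
    obtain ⟨n, -, v, S, h1, h2⟩ := h x w hw
    exact ⟨n, (⟨none, v, S⟩ : TM2.Cfg Γ F.Λ σ),
      (congrArg (fun c => NTM.Run _ c w n _) (hinit x)).mpr (Frag.Run.toNTM h1), rfl⟩
  refine ⟨⟨t, fun x w n d hd => (key x w n d hd).1⟩, fun x => ?_, fun x => ?_⟩
  · ext w
    exact ⟨fun ⟨n, d, h1, h2⟩ => ((key x w n d h1).2 h2).1, run x w⟩
  · ext w
    constructor
    · rintro ⟨n, d, h1, h2, h3⟩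
      obtain ⟨h4, h5⟩ := (key x w n d h1).2 h2
      exact ⟨h4, h5.1 h3⟩
    · rintro ⟨h1, h2⟩
      obtain ⟨n, d, h3, h4⟩ := run x w h1
      exact ⟨n, d, h3, h4, ((key x w n d h3).2 h4).2.2 h2⟩

end

/-- For every symbol on the register `r`, guess a bit and push it on the register `r'`. -/
def guessLoop {R E : Type} (Γ : E → Type) (σ : Type) (r r' : R) :
    Frag (RegΓ R Γ) (σ × Option Bool) where
  Λ := Bool
  entry := false
  m l := bif l then .push (.inl r') (fun _ => false) (.goto fun _ => false) else
    .pop (.inl r) (fun v o => (v.1, o)) (.branch (fun v => v.2.isNone) .halt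
      (.load (fun v => (v.1, none)) (.goto fun _ => true)))
  alt l := bif l then some (.push (.inl r') (fun _ => true) (.goto fun _ => false)) else none

theorem reach_guessLoop {R E : Type} [Fintype R] [DecidableEq R] [DecidableEq E] (Γ : E → Type)
    {σ : Type} (v : σ) {r r' : R} (hr : r ≠ r') (w : Str) (s : R → Str)
    (hs : (s r).length = w.length) :
    (guessLoop Γ σ r r').Reach (v, none) (full s) w (2 * w.length + 1) (v, none)
      (full (update (update s r []) r' (w.reverse ++ s r'))) := by
  induction w generalizing s with
  | nil =>
    have h0 : s r = [] := List.eq_nil_of_length_eq_zero hs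
    have h1 := full_update (Γ := Γ) s r []
    refine .step (c := ⟨none, (v, none), full (update s r [])⟩) rfl ?_ ?_
    · simp only [guessLoop, cond_false, TM2.stepAux, full, h0]
      exact congrArg _ h1
    · have : update (update s r []) r' (([] : Str).reverse ++ s r') = update s r [] := by
        rw [List.reverse_nil, List.nil_append, update_eq_iff]
        simp [hr.symm]
      rw [this]
      exact .refl _
  | cons b w ih =>
    obtain ⟨a, l, hl⟩ : ∃ a l, s r = a :: l := by
      cases h : s r with
      | nil => simp [h] at hs
      | cons a l => exact ⟨a, l, rfl⟩
    have h1 := full_update (Γ := Γ) s r l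
    have h2 := full_update (Γ := Γ) (update s r l) r' (b :: s r')
    have h3 := ih (update (update s r l) r' (b :: s r')) (by simpa [hr, hl] using hs)
    refine .step (c := ⟨some true, (v, none), full (update s r l)⟩) rfl ?_
      (.guess (s := .push (.inl r') (fun _ => true) (.goto fun _ => false)) b rfl ?_)
    · simp only [guessLoop, cond_false, TM2.stepAux, full, hl]
      exact congrArg (fun T => (⟨some true, (v, none), T⟩ :
        TM2.Cfg (RegΓ R Γ) Bool (σ × Option Bool))) h1
    · have h4 : TM2.stepAux (cond b (.push (.inl r') (fun _ => true) (.goto fun _ => false))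
          ((guessLoop Γ σ r r').m true)) (v, none) (full (update s r l)) =
          ⟨some false, (v, none), full (update (update s r l) r' (b :: s r'))⟩ := by
        have h5 : full (Γ := Γ) (update s r l) (.inl r') = s r' := update_of_ne hr.symm _ _
        cases b
        · exact congrArg _ ((congrArg (fun z : Str => update (β := fun k => List (RegΓ R Γ k))
            (full (update s r l)) (.inl r') (false :: z)) h5).trans h2)
        · exact congrArg _ ((congrArg (fun z : Str => update (β := fun k => List (RegΓ R Γ k))
            (full (update s r l)) (.inl r') (true :: z)) h5).trans h2)
      refine (congrArg (fun c => Frag.Run _ c w _ _) h4).mpr ?_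
      have h6 : update (update (update (update s r l) r' (b :: s r')) r []) r'
          (w.reverse ++ update (update s r l) r' (b :: s r') r') =
          update (update s r []) r' ((b :: w).reverse ++ s r') := by
        rw [update_comm hr.symm]
        simp
      rw [h6] at h3
      exact h3

/-- The machine computes `c x`, guesses one bit for each of its symbols, evaluates `B`, and pops the
answer into its state. Only the length of `c x` matters. The guessed string arrives in reverse
order, which the call of `B` corrects. -/
theorem exists_NTM {c : Str → Str} (hc : PT c) {B : Str × Str → Bool} (hB : PT B) :
    ∃ M : NTM, M.PolyTime ∧ (∀ x, M.paths x = words (c x).length) ∧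
      ∀ x, M.acc x = {w | w.length = (c x).length ∧ B (x, w) = true} := by
  obtain ⟨q, hq⟩ := hc.exists_size_le
  have h1 : Rz (R := (Unit ⊕ Unit) ⊕ Unit ⊕ Unit) fun s s' => ∃ x,
      s = Sum.elim (Sum.elim (fun _ => x) (fun _ => [])) (fun _ => []) ∧
      s' = Sum.elim (Sum.elim (fun _ => x) (fun _ => []))
        (Sum.elim (fun _ => []) (fun _ => c x)) := by
    refine (hc.at (fun r => .inl (.inl r)) (fun r => .inr (.inr r)) (by
      rintro (_ | _) (_ | _) h <;> first | rfl | simp at h)).mono ?_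
    rintro _ _ ⟨x, rfl, rfl⟩
    refine ⟨x, fun _ => rfl, fun _ => rfl, fun _ => rfl, fun _ => rfl, ?_⟩
    rintro ((r | r) | (r | r)) hr
    exacts [rfl, rfl, rfl, absurd ⟨.inr (), rfl⟩ hr]
  have h2 : Rz (R := (Unit ⊕ Unit) ⊕ Unit ⊕ Unit) fun s s' => ∃ x w,
      s = Sum.elim (Sum.elim (fun _ => x) (fun _ => w.reverse)) (fun _ => []) ∧
      s' = Sum.elim (Sum.elim (fun _ => x) (fun _ => w.reverse))
        (Sum.elim (fun _ => [B (x, w)]) (fun _ => [])) := by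
    refine ((hB.comp (PT.fst.pair (PT.reverse PT.snd))).at .inl (fun r => .inr (.inl r)) (by
      rintro ((_ | _) | _) ((_ | _) | _) h <;> first | rfl | simp at h)).mono ?_
    rintro _ _ ⟨x, w, rfl, rfl⟩
    refine ⟨(x, w.reverse), ?_, fun _ => rfl, ?_, fun _ => ?_, ?_⟩
    · rintro (r | r) <;> rfl
    · rintro (r | r) <;> rfl
    · show [B (x, w)] = [B (x, w.reverse.reverse)]
      rw [List.reverse_reverse]
    · rintro ((r | r) | (r | r)) hr
      exacts [rfl, rfl, absurd ⟨.inr (), rfl⟩ hr, rfl]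
  obtain ⟨M, t₁, h1⟩ := h1
  obtain ⟨N, t₂, h2⟩ := h2
  obtain ⟨F, G, hF, hG, hM, hN⟩ := M.pair N (σ := (M.σ × N.σ) × Option Bool)
    (Equiv.prodAssoc _ _ _)
    (((Equiv.prodComm _ _).prodCongr (.refl _)).trans (Equiv.prodAssoc _ _ _))
  let P : Frag (RegΓ ((Unit ⊕ Unit) ⊕ Unit ⊕ Unit) (Sum.elim M.Γ N.Γ))
      ((M.σ × N.σ) × Option Bool) :=
    .single (.pop (Sum.inl (Sum.inr (Sum.inl ()))) (fun v o => (v.1, o)) .halt)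
  let _ : Fintype (RegΓ ((Unit ⊕ Unit) ⊕ Unit ⊕ Unit) (Sum.elim M.Γ N.Γ) (.inl (.inl (.inl ())))) :=
    inferInstanceAs (Fintype Bool)
  refine ⟨Frag.toNTM ((F.seq (guessLoop (Sum.elim M.Γ N.Γ) (M.σ × N.σ) (.inr (.inr ()))
    (.inl (.inr ())))).seq
      (G.seq P))
    ((M.v₀, N.v₀), none) (.inl (.inl (.inl ()))) (Equiv.refl Bool) {v | v.2 = some true},
    Frag.toNTM_spec _ _ _ _ _ _ _ (t₁ + (2 * q + 1) + (t₂.comp (.X + q) + 1)) ?_⟩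
  intro x w hw
  obtain ⟨n, hn, h3⟩ := h1 _ _ ⟨x, rfl, rfl⟩
  obtain ⟨n', hn', h4⟩ := h2 _ _ ⟨x, w, rfl, rfl⟩
  have h5 := reach_guessLoop (Sum.elim M.Γ N.Γ) (M.v₀, N.v₀)
    (r := (Sum.inr (Sum.inr ()) : (Unit ⊕ Unit) ⊕ Unit ⊕ Unit)) (r' := Sum.inl (Sum.inr ())) (by simp) w (Sum.elim (Sum.elim (fun _ => x) (fun _ => []))
        (Sum.elim (fun _ => []) (fun _ => c x))) hw.symm
  have h6 : Frag.Reach P ((M.v₀, N.v₀), none) (full (Γ := Sum.elim M.Γ N.Γ)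
      (Sum.elim (Sum.elim (fun _ => x) (fun _ => w.reverse))
        (Sum.elim (fun _ => [B (x, w)]) (fun _ => [])))) [] 1 ((M.v₀, N.v₀), some (B (x, w)))
    (update (full _) (.inl (.inr (.inl ()))) []) := .single rfl
  have h7 := ((hM h3 (N.v₀, none)).seq (h5.cast rfl ?_)).seq ((hN h4 (M.v₀, none)).seq h6)
  · simp only [List.nil_append, List.append_nil] at h7
    refine ⟨_, ?_, _, _, h7.cast (full_eq_update _ _ ?_) rfl, ?_⟩
    · have h8 : w.length ≤ q.eval x.length := by simpa [hw] using hq x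
      simp only [memSize_elim, memSize_unit, memSize_nil, Nat.add_zero,
        List.length_reverse] at hn hn'
      have h9 := eval_mono t₂ (Nat.add_le_add_left h8 x.length)
      simp
      omega
    · funext r
      rcases r with (r | r) | (r | r)
      exacts [(List.map_id x).symm, rfl, rfl, rfl]
    · simp
  · refine congrArg full ?_
    funext r
    rcases r with (r | r) | (r | r)
    exacts [rfl, List.append_nil _, rfl, rfl]

/-! ### Unique certificates, and the length of the paths of a balanced machine. -/

/-! ### Characterizations of `UP` -/

/-- A language is in `UP` if it has unique short certificates checkable in polynomial time. -/
theorem mem_UP {L : Set Str} {B : Str × Str → Bool} (hB : PT B) (q : Polynomial ℕ)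
    (hq : ∀ x w, B (x, w) = true → w.length ≤ q.eval x.length)
    (hu : ∀ x w w', B (x, w) = true → B (x, w') = true → w = w')
    (hL : ∀ x, x ∈ L ↔ ∃ w, B (x, w) = true) : L ∈ UP := by
  -- Guess strings have a fixed length, so a certificate of length at most `q` is padded to length
  -- `q + 1`; there is one padding per certificate.
  obtain ⟨M, hM, -, hacc⟩ := exists_NTM (PT.clock PT.id (q + 1))
    ((((PT.fst.comp (PT.unpad .snd)).and
      (hB.comp (PT.fst.pair (PT.snd.comp (PT.unpad .snd))))) : PT fun p : Str × Str => _))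
  refine ⟨M, hM, fun x u hu' u' hu'' => ?_, ?_⟩
  · rw [hacc] at hu' hu''
    simp only [Set.mem_ofPred_eq, Bool.and_eq_true] at hu' hu''
    obtain ⟨h1, h2, h3⟩ := hu'
    obtain ⟨h4, h5, h6⟩ := hu''
    rw [eq_pad_of_unpad (u := u) (Prod.ext h2 rfl), eq_pad_of_unpad (u := u') (Prod.ext h5 rfl),
      h1, h4]
    exact congrArg (pad _) (hu x _ _ h3 h6)
  · ext x
    rw [hL, Set.mem_ofPred_eq, hacc]
    constructor
    · rintro ⟨w, hw⟩
      have h1 := hq x w hw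
      have h2 : w.length < (q + 1).eval x.length := by simp; omega
      refine ⟨pad ((q + 1).eval x.length) w, ?_, ?_⟩
      · rw [length_pad h2]; simp
      · simp [unpad_pad, hw]
    · rintro ⟨u, h1, h2⟩
      simp only [Bool.and_eq_true] at h2
      exact ⟨_, h2.2⟩

theorem NTM.Run.length_le {M : NTM} {c d : M.tm.Cfg} {w : Str} {n : ℕ} (h : M.Run c w n d) :
    w.length ≤ n := by
  induction h with
  | refl => simp
  | det _ _ ih => omega
  | guess _ _ _ ih => simpa using ih

open Classical in
theorem PT.mem_acc {M : NTM} (hM : M.PolyTime) : PT fun p : Str × Str => decide (p.2 ∈ M.acc p.1) :=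
  PT.accepts hM M.accept

open Classical in
theorem PT.mem_paths {M : NTM} (hM : M.PolyTime) :
    PT fun p : Str × Str => decide (p.2 ∈ M.paths p.1) :=
  (PT.accepts hM Set.univ).congr fun p => by
    rw [decide_eq_decide]
    simp [NTM.paths, Accepts]

theorem NTM.acc_subset_paths (M : NTM) (x : Str) : M.acc x ⊆ M.paths x :=
  fun _ ⟨n, d, h1, h2, _⟩ => ⟨n, d, h1, h2⟩

theorem NTM.PolyTime.exists_length_le {M : NTM} (hM : M.PolyTime) :
    ∃ q : Polynomial ℕ, ∀ x, ∀ w ∈ M.paths x, w.length ≤ q.eval x.length := by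
  obtain ⟨t, ht⟩ := hM
  exact ⟨t, fun x w ⟨n, d, h, _⟩ => h.length_le.trans (ht x w n d h)⟩

/-- The accepting paths themselves serve as certificates; their length is bounded by the running
time. -/
theorem exists_of_mem_UP {L : Set Str} (hL : L ∈ UP) : ∃ (B : Str × Str → Bool) (q : Polynomial ℕ),
    PT B ∧ (∀ x w, B (x, w) = true → w.length ≤ q.eval x.length) ∧
    (∀ x w w', B (x, w) = true → B (x, w') = true → w = w') ∧
    ∀ x, x ∈ L ↔ ∃ w, B (x, w) = true := by
  classical
  obtain ⟨M, hM, hu, rfl⟩ := hL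
  obtain ⟨q, hq⟩ := hM.exists_length_le
  refine ⟨_, q, PT.mem_acc hM, fun x w h => hq x w (M.acc_subset_paths x (by simpa using h)),
    fun x w w' h h' => hu x (by simpa using h) (by simpa using h'), fun x => ?_⟩
  simp [Set.Nonempty]

/-- The lengths of the paths of a balanced machine are computable in polynomial time. -/
theorem PT.path_length {M : NTM} (hM : M.PolyTime) {p : ℕ → ℕ} (hp : M.Balanced p) :
    PT fun x : Str => List.replicate (p x.length) false := by
  classical
  obtain ⟨q, hq⟩ := hM.exists_length_le
  have hb : ∀ x : Str, p x.length ≤ q.eval x.length := fun x => by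
    have := hq x (List.replicate (p x.length) false) (by rw [hp x]; simp [words])
    simpa using this
  -- The values of `p` are read off the machine, not computed from coefficients: `0^k` is a path on
  -- `x` exactly if `k = p |x|`. A string of zeros is prolonged until it is a path, and `q` rounds
  -- suffice.
  have h1 : PT fun a : Str => (List.replicate (q.eval a.length) false).foldl
      (fun s _ => if decide (s ∈ M.paths a) then s else false :: s) [] :=
    PT.foldl_of_le (F := fun a s _ => if decide (s ∈ M.paths a) then s else false :: s)
      (PT.clock PT.id q) (.const _)
      (((PT.mem_paths hM).comp (PT.fst.pair (PT.fst.comp .snd))).ite (PT.fst.comp .snd)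
        ((PT.const false).cons (PT.fst.comp .snd))) 1 (fun a z b => by split <;> simp)
  refine h1.congr fun x => ?_
  have h2 : ∀ m k, k ≤ p x.length → (List.replicate m false).foldl
      (fun s _ => if decide (s ∈ M.paths x) then s else false :: s) (List.replicate k false) =
      List.replicate (min (p x.length) (k + m)) false := by
    intro m
    induction m with
    | zero => intro k hk; simp [hk]
    | succ m ih =>
      intro k hk
      rw [List.replicate_succ, List.foldl_cons]
      by_cases hkp : k = p x.length
      · rw [if_pos (by rw [hp x]; simp [words, hkp]), ih k hk]
        congr 1
        omega
      · rw [if_neg (by rw [hp x]; simp [words, hkp]), ← List.replicate_succ, ih _ (by omega)]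
        congr 1
        omega
  have h3 := h2 (q.eval x.length) 0 (by omega)
  rw [Nat.zero_add, Nat.min_eq_left (hb x)] at h3
  exact h3.symm

/-! ### Words as numbers, and renamings as position functions. -/

/-! ### Strings as numbers -/

/-- The number with the binary expansion `w`, most significant bit first. -/
def val : Str → ℕ
  | [] => 0
  | b :: w => b.toNat * 2 ^ w.length + val w

theorem val_lt (w : Str) : val w < 2 ^ w.length := by
  induction w with
  | nil => simp [val]
  | cons b w ih => cases b <;> simp [val, pow_succ] <;> omega

theorem val_append (u w : Str) : val (u ++ w) = val u * 2 ^ w.length + val w := by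
  induction u with
  | nil => simp [val]
  | cons b u ih => simp [val, ih, pow_add]; ring

@[simp] theorem val_replicate_false (n : ℕ) : val (List.replicate n false) = 0 := by
  induction n with
  | zero => rfl
  | succ n ih => simp [List.replicate_succ, val, ih]

theorem val_replicate_true (n : ℕ) : val (List.replicate n true) + 1 = 2 ^ n := by
  induction n with
  | zero => rfl
  | succ n ih => simp [List.replicate_succ, val, pow_succ]; omega

theorem lexLt_iff {a b : Str} (h : a.length = b.length) : lexLt a b ↔ val a < val b := by
  rw [lexLt, List.shortlex_def]
  induction a generalizing b with
  | nil =>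
    obtain rfl := List.eq_nil_of_length_eq_zero h.symm
    simp [val]
  | cons c a ih =>
    cases b with
    | nil => simp at h
    | cons d b =>
      simp only [List.length_cons, Nat.add_right_cancel_iff] at h
      have h1 := ih h
      have h2 := val_lt a
      have h3 := val_lt b
      simp only [h, lt_irrefl, true_and, false_or, List.length_cons] at h1 h2 ⊢
      rw [List.cons_lex_cons_iff, h1]
      have h4 : ¬ (true < false) := by decide
      cases c <;> cases d <;> simp [val, h, h4] <;> omega

theorem val_inj {a b : Str} (h : a.length = b.length) (h' : val a = val b) : a = b := by
  induction a generalizing b with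
  | nil => exact (List.eq_nil_of_length_eq_zero h.symm).symm
  | cons c a ih =>
    cases b with
    | nil => simp at h
    | cons d b =>
      simp only [List.length_cons, Nat.add_right_cancel_iff] at h
      have h2 := val_lt a
      have h3 := val_lt b
      simp only [val, h] at h' h2
      cases c <;> cases d <;> simp at h' <;> first | omega | rw [ih h (by omega)]

theorem lexLt.length_le {a b : Str} (h : lexLt a b) : a.length ≤ b.length := by
  rw [lexLt, List.shortlex_def] at h
  omega

theorem ncard_words (n : ℕ) : (words n).ncard = 2 ^ n := by
  have : (words n).ncard = Nat.card (List.Vector Bool n) := rfl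
  rw [this, Nat.card_eq_fintype_card, card_vector]
  simp

/-- Both sets have `2 ^ n` elements, so injectivity suffices. -/
theorem bijOn_words {n : ℕ} {φ : Str → ℕ} (h : Set.MapsTo φ (words n) (Set.Iio (2 ^ n)))
    (hi : Set.InjOn φ (words n)) : Set.BijOn φ (words n) (Set.Iio (2 ^ n)) := by
  refine ⟨h, hi, ?_⟩
  have h1 : φ '' words n = Set.Iio (2 ^ n) := by
    refine Set.eq_of_subset_of_ncard_le h.image_subset ?_ (Set.finite_Iio _)
    rw [hi.ncard_image, ncard_words]
    simp [Set.ncard_eq_toFinset_card']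
  exact h1.symm.subset

theorem bijOn_val (n : ℕ) : Set.BijOn val (words n) (Set.Iio (2 ^ n)) :=
  bijOn_words (fun w (hw : w.length = n) => hw ▸ val_lt w)
    fun a (ha : a.length = n) b (hb : b.length = n) h => val_inj (ha.trans hb.symm) h

theorem lexSucc_iff {n : ℕ} {a b : Str} (ha : a ∈ words n) (hb : b ∈ words n) :
    lexSucc a b ↔ val b = val a + 1 := by
  have hab : a.length = b.length := ha.trans hb.symm
  rw [lexSucc, lexLt_iff hab]
  constructor
  · rintro ⟨h1, h2⟩
    by_contra h3
    obtain ⟨c, hc, hc'⟩ := (bijOn_val n).surjOn (Set.mem_Iio.2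
      (lt_of_le_of_lt h1 ((bijOn_val n).mapsTo hb)))
    exact h2 ⟨c, (lexLt_iff (ha.trans hc.symm)).2 (by omega),
      (lexLt_iff (hc.trans hb.symm)).2 (by omega)⟩
  · intro h
    refine ⟨by omega, ?_⟩
    rintro ⟨c, h1, h2⟩
    -- Candidates between `a` and `b` range over all strings; having length between two equal
    -- lengths, they are words of length `n` as well.
    have hc : a.length = c.length := le_antisymm h1.length_le (hab ▸ h2.length_le)
    rw [lexLt_iff hc] at h1
    rw [lexLt_iff (hc.symm.trans hab)] at h2
    omega

theorem lexLe_iff {n : ℕ} {a b : Str} (ha : a ∈ words n) (hb : b ∈ words n) :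
    lexLe a b ↔ val a ≤ val b := by
  have hab : a.length = b.length := ha.trans hb.symm
  rw [lexLe, lexLt_iff hab, le_iff_lt_or_eq, or_comm]
  exact or_congr_right ⟨fun h => h ▸ rfl, val_inj hab⟩

theorem addBit_spec (w : Str) (c : Bool) : (addBit w c).2.length = w.length ∧
    (addBit w c).1.toNat * 2 ^ w.length + val (addBit w c).2 = val w + c.toNat := by
  induction w with
  | nil => simp [addBit, val]
  | cons b w ih =>
    have h : addBit (b :: w) c = (b && (addBit w c).1, (b ^^ (addBit w c).1) :: (addBit w c).2) :=
      rfl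
    rw [h]
    obtain ⟨h1, h2⟩ := ih
    refine ⟨by simp [h1], ?_⟩
    rcases b with _ | _ <;> rcases hc : (addBit w c).1 with _ | _ <;>
      simp [hc, val, h1, pow_succ] at h2 ⊢ <;> omega

/-- The successor of a string among those of the same length. -/
theorem addBit_eq_iff {n : ℕ} {y z : Str} (hy : y ∈ words n) (hz : z ∈ words n) :
    addBit y true = (false, z) ↔ val z = val y + 1 := by
  obtain ⟨h1, h2⟩ := addBit_spec y true
  have hz' := val_lt z
  have h3 : y.length = n := hy
  have h4 : z.length = n := hz
  rw [h4] at hz'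
  rw [h3] at h1 h2
  constructor
  · intro h
    simp [h] at h2
    exact h2
  · intro h
    rcases hc : (addBit y true).1 with _ | _ <;> simp [hc] at h2
    · exact Prod.ext hc (val_inj (h1.trans h4.symm) (h2.trans h.symm))
    · omega

/-! ### Positions instead of renamings -/

/-- `φ` gives the positions of the strings of length `n` in an order on them. -/
def IsPos (n : ℕ) (φ : Str → ℕ) : Prop := Set.BijOn φ (words n) (Set.Iio (2 ^ n))

/-- The set `A`, if nonempty, is an interval with respect to the positions `φ`. -/
def IsInterval (n : ℕ) (φ : Str → ℕ) (A : Set Str) : Prop :=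
  A ≠ ∅ → ∃ l ∈ words n, ∃ u ∈ words n, A = {w | w ∈ words n ∧ φ l ≤ φ w ∧ φ w ≤ φ u}

theorem isPos_val_comp {n : ℕ} {h : Str → Str} (hh : Set.BijOn h (words n) (words n)) :
    IsPos n fun w => val (h w) :=
  (bijOn_val n).comp hh

theorem isCluster_iff {n : ℕ} {h : Str → Str} (hh : Set.BijOn h (words n) (words n))
    (A : Set Str) : IsCluster n h A ↔ IsInterval n (fun w => val (h w)) A := by
  have key : ∀ l ∈ words n, ∀ u ∈ words n, {w | w ∈ words n ∧ lexLe (h l) (h w) ∧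
      lexLe (h w) (h u)} = {w | w ∈ words n ∧ val (h l) ≤ val (h w) ∧ val (h w) ≤ val (h u)} := by
    intro l hl u hu
    ext w
    refine and_congr_right fun hw => ?_
    rw [lexLe_iff (hh.mapsTo hl) (hh.mapsTo hw), lexLe_iff (hh.mapsTo hw) (hh.mapsTo hu)]
  refine imp_congr_right fun _ => ?_
  refine exists_congr fun l => and_congr_right fun hl => exists_congr fun u =>
    and_congr_right fun hu => ?_
  rw [key l hl u hu]

/-- A renaming with given positions. -/
theorem IsPos.exists_renaming {n : ℕ} {φ : Str → ℕ} (hφ : IsPos n φ) :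
    ∃ h : Str → Str, Set.BijOn h (words n) (words n) ∧ ∀ w ∈ words n, val (h w) = φ w := by
  refine ⟨fun w => Function.invFunOn val (words n) (φ w), Set.BijOn.comp (t := Set.Iio (2 ^ n))
    ((bijOn_val n).symm (bijOn_val n).invOn_invFunOn.symm) hφ, fun w hw =>
    Function.invFunOn_eq ((bijOn_val n).surjOn (hφ.mapsTo hw))⟩

theorem val_eq_zero_iff {n : ℕ} {w : Str} (hw : w ∈ words n) :
    val w = 0 ↔ w = List.replicate n false := by
  refine ⟨fun h => val_inj (hw.trans (by simp)) (by simpa using h), ?_⟩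
  rintro rfl
  simp

theorem val_add_one_eq_iff {n : ℕ} {w : Str} (hw : w ∈ words n) :
    val w + 1 = 2 ^ n ↔ w = List.replicate n true := by
  have := val_replicate_true n
  refine ⟨fun h => val_inj (hw.trans (by simp)) (by omega), ?_⟩
  rintro rfl
  exact this

theorem IsInterval.congr {n : ℕ} {φ ψ : Str → ℕ} {A : Set Str} (h : IsInterval n φ A)
    (hφ : ∀ w ∈ words n, ψ w = φ w) : IsInterval n ψ A := by
  intro hA
  obtain ⟨l, hl, u, hu, h⟩ := h hA
  refine ⟨l, hl, u, hu, h.trans ?_⟩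
  ext w
  refine and_congr_right fun hw => ?_
  rw [hφ l hl, hφ u hu, hφ w hw]

/-- A renaming `h` enters only through the positions `val (h w)`, and every bijection onto `{0, …,
2^n - 1}` arises in this way. Positions turn the later case distinctions into arithmetic. -/
theorem mem_CLUSharpPFree_iff {f : Str → ℕ} : f ∈ CLUSharpPFree ↔
    ∃ p : ℕ → ℕ, IsPolynomial p ∧ ∃ M : NTM, M.PolyTime ∧ M.Balanced p ∧
    ∃ prec : Str × Str × Str → Bool, PT prec ∧ ∀ x : Str, ∃ φ : Str → ℕ, IsPos (p x.length) φ ∧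
      (∀ y ∈ words (p x.length), ∀ z ∈ words (p x.length),
        (prec (x, y, z) = true ↔ φ z = φ y + 1)) ∧
      IsInterval (p x.length) φ (M.acc x) ∧ f x = M.numAcc x := by
  constructor
  · rintro ⟨p, hp, M, hM, hb, prec, hprec, h⟩
    refine ⟨p, hp, M, hM, hb, _, PT.of_mem_PolyPred₃ hprec, fun x => ?_⟩
    obtain ⟨h, h1, h2, h3, h4⟩ := h x
    exact ⟨_, isPos_val_comp h1, fun y hy z hz => (h2 y hy z hz).trans
      (lexSucc_iff (h1.mapsTo hy) (h1.mapsTo hz)), (isCluster_iff h1 _).1 h3, h4⟩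
  · rintro ⟨p, hp, M, hM, hb, prec, hprec, h⟩
    refine ⟨p, hp, M, hM, hb, fun x y z => prec (x, y, z), mem_PolyPred₃_of_PT hprec, fun x => ?_⟩
    obtain ⟨φ, h1, h2, h3, h4⟩ := h x
    obtain ⟨h, hh, hφ⟩ := h1.exists_renaming
    refine ⟨h, hh, fun y hy z hz => (h2 y hy z hz).trans ?_,
      (isCluster_iff hh _).2 (h3.congr hφ), h4⟩
    rw [lexSucc_iff (hh.mapsTo hy) (hh.mapsTo hz), hφ y hy, hφ z hz]

theorem mem_CLUSharpP_of_isPos {f : Str → ℕ} {p : ℕ → ℕ} (hp : IsPolynomial p) {M : NTM}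
    (hM : M.PolyTime) (hb : M.Balanced p) {bot top : Str → Str} (hbot : PT bot) (htop : PT top)
    {prec : Str × Str × Str → Bool} (hprec : PT prec) (h : ∀ x : Str, ∃ φ : Str → ℕ,
      IsPos (p x.length) φ ∧ bot x ∈ words (p x.length) ∧ top x ∈ words (p x.length) ∧
      φ (bot x) = 0 ∧ φ (top x) + 1 = 2 ^ p x.length ∧
      (∀ y ∈ words (p x.length), ∀ z ∈ words (p x.length),
        (prec (x, y, z) = true ↔ φ z = φ y + 1)) ∧
      IsInterval (p x.length) φ (M.acc x) ∧ f x = M.numAcc x) : f ∈ CLUSharpP := by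
  refine ⟨p, hp, M, hM, hb, bot, mem_FPt_of_PT hbot, top, mem_FPt_of_PT htop,
    fun x y z => prec (x, y, z), mem_PolyPred₃_of_PT hprec, fun x => ?_⟩
  obtain ⟨φ, h1, h2, h3, h4, h5, h6, h7, h8⟩ := h x
  obtain ⟨h, hh, hφ⟩ := h1.exists_renaming
  refine ⟨h, hh, ⟨h2, h3⟩, ⟨?_, ?_⟩, fun y hy z hz => (h6 y hy z hz).trans ?_,
    (isCluster_iff hh _).2 (h7.congr hφ), h8⟩
  · rw [← val_eq_zero_iff (hh.mapsTo h2), hφ _ h2, h4]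
  · rw [← val_add_one_eq_iff (hh.mapsTo h3), hφ _ h3, h5]
  · rw [lexSucc_iff (hh.mapsTo hy) (hh.mapsTo hz), hφ y hy, hφ z hz]

/-- Successor and wrap-around together are the successor modulo `2 ^ n`. For `n = 0` the only word
is its own neighbour. -/
theorem exists_of_mem_CLUSharpPCircular {f : Str → ℕ} (hf : f ∈ CLUSharpPCircular) :
    ∃ p : ℕ → ℕ, IsPolynomial p ∧ ∃ M : NTM, M.PolyTime ∧ M.Balanced p ∧
    ∃ prec : Str × Str × Str → Bool, PT prec ∧ ∀ x : Str, ∃ φ : Str → ℕ, IsPos (p x.length) φ ∧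
      (∀ y ∈ words (p x.length), ∀ z ∈ words (p x.length),
        (prec (x, y, z) = true ↔ φ z = (φ y + 1) % 2 ^ p x.length)) ∧
      IsInterval (p x.length) φ (M.acc x) ∧ f x = M.numAcc x := by
  obtain ⟨p, hp, M, hM, hb, prec, hprec, h⟩ := hf
  refine ⟨p, hp, M, hM, hb, _, PT.of_mem_PolyPred₃ hprec, fun x => ?_⟩
  obtain ⟨h, h1, h2, h3, h4⟩ := h x
  refine ⟨_, isPos_val_comp h1, fun y hy z hz => (h2 y hy z hz).trans ?_,
    (isCluster_iff h1 _).1 h3, h4⟩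
  rw [lexSucc_iff (h1.mapsTo hy) (h1.mapsTo hz), ← val_add_one_eq_iff (h1.mapsTo hy),
    ← val_eq_zero_iff (h1.mapsTo hz)]
  have h5 : val (h y) < 2 ^ p x.length := (bijOn_val _).mapsTo (h1.mapsTo hy)
  have h6 : val (h z) < 2 ^ p x.length := (bijOn_val _).mapsTo (h1.mapsTo hz)
  rcases Nat.lt_or_ge (val (h y) + 1) (2 ^ p x.length) with h7 | h7
  · rw [Nat.mod_eq_of_lt h7]; omega
  · have h8 : val (h y) + 1 = 2 ^ p x.length := by omega
    rw [h8, Nat.mod_self]; omega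

/-- `CLU#P` is contained in the other two classes. -/
theorem CLUSharpP_subset_free : CLUSharpP ⊆ CLUSharpPFree := by
  rintro f ⟨p, hp, M, hM, hb, bot, -, top, -, prec, hprec, h⟩
  refine ⟨p, hp, M, hM, hb, prec, hprec, fun x => ?_⟩
  obtain ⟨h, h1, -, -, h2⟩ := h x
  exact ⟨h, h1, h2⟩

theorem CLUSharpP_subset_circular : CLUSharpP ⊆ CLUSharpPCircular := by
  rintro f ⟨p, hp, M, hM, hb, bot, hbot, top, htop, prec, hprec, h⟩
  have hbot := PT.of_mem_FPt hbot
  have htop := PT.of_mem_FPt htop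
  have h1 : PT fun q : Str × Str × Str => prec q.1 q.2.1 q.2.2 ||
      (decide (q.2.1 = top q.1) && decide (q.2.2 = bot q.1)) :=
    (PT.of_mem_PolyPred₃ hprec).or ((PT.decide_eq (PT.fst.comp .snd) (htop.comp .fst)).and
      (PT.decide_eq (PT.snd.comp .snd) (hbot.comp .fst)))
  refine ⟨p, hp, M, hM, hb, fun x y z => prec x y z || (decide (y = top x) && decide (z = bot x)),
    mem_PolyPred₃_of_PT h1, fun x => ?_⟩
  obtain ⟨h, hh, ⟨hb, ht⟩, ⟨hb', ht'⟩, h2, h3⟩ := h x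
  refine ⟨h, hh, fun y hy z hz => ?_, h3⟩
  rw [← h2 y hy z hz, ← hb', ← ht', hh.injOn.eq_iff hy ht, hh.injOn.eq_iff hz hb]
  simp

/-! ### Certificates consisting of two strings -/

/-- Check a pair of strings, given as one string. -/
def splitCert {α : Type} (D : α × Str × Str → Bool) (p : α × Str) : Bool :=
  decide (p.2 = pairStr (unpairStr p.2).1 (unpairStr p.2).2) && D (p.1, unpairStr p.2)

theorem PT.splitCert {α : Type} [Code α] {D : α × Str × Str → Bool} (hD : PT D) :
    PT (splitCert D) :=
  have h : PT fun p : α × Str => Cluster.unpairStr p.2 := PT.unpairStr .snd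
  (PT.decide_eq .snd (PT.pairStr (PT.fst.comp h) (PT.snd.comp h))).and (hD.comp (PT.fst.pair h))

/-- Decoding is total, so strings that code no pair are excluded by encoding again; otherwise one
pair could have several certificates. -/
theorem splitCert_iff {α : Type} {D : α × Str × Str → Bool} {a : α} {w : Str} :
    splitCert D (a, w) = true ↔ ∃ u v, w = pairStr u v ∧ D (a, u, v) = true := by
  simp only [splitCert, Bool.and_eq_true, decide_eq_true_eq]
  constructor
  · rintro ⟨h1, h2⟩
    exact ⟨_, _, h1, h2⟩
  · rintro ⟨u, v, rfl, h⟩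
    simpa [unpairStr_pairStr] using h

theorem pairStr_inj {u v u' v' : Str} : pairStr u v = pairStr u' v' ↔ u = u' ∧ v = v' := by
  refine ⟨fun h => ?_, fun ⟨h1, h2⟩ => h1 ▸ h2 ▸ rfl⟩
  have := congrArg unpairStr h
  simpa [unpairStr_pairStr] using this

/-! ### Successors -/

/-- `z` is the successor of `y` among the strings of the same length. -/
def isSucc (y z : Str) : Bool := !(addBit y true).1 && decide ((addBit y true).2 = z)

theorem PT.isSucc {α : Type} [Code α] {f g : α → Str} (hf : PT f) (hg : PT g) :
    PT fun a => isSucc (f a) (g a) :=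
  (PT.fst.comp (hf.addBit true)).not.and (PT.decide_eq (PT.snd.comp (hf.addBit true)) hg)

theorem isSucc_iff {n : ℕ} {y z : Str} (hy : y ∈ words n) (hz : z ∈ words n) :
    isSucc y z = true ↔ val z = val y + 1 := by
  rw [← addBit_eq_iff hy hz, isSucc, Prod.ext_iff]
  simp

theorem addBit_fst_iff {n : ℕ} {y : Str} (hy : y ∈ words n) :
    (addBit y true).1 = true ↔ val y + 1 = 2 ^ n := by
  obtain ⟨h1, h2⟩ := addBit_spec y true
  have h3 : y.length = n := hy
  have h4 := val_lt y
  have h5 := val_lt (addBit y true).2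
  rw [h1] at h5
  rw [h3] at h2 h4 h5
  rcases hc : (addBit y true).1 with _ | _ <;> simp [hc] at h2 ⊢ <;> omega

theorem isPolynomial_eval (q : Polynomial ℕ) : IsPolynomial fun n => q.eval n :=
  ⟨q.map (Nat.castRingHom ℝ), fun n => by rw [Polynomial.eval_natCast_map]; simp⟩

/-! ### From the circular inclusion to `UP = coUP`. -/

/-! ### The order in which one string is moved to the end -/

/-- The positions when the string with value `c` is moved to the end. -/
def movePos (n c : ℕ) (w : Str) : ℕ :=
  if val w = c then 2 ^ n - 1 else if val w < c then val w else val w - 1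

theorem isPos_movePos {n c : ℕ} (hc : c < 2 ^ n) : IsPos n (movePos n c) := by
  refine bijOn_words (fun w hw => ?_) fun a ha b hb h => ?_
  · have h1 : val w < 2 ^ n := (bijOn_val n).mapsTo hw
    simp only [Set.mem_Iio, movePos]
    split_ifs <;> omega
  · have h1 : val a < 2 ^ n := (bijOn_val n).mapsTo ha
    have h2 : val b < 2 ^ n := (bijOn_val n).mapsTo hb
    refine (bijOn_val n).injOn ha hb ?_
    simp only [movePos] at h
    split_ifs at h <;> omega

/-- The neighbourhood relation of the order in which the string fulfilling `C` is moved to the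
end. -/
def movePrec (C : Str × Str → Bool) (p : Str × Str × Str) : Bool :=
  -- The moved word comes last and has no successor; its predecessor is `1…1`, the word whose
  -- increment overflows. Any other neighbours differ by one, or by two with the moved word in
  -- between.
  if C (p.1, p.2.1) then false else
    if C (p.1, p.2.2) then (addBit p.2.1 true).1 else
      isSucc p.2.1 p.2.2 || (!(addBit p.2.1 true).1 && C (p.1, (addBit p.2.1 true).2) &&
        isSucc (addBit p.2.1 true).2 p.2.2)

theorem PT.movePrec {C : Str × Str → Bool} (hC : PT C) : PT (movePrec C) := by
  have hy : PT fun p : Str × Str × Str => p.2.1 := PT.fst.comp .snd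
  have hz : PT fun p : Str × Str × Str => p.2.2 := PT.snd.comp .snd
  have ha := hy.addBit true
  exact (hC.comp (PT.fst.pair hy)).ite (.const _) ((hC.comp (PT.fst.pair hz)).ite
    (PT.fst.comp ha) ((PT.isSucc hy hz).or (((PT.fst.comp ha).not.and
      (hC.comp (PT.fst.pair (PT.snd.comp ha)))).and (PT.isSucc (PT.snd.comp ha) hz))))

/-- By `hu'` the moved word is not already the last one, so `1…1` becomes its predecessor. -/
theorem movePrec_iff {C : Str × Str → Bool} {x : Str} {n : ℕ} {u : Str} (hu : u ∈ words n)
    (hC : ∀ w ∈ words n, C (x, w) = true ↔ w = u) (hu' : val u + 1 < 2 ^ n) {y z : Str}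
    (hy : y ∈ words n) (hz : z ∈ words n) :
    movePrec C (x, y, z) = true ↔ movePos n (val u) z = movePos n (val u) y + 1 := by
  have hval : ∀ w ∈ words n, C (x, w) = true ↔ val w = val u := fun w hw =>
    (hC w hw).trans ((bijOn_val n).injOn.eq_iff hw hu).symm
  have hy' : val y < 2 ^ n := (bijOn_val n).mapsTo hy
  have hz' : val z < 2 ^ n := (bijOn_val n).mapsTo hz
  by_cases h1 : val y = val u
  · simp only [movePrec, (hval y hy).2 h1, if_true, Bool.false_eq_true, false_iff, movePos, h1]
    split_ifs <;> omega
  have h2 : C (x, y) = false := by simpa using (hval y hy).not.2 h1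
  by_cases h3 : val z = val u
  · simp only [movePrec, h2, (hval z hz).2 h3, if_true, Bool.false_eq_true, if_false,
      addBit_fst_iff hy, movePos, h1, h3]
    split_ifs <;> omega
  have h4 : C (x, z) = false := by simpa using (hval z hz).not.2 h3
  have hm : (addBit y true).2 ∈ words n := (addBit_spec y true).1.trans hy
  have h5 : ((!(addBit y true).1 && C (x, (addBit y true).2) && isSucc (addBit y true).2 z) = true)
      ↔ val y + 1 = val u ∧ val z = val u + 1 := by
    rw [Bool.and_eq_true, Bool.and_eq_true, isSucc_iff hm hz, hval _ hm]
    constructor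
    · rintro ⟨⟨h5, h6⟩, h7⟩
      have := (addBit_eq_iff hy hm).1 (Prod.ext (by simpa using h5) rfl)
      omega
    · rintro ⟨h5, h6⟩
      have h7 := (addBit_eq_iff hy hu).2 h5.symm
      simp [h7, h6]
  simp only [movePrec, h2, h4, Bool.false_eq_true, if_false]
  rw [Bool.or_eq_true, isSucc_iff hy hz, h5]
  simp only [movePos, h1, h3, if_false]
  split_ifs <;> omega

theorem movePrec_iff_of_forall_not {C : Str × Str → Bool} {x : Str} {n : ℕ}
    (hC : ∀ w ∈ words n, C (x, w) = false) {y z : Str} (hy : y ∈ words n) (hz : z ∈ words n) :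
    movePrec C (x, y, z) = true ↔ val z = val y + 1 := by
  have hm : (addBit y true).2 ∈ words n := (addBit_spec y true).1.trans hy
  simp [movePrec, hC y hy, hC z hz, hC _ hm, isSucc_iff hy hz]

/-- For every language in `UP` there is a function in `CLU#P_free` which is `2` on the language
and `1` off it. -/
theorem exists_free_of_mem_UP {L : Set Str} (hL : L ∈ UP) :
    ∃ f ∈ CLUSharpPFree, ∀ x, (x ∈ L → f x = 2) ∧ (x ∉ L → f x = 1) := by
  obtain ⟨B, q, hB, hq, hu, hL⟩ := exists_of_mem_UP hL
  have hun : PT fun p : Str × Str => unpad p.2.tail := PT.unpad (PT.tail .snd)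
  -- The leading `0` keeps certificate words apart from `1…1`. Together with a padding to length `q
  -- + 1` it accounts for the length `q + 2`.
  let C : Str × Str → Bool := fun p => !(p.2.headD false) &&
    ((unpad p.2.tail).1 && B (p.1, (unpad p.2.tail).2))
  have hC : PT C := (PT.headD .snd).not.and ((PT.fst.comp hun).and
    (hB.comp (PT.fst.pair (PT.snd.comp hun))))
  let n : Str → ℕ := fun x => (q + 2).eval x.length
  have hn : ∀ x, n x = q.eval x.length + 2 := fun x => by simp [n]
  -- Accepting are the certificate word, if there is one, and `1…1`, recognized by the carry of its
  -- increment.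
  obtain ⟨M, hM, hpaths, hacc⟩ := exists_NTM (PT.clock PT.id (q + 2))
    ((hC.or (PT.fst.comp (PT.addBit .snd true))) : PT fun p : Str × Str => _)
  have hacc' : ∀ x, M.acc x = {w | w ∈ words (n x) ∧ (C (x, w) = true ∨ val w + 1 = 2 ^ n x)} := by
    intro x
    rw [hacc]
    ext w
    simp only [Set.mem_ofPred_eq, List.length_replicate, Bool.or_eq_true]
    exact and_congr_right fun hw => or_congr_right (addBit_fst_iff hw)
  have ones : ∀ x, List.replicate (n x) true ∈ words (n x) := fun x => by simp [words]
  have h2 : ∀ x, 4 ≤ 2 ^ n x := fun x => by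
    rw [hn, pow_add]; have := Nat.one_le_two_pow (n := q.eval x.length); omega
  have in_L : ∀ x ∈ L, ∃ u ∈ words (n x), (∀ w ∈ words (n x), C (x, w) = true ↔ w = u) ∧
      val u + 1 < 2 ^ n x := by
    intro x hx
    obtain ⟨w, hw⟩ := (hL x).1 hx
    have h3 := hq x w hw
    have h4 : (pad (q.eval x.length + 1) w).length = q.eval x.length + 1 := length_pad (by omega)
    have h5 : (false :: pad (q.eval x.length + 1) w) ∈ words (n x) := by
      simp [words, hn, h4]
    refine ⟨_, h5, fun v hv => ⟨fun h => ?_, ?_⟩, ?_⟩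
    · simp only [C, Bool.and_eq_true] at h
      obtain ⟨h6, h7, h8⟩ := h
      cases v with
      | nil => simp [words, hn] at hv
      | cons b v =>
        have h9 : v.length = q.eval x.length + 1 := by simpa [words, hn] using hv
        simp only [List.headD_cons, Bool.not_eq_true', List.tail_cons] at h6 h7 h8
        rw [h6, eq_pad_of_unpad (u := v) (Prod.ext h7 rfl), h9]
        exact congrArg _ (congrArg (pad _) (hu x _ _ h8 hw))
    · rintro rfl
      simp [C, unpad_pad, hw]
    · have h6 := val_lt (pad (q.eval x.length + 1) w)
      have h7 := h2 x
      rw [h4] at h6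
      simp only [val, Bool.toNat_false, Nat.zero_mul, Nat.zero_add]
      rw [hn] at h7 ⊢
      rw [pow_succ] at h7 ⊢
      omega
  have off_L : ∀ x, x ∉ L → ∀ w ∈ words (n x), C (x, w) = false := by
    intro x hx w hw
    by_contra h
    simp only [Bool.not_eq_false, C, Bool.and_eq_true] at h
    exact hx ((hL x).2 ⟨_, h.2.2⟩)
  have hones : ∀ x, val (List.replicate (n x) true) + 1 = 2 ^ n x := fun x => val_replicate_true _
  have hvi : ∀ x w, w ∈ words (n x) → val w + 1 = 2 ^ n x → w = List.replicate (n x) true :=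
    fun x w hw h => (val_add_one_eq_iff hw).1 h
  have num : ∀ x, (x ∈ L → M.numAcc x = 2) ∧ (x ∉ L → M.numAcc x = 1) := by
    refine fun x => ⟨fun hx => ?_, fun hx => ?_⟩
    · obtain ⟨u, h3, h4, h5⟩ := in_L x hx
      have : M.acc x = {u, List.replicate (n x) true} := by
        rw [hacc']
        ext w
        constructor
        · rintro ⟨hw, h6 | h6⟩
          exacts [.inl ((h4 w hw).1 h6), .inr (hvi x w hw h6)]
        · rintro (rfl | rfl)
          exacts [⟨h3, .inl ((h4 _ h3).2 rfl)⟩, ⟨ones x, .inr (hones x)⟩]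
      rw [NTM.numAcc, this, Set.ncard_pair]
      rintro rfl
      exact absurd (hones x) (by omega)
    · have : M.acc x = {List.replicate (n x) true} := by
        rw [hacc']
        ext w
        constructor
        · rintro ⟨hw, h6 | h6⟩
          exacts [absurd h6 (by simp [off_L x hx w hw]), hvi x w hw h6]
        · rintro rfl
          exact ⟨ones x, .inr (hones x)⟩
      rw [NTM.numAcc, this, Set.ncard_singleton]
  refine ⟨M.numAcc, mem_CLUSharpPFree_iff.2 ⟨fun k => (q + 2).eval k, isPolynomial_eval _, M, hM,
    fun x => by rw [hpaths]; simp, _, PT.movePrec hC, fun x => ?_⟩, num⟩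
  change ∃ φ, IsPos (n x) φ ∧ (∀ y ∈ words (n x), ∀ z ∈ words (n x), _) ∧ IsInterval (n x) φ _ ∧ _
  by_cases hx : x ∈ L
  · obtain ⟨u, h3, h4, h5⟩ := in_L x hx
    -- The accepting set consists of the last two positions, `1…1` and then the moved word.
    refine ⟨movePos (n x) (val u), isPos_movePos (by omega), fun y hy z hz =>
      movePrec_iff h3 h4 h5 hy hz, fun _ => ⟨_, ones x, u, h3, ?_⟩, rfl⟩
    rw [hacc']
    ext w
    refine and_congr_right fun hw => ?_
    have h6 := hones x
    have h7 : val w < 2 ^ n x := (bijOn_val _).mapsTo hw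
    rw [h4 w hw, ← (bijOn_val (n x)).injOn.eq_iff hw h3]
    simp only [movePos]
    split_ifs <;> omega
  · refine ⟨val, bijOn_val _, fun y hy z hz => movePrec_iff_of_forall_not (off_L x hx) hy hz,
      fun _ => ⟨_, ones x, _, ones x, ?_⟩, rfl⟩
    rw [hacc']
    ext w
    refine and_congr_right fun hw => ?_
    have h6 := hones x
    simp only [off_L x hx w hw, Bool.false_eq_true, false_or]
    omega

/-! ### Circular neighbourhood -/

/-- In a circular order, an interval element whose neighbours are outside of the interval (or
itself) is the only element of the interval. -/
theorem eq_singleton_of_isolated {n : ℕ} {φ : Str → ℕ} (hφ : IsPos n φ) {A : Set Str}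
    (hA : IsInterval n φ A) {z₀ y z₁ : Str} (hy : y ∈ A) (h₀ : z₀ ∈ words n) (h₁ : z₁ ∈ words n)
    (h0 : φ y = (φ z₀ + 1) % 2 ^ n) (h1 : φ z₁ = (φ y + 1) % 2 ^ n) (h0' : z₀ = y ∨ z₀ ∉ A)
    (h1' : z₁ = y ∨ z₁ ∉ A) : A = {y} := by
  obtain ⟨l, hl, u, hu, rfl⟩ := hA (Set.nonempty_iff_ne_empty.1 ⟨y, hy⟩)
  obtain ⟨hyw, h2, h3⟩ := hy
  have h4 : φ u < 2 ^ n := hφ.mapsTo hu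
  have h5 : φ z₀ < 2 ^ n := hφ.mapsTo h₀
  -- If `y` were not the upper end of the interval, its successor would arise without wrapping and
  -- would be another element of the interval. The lower end is treated symmetrically.
  have h6 : φ y = φ u := by
    by_contra h
    rw [Nat.mod_eq_of_lt (by omega)] at h1
    rcases h1' with rfl | h1'
    · omega
    · exact h1' ⟨h₁, by omega, by omega⟩
  have h7 : φ l = φ y := by
    by_contra h
    have h8 : φ z₀ + 1 < 2 ^ n := by
      by_contra h9
      rw [show φ z₀ + 1 = 2 ^ n by omega, Nat.mod_self] at h0
      omega
    rw [Nat.mod_eq_of_lt h8] at h0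
    rcases h0' with rfl | h0'
    · omega
    · exact h0' ⟨h₀, by omega, by omega⟩
  ext w
  constructor
  · rintro ⟨hw, h8, h9⟩
    exact hφ.injOn hw hyw (by omega)
  · rintro rfl
    exact ⟨hyw, h2, h3⟩

/-- A certificate for `x ∉ L` consists of an accepting path `y` and its neighbours `z₀` and `z₁`,
neither of them a further accepting path. It forces `f x = 1`, and conversely the only accepting
path and its neighbours form such a triple. -/
theorem UP_subset_coUP_of_free_subset_circular (h : CLUSharpPFree ⊆ CLUSharpPCircular) :
    UP ⊆ coUP := by
  classical
  intro L hL
  obtain ⟨f, hf, hfL⟩ := exists_free_of_mem_UP hL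
  obtain ⟨p, -, M, hM, hb, prec, hprec, h⟩ := exists_of_mem_CLUSharpPCircular (h hf)
  obtain ⟨q, hq⟩ := hM.exists_length_le
  have hacc := PT.mem_acc hM
  have hpaths := PT.mem_paths hM
  -- A neighbour is allowed to equal `y`: this happens if there is only one path.
  let D : (Str × Str) × Str × Str → Bool := fun p =>
    (decide (p.2.1 ∈ M.acc p.1.1) && (decide (p.1.2 ∈ M.paths p.1.1) &&
      decide (p.2.2 ∈ M.paths p.1.1))) &&
    ((prec (p.1.1, p.1.2, p.2.1) && prec (p.1.1, p.2.1, p.2.2)) &&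
    ((decide (p.1.2 = p.2.1) || !decide (p.1.2 ∈ M.acc p.1.1)) &&
      (decide (p.2.2 = p.2.1) || !decide (p.2.2 ∈ M.acc p.1.1))))
  have hx : PT fun p : (Str × Str) × Str × Str => p.1.1 := PT.fst.comp .fst
  have hz₀ : PT fun p : (Str × Str) × Str × Str => p.1.2 := PT.snd.comp .fst
  have hy : PT fun p : (Str × Str) × Str × Str => p.2.1 := PT.fst.comp .snd
  have hz₁ : PT fun p : (Str × Str) × Str × Str => p.2.2 := PT.snd.comp .snd
  have hD : PT D := ((hacc.comp (hx.pair hy)).and ((hpaths.comp (hx.pair hz₀)).and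
    (hpaths.comp (hx.pair hz₁)))).and (((hprec.comp (hx.pair (hz₀.pair hy))).and
      (hprec.comp (hx.pair (hy.pair hz₁)))).and
      (((PT.decide_eq hz₀ hy).or (hacc.comp (hx.pair hz₀)).not).and
        ((PT.decide_eq hz₁ hy).or (hacc.comp (hx.pair hz₁)).not)))
  have hD_iff : ∀ x z₀ y z₁, D ((x, z₀), y, z₁) = true ↔ y ∈ M.acc x ∧ z₀ ∈ M.paths x ∧
      z₁ ∈ M.paths x ∧ prec (x, z₀, y) = true ∧ prec (x, y, z₁) = true ∧
      (z₀ = y ∨ z₀ ∉ M.acc x) ∧ (z₁ = y ∨ z₁ ∉ M.acc x) := by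
    intro x z₀ y z₁
    simp only [D, Bool.and_eq_true, Bool.or_eq_true, decide_eq_true_eq, Bool.not_eq_true',
      decide_eq_false_iff_not, and_assoc]
  let D' : Str × Str × Str → Bool := fun p => splitCert D ((p.1, p.2.1), p.2.2)
  have hD' : PT D' := (PT.splitCert hD).comp ((PT.fst.pair (PT.fst.comp .snd)).pair
    (PT.snd.comp .snd))
  have iff : ∀ x w, splitCert D' (x, w) = true ↔ ∃ z₀ y z₁, w = pairStr z₀ (pairStr y z₁) ∧
      D ((x, z₀), y, z₁) = true := by
    intro x w
    rw [splitCert_iff]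
    constructor
    · rintro ⟨z₀, v, rfl, h⟩
      obtain ⟨y, z₁, rfl, h⟩ := splitCert_iff.1 h
      exact ⟨z₀, y, z₁, rfl, h⟩
    · rintro ⟨z₀, y, z₁, rfl, h⟩
      exact ⟨z₀, _, rfl, splitCert_iff.2 ⟨y, z₁, rfl, h⟩⟩
  have hw : ∀ x w, w ∈ M.acc x → w ∈ words (p x.length) := fun x w hw => hb x ▸ M.acc_subset_paths x hw
  have single : ∀ x z₀ y z₁, D ((x, z₀), y, z₁) = true → M.acc x = {y} := by
    intro x z₀ y z₁ h1
    obtain ⟨h1, h2, h3, h4, h5, h6, h7⟩ := (hD_iff _ _ _ _).1 h1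
    obtain ⟨φ, h8, h9, h10, -⟩ := h x
    rw [hb x] at h2 h3
    exact eq_singleton_of_isolated h8 h10 h1 h2 h3 ((h9 _ h2 _ (hw x y h1)).1 h4)
      ((h9 _ (hw x y h1) _ h3).1 h5) h6 h7
  -- The code `pairStr z₀ (pairStr y z₁)` has length `2|z₀| + 2|y| + |z₁| + 2`.
  refine mem_UP (PT.splitCert hD') (5 * q + 2) (fun x w h1 => ?_) (fun x w w' h1 h2 => ?_)
    fun x => ⟨fun hx => ?_, ?_⟩
  · obtain ⟨z₀, y, z₁, rfl, h0⟩ := (iff x w).1 h1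
    obtain ⟨h1, h2, h3, -⟩ := (hD_iff _ _ _ _).1 h0
    have h4 := hq x _ h2
    have h5 := hq x _ h3
    have h6 := hq x _ (M.acc_subset_paths x h1)
    simp
    omega
  · obtain ⟨z₀, y, z₁, rfl, h0⟩ := (iff x w).1 h1
    obtain ⟨z₀', y', z₁', rfl, h0'⟩ := (iff x w').1 h2
    -- Both triples force the accepting set to be a singleton, hence have the same middle; the
    -- neighbours then agree because positions are injective.
    obtain rfl : y' = y := by
      have := (single _ _ _ _ h0).symm.trans (single _ _ _ _ h0')
      simpa using this.symm
    obtain ⟨φ, h8, h9, -⟩ := h x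
    obtain ⟨h1, h2, h3, h4, h5, -⟩ := (hD_iff _ _ _ _).1 h0
    obtain ⟨-, h2', h3', h4', h5', -⟩ := (hD_iff _ _ _ _).1 h0'
    rw [hb x] at h2 h3 h2' h3'
    have hy := hw x _ h1
    rw [h9 _ h2 _ hy] at h4
    rw [h9 _ h2' _ hy] at h4'
    rw [h9 _ hy _ h3] at h5
    rw [h9 _ hy _ h3'] at h5'
    have h6 : z₁ = z₁' := h8.injOn h3 h3' (h5.trans h5'.symm)
    have h7 : z₀ = z₀' := by
      refine h8.injOn h2 h2' ?_
      have h10 : φ z₀ < 2 ^ p x.length := h8.mapsTo h2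
      have h11 : φ z₀' < 2 ^ p x.length := h8.mapsTo h2'
      exact (Nat.ModEq.add_right_cancel' 1 (h4.symm.trans h4' : _ ≡ _ [MOD _])).eq_of_lt_of_lt
        h10 h11
    rw [h6, h7]
  · obtain ⟨φ, h8, h9, h10, h11⟩ := h x
    rw [(hfL x).2 hx] at h11
    obtain ⟨y, hy⟩ := Set.ncard_eq_one.1 h11.symm
    have hyA : y ∈ M.acc x := by simp [hy]
    have hyw := hw x y hyA
    have hpos : 0 < 2 ^ p x.length := by positivity
    obtain ⟨z₁, h1, h1'⟩ := h8.surjOn (Set.mem_Iio.2 (Nat.mod_lt (φ y + 1) hpos))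
    -- Adding `2 ^ n - 1` is subtracting `1` modulo `2 ^ n`, without truncation at `0`.
    obtain ⟨z₀, h0, h0'⟩ := h8.surjOn (Set.mem_Iio.2 (Nat.mod_lt (φ y + (2 ^ p x.length - 1)) hpos))
    refine ⟨_, (iff x _).2 ⟨z₀, y, z₁, rfl, (hD_iff _ _ _ _).2 ⟨hyA, hb x ▸ h0, hb x ▸ h1,
      (h9 _ h0 _ hyw).2 ?_, (h9 _ hyw _ h1).2 h1', ?_, ?_⟩⟩⟩
    · have h12 : φ y < 2 ^ p x.length := h8.mapsTo hyw
      rw [h0', Nat.mod_add_mod, show φ y + (2 ^ p x.length - 1) + 1 = φ y + 2 ^ p x.length by omega,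
        Nat.add_mod_right, Nat.mod_eq_of_lt h12]
    · rw [hy]; exact em _
    · rw [hy]; exact em _
  · rintro ⟨w, hw⟩ hx
    obtain ⟨z₀, y, z₁, rfl, h1⟩ := (iff x w).1 hw
    obtain ⟨φ, -, -, -, h11⟩ := h x
    rw [(hfL x).1 hx, NTM.numAcc, single _ _ _ _ h1, Set.ncard_singleton] at h11
    omega

/-! ### From `UP = coUP` to orders with computable ends. -/

/-! ### Certificates for the ends of an order -/

-- A neighbour `z` is its own unique certificate, so the codes of pairs `(x, y)` for which one
-- exists form a `UP` language. By hypothesis its complement is in `UP` too, and this provides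
-- unique certificates for having no neighbour.
open Classical in
theorem exists_cert_not (hUP : UP = coUP) {M : NTM} (hM : M.PolyTime)
    {R : Str × Str × Str → Bool} (hR : PT R) (hu : ∀ x, ∀ y ∈ M.paths x, ∀ z ∈ M.paths x,
      ∀ z' ∈ M.paths x, R (x, y, z) = true → R (x, y, z') = true → z = z') :
    ∃ (B : Str × Str × Str → Bool) (q : Polynomial ℕ), PT B ∧
      (∀ x y u, B (x, y, u) = true → y ∈ M.paths x ∧ u.length ≤ q.eval x.length) ∧
      (∀ x y u u', B (x, y, u) = true → B (x, y, u') = true → u = u') ∧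
      ∀ x, ∀ y ∈ M.paths x, (∃ u, B (x, y, u) = true) ↔ ¬ ∃ z ∈ M.paths x, R (x, y, z) = true := by
  have hp := PT.mem_paths hM
  obtain ⟨q, hq⟩ := hM.exists_length_le
  let E : Str × Str × Str → Bool := fun p =>
    (decide (p.2.2 ∈ M.paths p.2.1) && decide (p.1 ∈ M.paths p.2.1)) && R (p.2.1, p.2.2, p.1)
  have hE : PT E := ((hp.comp ((PT.fst.comp .snd).pair (PT.snd.comp .snd))).and
    (hp.comp ((PT.fst.comp .snd).pair .fst))).and
      (hR.comp ((PT.fst.comp .snd).pair ((PT.snd.comp .snd).pair .fst)))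
  have hE_iff : ∀ x y z, E (z, x, y) = true ↔ (y ∈ M.paths x ∧ z ∈ M.paths x) ∧
      R (x, y, z) = true := by
    intro x y z
    simp only [E, Bool.and_eq_true, decide_eq_true_eq]
  have h1 : {s | ∃ z, splitCert E (z, s) = true} ∈ UP := by
    refine mem_UP ((PT.splitCert hE).comp (PT.snd.pair .fst)) q (fun s z h => ?_)
      (fun s z z' h h' => ?_) fun s => Iff.rfl
    · obtain ⟨x, y, rfl, h⟩ := splitCert_iff.1 h
      refine (hq x z ((hE_iff _ _ _).1 h).1.2).trans (eval_mono q ?_)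
      rw [length_pairStr]
      omega
    · obtain ⟨x, y, rfl, h⟩ := splitCert_iff.1 h
      obtain ⟨x', y', h2, h'⟩ := splitCert_iff.1 h'
      obtain ⟨rfl, rfl⟩ := pairStr_inj.1 h2
      obtain ⟨⟨h3, h4⟩, h5⟩ := (hE_iff _ _ _).1 h
      obtain ⟨⟨-, h6⟩, h7⟩ := (hE_iff _ _ _).1 h'
      exact hu x y h3 z h4 z' h6 h5 h7
  rw [hUP] at h1
  obtain ⟨B, t, hB, ht, hBu, hBL⟩ := exists_of_mem_UP h1
  have hfst : PT fun p : Str × Str × Str => p.2.1 := PT.fst.comp .snd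
  have hsnd : PT fun p : Str × Str × Str => p.2.2 := PT.snd.comp .snd
  refine ⟨fun p => decide (p.2.1 ∈ M.paths p.1) && B (pairStr p.1 p.2.1, p.2.2),
    -- The bound `t` refers to the code of `(x, y)`, of length `2|x| + |y| + 1`, and `|y|` is at
    -- most `q`.
    t.comp (2 * .X + q + 1), (hp.comp (PT.fst.pair hfst)).and (hB.comp
      ((PT.pairStr .fst hfst).pair hsnd)), fun x y u h => ?_, fun x y u u' h h' => ?_,
    fun x y hy => ?_⟩
  · simp only [Bool.and_eq_true, decide_eq_true_eq] at h
    refine ⟨h.1, (ht _ _ h.2).trans ?_⟩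
    have := hq x y h.1
    rw [Polynomial.eval_comp]
    refine eval_mono t ?_
    simp
    omega
  · simp only [Bool.and_eq_true] at h h'
    exact hBu _ _ _ h.2 h'.2
  · have h2 := hBL (pairStr x y)
    simp only [hy, decide_true, Bool.true_and]
    rw [← h2, Set.mem_compl_iff, not_iff_not]
    constructor
    · rintro ⟨z, h⟩
      obtain ⟨x', y', h3, h⟩ := splitCert_iff.1 h
      obtain ⟨rfl, rfl⟩ := pairStr_inj.1 h3
      obtain ⟨⟨-, h4⟩, h5⟩ := (hE_iff _ _ _).1 h
      exact ⟨z, h4, h5⟩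
    · rintro ⟨z, hz, h⟩
      exact ⟨z, splitCert_iff.2 ⟨x, y, rfl, (hE_iff _ _ _).2 ⟨⟨hy, hz⟩, h⟩⟩⟩

/-- If `UP = coUP`, the first and the last string of an order with a decidable neighbourhood
relation have unique certificates. -/
theorem exists_ends (hUP : UP = coUP) {p : ℕ → ℕ} {M : NTM} (hM : M.PolyTime) (hb : M.Balanced p)
    {prec : Str × Str × Str → Bool} (hprec : PT prec)
    (h : ∀ x : Str, ∃ φ : Str → ℕ, IsPos (p x.length) φ ∧
      ∀ y ∈ words (p x.length), ∀ z ∈ words (p x.length),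
        (prec (x, y, z) = true ↔ φ z = φ y + 1)) :
    ∃ (V : Str × Str → Bool) (β τ : Str → Str) (r : Polynomial ℕ), PT V ∧ PT β ∧ PT τ ∧
      ∀ (x : Str) (φ : Str → ℕ), IsPos (p x.length) φ →
      (∀ y ∈ words (p x.length), ∀ z ∈ words (p x.length),
        (prec (x, y, z) = true ↔ φ z = φ y + 1)) →
      ∃ v ∈ words (r.eval x.length), (∀ v' ∈ words (r.eval x.length), V (x, v') = true ↔ v' = v) ∧
        β v ∈ words (p x.length) ∧ τ v ∈ words (p x.length) ∧
        φ (β v) = 0 ∧ φ (τ v) + 1 = 2 ^ p x.length := by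
  -- Being first means having no predecessor, so the arguments of `prec` are exchanged; the next
  -- application, to `prec` itself, describes being last.
  obtain ⟨B₁, q₁, hB₁, hq₁, hu₁, hL₁⟩ := exists_cert_not hUP hM
    (R := fun q => prec (q.1, q.2.2, q.2.1))
    (hprec.comp (PT.fst.pair ((PT.snd.comp .snd).pair (PT.fst.comp .snd)))) (by
      intro x y hy z hz z' hz' h1 h2
      obtain ⟨φ, hφ, h3⟩ := h x
      rw [hb x] at hy hz hz'
      simp only [h3 z hz y hy, h3 z' hz' y hy] at h1 h2
      exact hφ.injOn hz hz' (by omega))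
  obtain ⟨B₂, q₂, hB₂, hq₂, hu₂, hL₂⟩ := exists_cert_not hUP hM hprec (by
      intro x y hy z hz z' hz' h1 h2
      obtain ⟨φ, hφ, h3⟩ := h x
      rw [hb x] at hy hz hz'
      rw [h3 y hy z hz] at h1
      rw [h3 y hy z' hz'] at h2
      exact hφ.injOn hz hz' (by omega))
  obtain ⟨q, hq⟩ := hM.exists_length_le
  let D : Str × Str × Str → Bool := fun p =>
    splitCert B₁ (p.1, p.2.1) && splitCert B₂ (p.1, p.2.2)
  have hD : PT D := ((PT.splitCert hB₁).comp (PT.fst.pair (PT.fst.comp .snd))).and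
    ((PT.splitCert hB₂).comp (PT.fst.pair (PT.snd.comp .snd)))
  have hD_iff : ∀ x w, splitCert D (x, w) = true ↔ ∃ b u t u', w = pairStr (pairStr b u)
      (pairStr t u') ∧ B₁ (x, b, u) = true ∧ B₂ (x, t, u') = true := by
    intro x w
    rw [splitCert_iff]
    constructor
    · rintro ⟨w₁, w₂, rfl, h1⟩
      simp only [D, Bool.and_eq_true, splitCert_iff] at h1
      obtain ⟨⟨b, u, rfl, h1⟩, ⟨t, u', rfl, h2⟩⟩ := h1
      exact ⟨b, u, t, u', rfl, h1, h2⟩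
    · rintro ⟨b, u, t, u', rfl, h1, h2⟩
      refine ⟨_, _, rfl, ?_⟩
      simp only [D, Bool.and_eq_true, splitCert_iff]
      exact ⟨⟨b, u, rfl, h1⟩, ⟨t, u', rfl, h2⟩⟩
  have hun : PT fun v : Str => unpairStr (unpad v).2 := PT.unpairStr (PT.snd.comp (PT.unpad .id))
  refine ⟨fun p => (unpad p.2).1 && splitCert D (p.1, (unpad p.2).2),
    fun v => (unpairStr (unpairStr (unpad v).2).1).1,
    fun v => (unpairStr (unpairStr (unpad v).2).2).1,
    -- The code of the two ends and their certificates has length at most `6q + 2q₁ + q₂ + 4`, since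
    -- the first component of each pair counts twice; padding takes one more bit.
    6 * q + 2 * q₁ + q₂ + 5, (PT.fst.comp (PT.unpad .snd)).and ((PT.splitCert hD).comp
      (PT.fst.pair (PT.snd.comp (PT.unpad .snd)))),
    PT.fst.comp (PT.unpairStr (PT.fst.comp hun)), PT.fst.comp (PT.unpairStr (PT.snd.comp hun)),
    fun x φ hφ hp => ?_⟩
  have hpos : 0 < 2 ^ p x.length := by positivity
  obtain ⟨b, hb₁, hb₀⟩ := hφ.surjOn (Set.mem_Iio.2 hpos)
  obtain ⟨t, ht₁, ht₀⟩ := hφ.surjOn (Set.mem_Iio.2 (show 2 ^ p x.length - 1 < 2 ^ p x.length by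
    omega))
  have hbot : ∀ y ∈ M.paths x, (∃ u, B₁ (x, y, u) = true) ↔ y = b := by
    intro y hy
    rw [hL₁ x y hy]
    rw [hb x] at hy ⊢
    rw [← hφ.injOn.eq_iff hy hb₁, hb₀]
    constructor
    · intro h1
      by_contra h2
      have h3 : φ y < 2 ^ p x.length := hφ.mapsTo hy
      obtain ⟨z, hz, hz'⟩ := hφ.surjOn (Set.mem_Iio.2 (show φ y - 1 < 2 ^ p x.length by omega))
      exact h1 ⟨z, hz, (hp z hz y hy).2 (by omega)⟩
    · rintro h1 ⟨z, hz, h2⟩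
      have := (hp z hz y hy).1 h2
      omega
  have htop : ∀ y ∈ M.paths x, (∃ u, B₂ (x, y, u) = true) ↔ y = t := by
    intro y hy
    rw [hL₂ x y hy]
    rw [hb x] at hy ⊢
    rw [← hφ.injOn.eq_iff hy ht₁, ht₀]
    have h3 : φ y < 2 ^ p x.length := hφ.mapsTo hy
    constructor
    · intro h1
      by_contra h2
      obtain ⟨z, hz, hz'⟩ := hφ.surjOn (Set.mem_Iio.2 (show φ y + 1 < 2 ^ p x.length by omega))
      exact h1 ⟨z, hz, (hp y hy z hz).2 hz'⟩
    · rintro h1 ⟨z, hz, h2⟩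
      have h4 : φ z < 2 ^ p x.length := hφ.mapsTo hz
      have := (hp y hy z hz).1 h2
      omega
  have hbp : b ∈ M.paths x := hb x ▸ hb₁
  have htp : t ∈ M.paths x := hb x ▸ ht₁
  obtain ⟨u, hu⟩ := (hbot b hbp).2 rfl
  obtain ⟨u', hu'⟩ := (htop t htp).2 rfl
  have hlen : (pairStr (pairStr b u) (pairStr t u')).length <
      (6 * q + 2 * q₁ + q₂ + 5).eval x.length := by
    have h1 := hq x b hbp
    have h2 := hq x t htp
    have h3 := (hq₁ _ _ _ hu).2
    have h4 := (hq₂ _ _ _ hu').2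
    simp
    omega
  refine ⟨pad ((6 * q + 2 * q₁ + q₂ + 5).eval x.length) (pairStr (pairStr b u) (pairStr t u')),
    length_pad hlen, fun v' hv' => ⟨fun h1 => ?_, ?_⟩, ?_⟩
  · simp only [Bool.and_eq_true] at h1
    obtain ⟨b', w, t', w', h2, h3, h4⟩ := (hD_iff _ _).1 h1.2
    obtain rfl := (hbot b' (hq₁ _ _ _ h3).1).1 ⟨w, h3⟩
    obtain rfl := (htop t' (hq₂ _ _ _ h4).1).1 ⟨w', h4⟩
    obtain rfl := hu₁ _ _ _ _ h3 hu
    obtain rfl := hu₂ _ _ _ _ h4 hu'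
    have h5 := eq_pad_of_unpad (u := v') (Prod.ext h1.1 rfl)
    rw [show v'.length = _ from hv'] at h5
    exact h5.trans (congrArg (pad _) h2)
  · rintro rfl
    simp only [unpad_pad, Bool.true_and]
    exact (hD_iff _ _).2 ⟨b, u, t, u', rfl, hu, hu'⟩
  · simp only [unpad_pad, unpairStr_pairStr]
    exact ⟨hb₁, ht₁, hb₀, by omega⟩

/-! ### Making the ends explicit -/

/-- The two junk strings naming the certificate `v`. -/
def junk (Z v : Str) (b : Bool) : Str := true :: (v ++ (Z ++ [b]))

/-- The certificate in a junk string. -/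
def core (Z w : Str) : Str := (w.reverse.drop (false :: Z).length).reverse.tail

theorem core_junk (Z v : Str) (b : Bool) : core Z (junk Z v b) = v := by
  have h : (junk Z v b).reverse = (Z ++ [b]).reverse ++ (true :: v).reverse := by
    rw [← List.reverse_append]; rfl
  rw [core, h, List.drop_left' (by simp), List.reverse_reverse, List.tail_cons]

/-- The last bit makes the two junk words for `v` numerically consecutive, and the leading bit lifts
them above all old words. -/
theorem val_junk (Z v : Str) (b : Bool) : val (junk Z v b) =
    2 ^ (v.length + (Z.length + 1)) + val v * 2 ^ (Z.length + 1) + val Z * 2 + b.toNat := by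
  simp [junk, val, val_append]
  ring

section

variable (V : Str × Str → Bool) (β τ : Str → Str) (prec : Str × Str × Str → Bool) (R Z : Str → Str)

/-- Strings from the given order, prolonged by the prefix `R x`. -/
def isOld (p : Str × Str) : Bool := decide (p.2 = R p.1 ++ p.2.drop (R p.1).length)

/-- Junk strings naming a correct certificate. -/
def isJunk (b : Bool) (p : Str × Str) : Bool :=
  decide (p.2 = junk (Z p.1) (core (Z p.1) p.2) b) && V (p.1, core (Z p.1) p.2)

/-- The neighbourhood relation of the new order. -/
def endPrec (q : Str × Str × Str) : Bool :=
  -- Within the old words the given relation applies. The last old word precedes `junk true`, the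
  -- first one follows `junk false`; the ends are read from the certificate inside the junk word.
  -- All other words follow each other numerically, except that the step from `junk false` to `junk
  -- true` is cut.
  if isOld R (q.1, q.2.1) then
    if isOld R (q.1, q.2.2) then
      prec (q.1, q.2.1.drop (R q.1).length, q.2.2.drop (R q.1).length)
    else isJunk V Z true (q.1, q.2.2) &&
      decide (τ (core (Z q.1) q.2.2) = q.2.1.drop (R q.1).length)
  else
    if isOld R (q.1, q.2.2) then isJunk V Z false (q.1, q.2.1) &&
      decide (β (core (Z q.1) q.2.1) = q.2.2.drop (R q.1).length)
    else isSucc q.2.1 q.2.2 && !isJunk V Z false (q.1, q.2.1)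

variable {V β τ prec R Z}

theorem PT.isOld (hR : PT R) : PT (isOld R) :=
  PT.decide_eq .snd (PT.append (hR.comp .fst) (PT.drop (hR.comp .fst) .snd))

theorem PT.core (hZ : PT Z) : PT fun p : Str × Str => core (Z p.1) p.2 :=
  PT.tail (PT.reverse (PT.drop ((PT.const false).cons (hZ.comp .fst)) (PT.reverse .snd)))

theorem PT.isJunk (hV : PT V) (hZ : PT Z) (b : Bool) : PT (isJunk V Z b) := by
  have hc := PT.core hZ
  refine (PT.decide_eq .snd ((PT.const true).cons (hc.append ((hZ.comp .fst).append
    (.const [b]))))).and (hV.comp (PT.fst.pair hc))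

theorem PT.endPrec (hV : PT V) (hβ : PT β) (hτ : PT τ) (hprec : PT prec) (hR : PT R) (hZ : PT Z) :
    PT (endPrec V β τ prec R Z) := by
  have hy : PT fun p : Str × Str × Str => (p.1, p.2.1) := PT.fst.pair (PT.fst.comp .snd)
  have hz : PT fun p : Str × Str × Str => (p.1, p.2.2) := PT.fst.pair (PT.snd.comp .snd)
  have hd : PT fun p : Str × Str => p.2.drop (R p.1).length := PT.drop (hR.comp .fst) .snd
  have ho := PT.isOld hR
  have hc := PT.core hZ
  refine (ho.comp hy).ite ((ho.comp hz).ite (hprec.comp (PT.fst.pair ((hd.comp hy).pair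
    (hd.comp hz)))) (((PT.isJunk hV hZ true).comp hz).and (PT.decide_eq (hτ.comp (hc.comp hz))
    (hd.comp hy)))) ((ho.comp hz).ite (((PT.isJunk hV hZ false).comp hy).and
    (PT.decide_eq (hβ.comp (hc.comp hy)) (hd.comp hz))) ((PT.isSucc (PT.fst.comp .snd)
    (PT.snd.comp .snd)).and ((PT.isJunk hV hZ false).comp hy).not))

theorem isOld_iff {x w : Str} {m n : ℕ} (hR : R x = List.replicate m false)
    (hw : w ∈ words (m + n)) : isOld R (x, w) = true ↔ val w < 2 ^ n := by
  have hw' : w.length = m + n := hw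
  simp only [isOld, hR, decide_eq_true_eq, List.length_replicate]
  constructor
  · intro h
    rw [h, val_append]
    have := val_lt (w.drop m)
    simpa [hw'] using this
  · intro h
    obtain ⟨y, hy, hy'⟩ := (bijOn_val n).surjOn h
    have h1 : w = List.replicate m false ++ y :=
      val_inj (hw'.trans (by simp [show y.length = n from hy])) (by simp [val_append, hy'])
    conv_rhs => rw [h1, List.drop_left' (by simp)]
    exact h1

theorem isJunk_iff {x w v : Str} {n r : ℕ} (hZ : Z x = List.replicate n false)
    (hv : v ∈ words r) (hV : ∀ v' ∈ words r, V (x, v') = true ↔ v' = v) (b : Bool)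
    (hw : w ∈ words (r + 2 + n)) :
    isJunk V Z b (x, w) = true ↔ w = junk (Z x) v b := by
  have hw' : w.length = r + 2 + n := hw
  simp only [isJunk, Bool.and_eq_true, decide_eq_true_eq]
  constructor
  · rintro ⟨h1, h2⟩
    -- The certificate is unique only among words of length `r`, so the length of the core has to be
    -- determined before `hV` applies.
    have h3 := congrArg List.length h1
    rw [hw'] at h3
    simp [junk, hZ] at h3
    have h4 : core (List.replicate n false) w ∈ words r := by
      show List.length _ = r
      omega
    rw [← hZ] at h4
    rw [(hV _ h4).1 h2] at h1
    exact h1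
  · rintro rfl
    rw [core_junk]
    exact ⟨rfl, (hV v hv).2 rfl⟩

end

/-- The positions in the new order. -/
def endPos (m n j : ℕ) (φ : Str → ℕ) (w : Str) : ℕ :=
  -- With `j` the value of `junk false`, the words of value `2^n, …, j` come first, then the `2^n`
  -- old words fill the positions up to `j`, and larger values are their own positions.
  if val w < 2 ^ n then j - 2 ^ n + 1 + φ (w.drop m) else
    if val w ≤ j then val w - 2 ^ n else val w

theorem drop_mem_words {m n : ℕ} {w : Str} (hw : w ∈ words (m + n)) : w.drop m ∈ words n := by
  have : w.length = m + n := hw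
  simp [words, this]

theorem val_drop {m n : ℕ} {w : Str} (hw : w ∈ words (m + n)) (h : val w < 2 ^ n) :
    val (w.drop m) = val w := by
  have h1 := (isOld_iff (R := fun _ => List.replicate m false) (x := []) rfl hw).2 h
  simp only [isOld, decide_eq_true_eq, List.length_replicate] at h1
  conv_rhs => rw [h1, val_append]
  simp

theorem isPos_endPos {m n j : ℕ} {φ : Str → ℕ} (hφ : IsPos n φ) (hj : 2 ^ n ≤ j)
    (hj' : j < 2 ^ (m + n)) : IsPos (m + n) (endPos m n j φ) := by
  have hlt : ∀ w ∈ words (m + n), φ (w.drop m) < 2 ^ n := fun w hw => hφ.mapsTo (drop_mem_words hw)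
  refine bijOn_words (fun w hw => ?_) fun a ha b hb h => ?_
  · have h1 : val w < 2 ^ (m + n) := (bijOn_val _).mapsTo hw
    have h2 := hlt w hw
    simp only [Set.mem_Iio, endPos]
    split_ifs <;> omega
  · have h1 := hlt a ha
    have h2 := hlt b hb
    refine (bijOn_val _).injOn ha hb ?_
    simp only [endPos] at h
    split_ifs at h with h3 h4 h5 h6 h7 h8 h9
    · rw [← val_drop ha h3, ← val_drop hb h4, hφ.injOn (drop_mem_words ha) (drop_mem_words hb)
        (by omega)]
    all_goals omega

/-- Exactly one pair of junk words passes the test with `V`, so the insertion point `j` is verified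
without being computed. The four cases, according to which of the two words are old, reduce to
arithmetic of positions. -/
theorem endPrec_iff {V : Str × Str → Bool} {β τ : Str → Str} {prec : Str × Str × Str → Bool}
    {R Z : Str → Str} {x v : Str} {n r : ℕ} {φ : Str → ℕ} (hφ : IsPos n φ)
    (hprec : ∀ y ∈ words n, ∀ z ∈ words n, prec (x, y, z) = true ↔ φ z = φ y + 1)
    (hR : R x = List.replicate (r + 2) false) (hZ : Z x = List.replicate n false)
    (hv : v ∈ words r) (hV : ∀ v' ∈ words r, V (x, v') = true ↔ v' = v)
    (hβ : β v ∈ words n) (hτ : τ v ∈ words n) (hβ' : φ (β v) = 0) (hτ' : φ (τ v) + 1 = 2 ^ n)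
    {y z : Str} (hy : y ∈ words (r + 2 + n)) (hz : z ∈ words (r + 2 + n)) :
    endPrec V β τ prec R Z (x, y, z) = true ↔
      endPos (r + 2) n (val (junk (Z x) v false)) φ z =
        endPos (r + 2) n (val (junk (Z x) v false)) φ y + 1 := by
  set j := val (junk (Z x) v false) with hj
  have hv' : v.length = r := hv
  have hmem : ∀ b, junk (Z x) v b ∈ words (r + 2 + n) := by
    intro b
    simp [words, junk, hZ, hv']
    omega
  have hj1 : val (junk (Z x) v true) = j + 1 := by
    simp [hj, val_junk]
  have hjn : 2 ^ n ≤ j := by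
    rw [hj, val_junk, hZ, List.length_replicate]
    have : 2 ^ n ≤ 2 ^ (v.length + (n + 1)) := Nat.pow_le_pow_right (by omega) (by omega)
    omega
  have hjunk : ∀ b, ∀ w ∈ words (r + 2 + n), isJunk V Z b (x, w) = true ↔
      val w = val (junk (Z x) v b) := fun b w hw =>
    (isJunk_iff hZ hv hV b hw).trans ((bijOn_val _).injOn.eq_iff hw (hmem b)).symm
  have hcore : ∀ b, ∀ w ∈ words (r + 2 + n), isJunk V Z b (x, w) = true → core (Z x) w = v := by
    intro b w hw h
    rw [(isJunk_iff hZ hv hV b hw).1 h, core_junk]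
  have hy' := drop_mem_words hy
  have hz' := drop_mem_words hz
  have hyφ : φ (y.drop (r + 2)) < 2 ^ n := hφ.mapsTo hy'
  have hzφ : φ (z.drop (r + 2)) < 2 ^ n := hφ.mapsTo hz'
  have hlen : (R x).length = r + 2 := by simp [hR]
  simp only [endPrec, isOld_iff hR hy, isOld_iff hR hz, hlen, endPos]
  by_cases h1 : val y < 2 ^ n <;> by_cases h2 : val z < 2 ^ n <;> simp only [h1, h2, if_true, if_false]
  · rw [hprec _ hy' _ hz']
    omega
  · have h3 : (isJunk V Z true (x, z) && decide (τ (core (Z x) z) = y.drop (r + 2))) = true ↔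
        val z = j + 1 ∧ φ (y.drop (r + 2)) + 1 = 2 ^ n := by
      rw [Bool.and_eq_true, decide_eq_true_eq, ← hj1, ← hjunk true z hz]
      refine and_congr_right fun h => ?_
      rw [hcore true z hz h, ← hφ.injOn.eq_iff hτ hy']
      omega
    rw [h3]
    split_ifs <;> omega
  · have h3 : (isJunk V Z false (x, y) && decide (β (core (Z x) y) = z.drop (r + 2))) = true ↔
        val y = j ∧ φ (z.drop (r + 2)) = 0 := by
      rw [Bool.and_eq_true, decide_eq_true_eq, hjunk false y hy]
      refine and_congr_right fun h => ?_
      rw [hcore false y hy ((hjunk false y hy).2 h), ← hφ.injOn.eq_iff hβ hz']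
      omega
    rw [h3]
    split_ifs <;> omega
  · have h3 : (isSucc y z && !isJunk V Z false (x, y)) = true ↔ val z = val y + 1 ∧ val y ≠ j := by
      rw [Bool.and_eq_true, isSucc_iff hy hz, Bool.not_eq_true', ← Bool.not_eq_true,
        hjunk false y hy]
    rw [h3]
    split_ifs <;> omega

theorem PT.replicate_true {α : Type} [Code α] {f : α → Str} (hf : PT f) :
    PT fun a => List.replicate (f a).length true := by
  refine (hf.foldl_of_le (F := fun _ z _ => true :: z) (.const [])
    ((PT.const true).cons (PT.fst.comp .snd)) 1 (by simp)).congr fun a => ?_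
  simp

theorem CLUSharpPFree_subset_of_UP_eq_coUP (hUP : UP = coUP) : CLUSharpPFree ⊆ CLUSharpP := by
  classical
  intro f hf
  obtain ⟨p, hp, M, hM, hb, prec, hprec, h⟩ := mem_CLUSharpPFree_iff.1 hf
  obtain ⟨V, β, τ, r, hV, hβ, hτ, hends⟩ := exists_ends hUP hM hb hprec fun x => by
    obtain ⟨φ, h1, h2, -⟩ := h x
    exact ⟨φ, h1, h2⟩
  let R : Str → Str := fun x => List.replicate (r.eval x.length + 2) false
  let Z : Str → Str := fun x => List.replicate (p x.length) false
  have hR : PT R := (PT.clock PT.id (r + 2)).congr fun x => by simp [R]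
  have hZ : PT Z := PT.path_length hM hb
  have hd : PT fun p : Str × Str => p.2.drop (R p.1).length := PT.drop (hR.comp .fst) .snd
  -- The new machine accepts the old accepting paths behind the zero prefix. The order inside the
  -- old block is unchanged, so the interval and the count persist.
  obtain ⟨N, hN, hNp, hNa⟩ := exists_NTM (PT.append hR hZ)
    ((PT.isOld hR).and ((PT.mem_acc hM).comp (PT.fst.pair hd)))
  have hRZ : ∀ x, (R x ++ Z x).length = r.eval x.length + 2 + p x.length := fun x => by
    simp [R, Z]
  have hacc : ∀ x, N.acc x = (R x ++ ·) '' M.acc x := by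
    intro x
    rw [hNa]
    ext w
    simp only [hRZ, Bool.and_eq_true, decide_eq_true_eq, Set.mem_ofPred_eq, Set.mem_image, isOld]
    constructor
    · rintro ⟨-, h1, h2⟩
      exact ⟨_, h2, h1.symm⟩
    · rintro ⟨y, hy, rfl⟩
      have h1 : y.length = p x.length := by
        have := M.acc_subset_paths x hy
        rw [hb x] at this
        exact this
      simp [h1, R, hy]
  refine mem_CLUSharpP_of_isPos (p := fun k => r.eval k + 2 + p k) (M := N)
    -- This word has value `2 ^ p`, the least value of a word that is not old, hence position `0`.
    (bot := fun x => List.replicate ((r + 1).eval x.length) false ++ (true :: Z x))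
    (top := fun x => List.replicate (R x ++ Z x).length true) ?_ hN
    (fun x => by rw [hNp, hRZ]) (PT.append (PT.clock PT.id (r + 1)) ((PT.const true).cons hZ))
    (PT.replicate_true (hR.append hZ)) (PT.endPrec hV hβ hτ hprec hR hZ) fun x => ?_
  · obtain ⟨P, hP⟩ := hp
    obtain ⟨Q, hQ⟩ := isPolynomial_eval r
    exact ⟨Q + 2 + P, fun n => by simp [hP, hQ]⟩
  · obtain ⟨φ, h1, h2, h3, h4⟩ := h x
    obtain ⟨v, hv, hv', h5, h6, h7, h8⟩ := hends x φ h1 h2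
    have hv'' : v.length = r.eval x.length := hv
    set j := val (junk (Z x) v false) with hj
    have hjn : 2 ^ p x.length ≤ j := by
      rw [hj, val_junk, show (Z x).length = p x.length by simp [Z]]
      have : 2 ^ p x.length ≤ 2 ^ (v.length + (p x.length + 1)) :=
        Nat.pow_le_pow_right (by omega) (by omega)
      omega
    have hj1 : j + 1 < 2 ^ (r.eval x.length + 2 + p x.length) := by
      have h9 := val_lt (junk (Z x) v true)
      have h10 : (junk (Z x) v true).length = r.eval x.length + 2 + p x.length := by
        simp [junk, Z, hv'']
        omega
      rw [h10] at h9
      have h11 : val (junk (Z x) v true) = j + 1 := by simp [hj, val_junk]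
      omega
    have hbot : val (List.replicate ((r + 1).eval x.length) false ++ (true :: Z x)) =
        2 ^ p x.length := by
      simp [val_append, val, Z]
    have htop := val_replicate_true (r.eval x.length + 2 + p x.length)
    have hold : ∀ y ∈ words (p x.length), R x ++ y ∈ words (r.eval x.length + 2 + p x.length) ∧
        endPos (r.eval x.length + 2) (p x.length) j φ (R x ++ y) = j - 2 ^ p x.length + 1 + φ y := by
      intro y hy
      have hy' : y.length = p x.length := hy
      have h9 : val (R x ++ y) = val y := by simp [val_append, R]
      have h10 : val y < 2 ^ p x.length := (bijOn_val _).mapsTo hy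
      have h11 : (R x ++ y).drop (r.eval x.length + 2) = y := List.drop_left' (by simp [R])
      refine ⟨by simp [words, R, hy'], ?_⟩
      rw [endPos, h9, if_pos h10, h11]
    refine ⟨endPos (r.eval x.length + 2) (p x.length) j φ, isPos_endPos h1 hjn (by omega), ?_, ?_,
      ?_, ?_, fun y hy z hz => endPrec_iff h1 h2 rfl rfl hv hv' h5 h6 h7 h8 hy hz, ?_, ?_⟩
    · simp [words, Z]
      omega
    · rw [hRZ]; simp [words]
    · rw [endPos, hbot, if_neg (lt_irrefl _), if_pos hjn, Nat.sub_self]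
    · rw [hRZ, endPos, if_neg (by omega), if_neg (by omega), htop]
    · intro hA
      have hA' : M.acc x ≠ ∅ := by
        rintro h9
        rw [hacc, h9, Set.image_empty] at hA
        exact hA rfl
      obtain ⟨l, hl, u, hu, h9⟩ := h3 hA'
      refine ⟨_, (hold l hl).1, _, (hold u hu).1, ?_⟩
      rw [(hold l hl).2, (hold u hu).2, hacc, h9]
      have hu' : φ u < 2 ^ p x.length := h1.mapsTo hu
      ext w
      constructor
      · rintro ⟨y, ⟨hy, h10, h11⟩, rfl⟩
        refine ⟨(hold y hy).1, ?_⟩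
        simp only [(hold y hy).2]
        omega
      · rintro ⟨hw, h10, h11⟩
        -- The old words occupy the positions from `j - 2^p + 1` to `j`, so a word positioned
        -- between two of them is old.
        have h12 : val w < 2 ^ p x.length := by
          by_contra h12
          rw [endPos, if_neg h12] at h10 h11
          split_ifs at h10 h11 <;> omega
        have h13 := (isOld_iff (R := R) (x := x) rfl hw).2 h12
        simp only [isOld, decide_eq_true_eq] at h13
        rw [endPos, if_pos h12] at h10 h11
        refine ⟨w.drop (r.eval x.length + 2), ⟨drop_mem_words hw, by omega, by omega⟩, ?_⟩
        simpa [R] using h13.symm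
    · rw [h4, NTM.numAcc, NTM.numAcc, hacc,
        Set.ncard_image_of_injective _ fun a b hab => List.append_cancel_left hab]

end Cluster

theorem theoremt :
    List.TFAE [
      Cluster.UP = Cluster.coUP,
      Cluster.CLUSharpPFree = Cluster.CLUSharpP,
      Cluster.CLUSharpPFree ⊆ Cluster.CLUSharpPCircular] := by
  tfae_have 1 → 2 := fun h => Set.Subset.antisymm
    (Cluster.CLUSharpPFree_subset_of_UP_eq_coUP h) Cluster.CLUSharpP_subset_free
  tfae_have 2 → 3 := fun h => h ▸ Cluster.CLUSharpP_subset_circular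
  tfae_have 3 → 1 := fun h => by
    have h1 := Cluster.UP_subset_coUP_of_free_subset_circular h
    -- The inclusion of `UP` in `coUP`, applied to the complement, gives the converse.
    refine Set.Subset.antisymm h1 fun L hL => ?_
    have h2 : Lᶜᶜ ∈ Cluster.UP := h1 hL
    rwa [compl_compl] at h2
  tfae_finish
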